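/- **Setting.** Let $\mathcal{T}$ be a finite abstract three-dimensional triangulation (model tetrahedra whose faces are glued in pairs by simplicial isomorphisms), with realisation $|\mathcal{T}|$. Let $M$ be a compact connected smooth three-manifold with boundary, and suppose that $\mathcal{T}$ is an ideal triangulation of $M$: a homeomorphism is given from $M$ to $|\mathcal{T}|$ minus an open regular neighbourhood of the vertices. Suppose that $\mathcal{T}$ carries a taut angle structure: each edge of each model tetrahedron has a dihedral angle $0$ or $\pi$, such that for each edge of $\mathcal{T}$ the angles of its models sum to $2\pi$, and for each vertex of each model tetrahedron the angles of the three adjacent edges sum to $\pi$. (Then $\partial M$ is automatically a non-empty union of tori and Klein bottles.) The *equator* of a tetrahedron is the union of its edges with angle $0$. Suppose that, via the homeomorphism, the two-skeleton $\mathcal{B} = \mathcal{T}^{(2)}$ is a smooth branched surface in $M$ that obeys the dihedral angles. That is, the interiors of the faces are smooth neatly embedded surfaces; along each edge all incident faces are smooth sheets with a common tangent plane; and two faces of a model tetrahedron that meet in a model edge lie to the same side of the edge (in this tangent plane) if the angle there is $0$, and to opposite sides if it is $\pi$. Let $\delta$ be a smooth embedded loop in $M$ that is transverse to $\mathcal{B}$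 (where $\delta$ meets $\mathcal{B}$, its velocity is not in the tangent plane of $\mathcal{B}$). We call $\delta$ *vertical* with respect to $\mathcal{B}$ if it meets $\mathcal{B}$ and if, for every tetrahedron $t$, every arc $d$ of $\delta \cap t$ *links* the equator of $t$: the endpoints of $d$ do not lie on the equator and are separated by it in $\partial t$. **Theorem.** Any loop $\delta$ in $M$ which is vertical with respect to $\mathcal{B}$ is essential: it represents a non-trivial element of $\pi_1(M)$. -/

import Mathlib

open scoped Manifold ContDiff Topology

noncomputable section

namespace TautTri

/-- The model tetrahedron, in barycentric coordinates. Face `i` is `{x | x i = 0}`, and it is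
opposite to vertex `i`. -/
abbrev Simplex3 : Type := stdSimplex ℝ (Fin 4)

/-- An edge of the model tetrahedron, as a pair of vertices. -/
abbrev Edge : Type := {e : Finset (Fin 4) // e.card = 2}

/-- The simplicial isomorphism of the model tetrahedron induced by a permutation of its vertices:
vertex `j` goes to vertex `σ j`. -/
def permute (σ : Equiv.Perm (Fin 4)) (x : Simplex3) : Simplex3 :=
  ⟨fun j => x.1 (σ.symm j), fun j => x.2.1 _, by
    rw [Equiv.sum_comp σ.symm (fun j => x.1 j)]; exact x.2.2⟩

/-- An abstract three-dimensional triangulation with set of model tetrahedra `Tet`: the model faces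
are glued in pairs by simplicial isomorphisms. Face `i` of `t` is glued to face `gluing t i i` of
`adj t i`, and vertex `j ≠ i` of this face of `t` goes to vertex `gluing t i j`. -/
structure Triangulation (Tet : Type*) where
  adj : Tet → Fin 4 → Tet
  gluing : Tet → Fin 4 → Equiv.Perm (Fin 4)
  adj_adj : ∀ t i, adj (adj t i) (gluing t i i) = t
  gluing_gluing : ∀ t i, gluing (adj t i) (gluing t i i) = (gluing t i).symm
  ne_self : ∀ t i, (adj t i, gluing t i i) ≠ (t, i)

namespace Triangulation

variable {Tet : Type*} (T : Triangulation Tet)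

/-- The identification of points of model faces given by the face pairings. -/
inductive Glued : (Σ _ : Tet, Simplex3) → (Σ _ : Tet, Simplex3) → Prop
  | glue (t : Tet) (i : Fin 4) (x : Simplex3) (hx : x.1 i = 0) :
      Glued ⟨t, x⟩ ⟨T.adj t i, permute (T.gluing t i) x⟩

/-- The realisation space `|T|`, with the quotient topology. -/
abbrev Realisation : Type _ := Quot T.Glued

/-- The map of the model tetrahedron `t` to the realisation. -/
def proj (t : Tet) (x : Simplex3) : T.Realisation := Quot.mk _ ⟨t, x⟩

/-- The two-skeleton of the realisation. -/
def skeleton2 : Set T.Realisation := {p | ∃ t x, p = T.proj t x ∧ ∃ i, x.1 i = 0}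

/-- The one-skeleton of the realisation. -/
def skeleton1 : Set T.Realisation :=
  {p | ∃ t x, p = T.proj t x ∧ ∃ i j, i ≠ j ∧ x.1 i = 0 ∧ x.1 j = 0}

/-- An open regular neighbourhood of the vertices of the realisation. -/
def vertexNbhd : Set T.Realisation := {p | ∃ t x, p = T.proj t x ∧ ∃ i, 3 / 4 < x.1 i}

/-- The identification of model edges given by one face pairing. -/
def EdgeGlued (m m' : Tet × Edge) : Prop :=
  ∃ i, i ∉ m.2.1 ∧ m'.1 = T.adj m.1 i ∧
    m'.2.1 = m.2.1.map (T.gluing m.1 i).toEmbedding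

/-- Two model edges are models of the same edge of the triangulation. -/
def SameEdge : Tet × Edge → Tet × Edge → Prop := Relation.EqvGen T.EdgeGlued

open Classical in
/-- A taut angle structure: dihedral angles `0` or `π` at the model edges, satisfying the edge
equalities and the triangle equalities. -/
structure IsTautAngleStructure [Fintype Tet] (angle : Tet → Edge → ℝ) : Prop where
  zero_or_pi : ∀ t e, angle t e = 0 ∨ angle t e = Real.pi
  edge_eq : ∀ m : Tet × Edge,
    ∑ m' ∈ Finset.univ.filter (fun m' => T.SameEdge m m'), angle m'.1 m'.2 = 2 * Real.pi
  triangle_eq : ∀ (t : Tet) (v : Fin 4),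
    ∑ e ∈ (Finset.univ : Finset Edge).filter (fun e => v ∈ e.1), angle t e = Real.pi

end Triangulation

/-- The points of a model edge. -/
def edgePoints (e : Edge) : Set Simplex3 := {x | ∀ i, i ∉ e.1 → x.1 i = 0}

/-- The boundary of the model tetrahedron. -/
def simplexBoundary : Set Simplex3 := {x | ∃ i, x.1 i = 0}

/-- The equator of a model tetrahedron with the given dihedral angles: the union of its edges with
dihedral angle zero. -/
def equator (ang : Edge → ℝ) : Set Simplex3 := {x | ∃ e, ang e = 0 ∧ x ∈ edgePoints e}

/-- Two points of the boundary of the model tetrahedron are separated in it by the equator: they lie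
in different (path) components of the complement of the equator in the boundary. -/
def SeparatedByEquator (ang : Edge → ℝ) (x y : Simplex3) : Prop :=
  x ∈ simplexBoundary \ equator ang ∧ y ∈ simplexBoundary \ equator ang ∧
    ¬ JoinedIn (simplexBoundary \ equator ang) x y

/-- The parametrisation of a loop by the real line, with period one. -/
def param {M : Type*} [TopologicalSpace M] (δ : C(Circle, M)) (s : ℝ) : M :=
  δ (Circle.exp (2 * Real.pi * s))

/-- The loop as a path from its base point `δ 1` to itself. -/
def loopPath {M : Type*} [TopologicalSpace M] (δ : C(Circle, M)) : Path (δ 1) (δ 1) where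
  toFun s := param δ s
  continuous_toFun := by unfold param; fun_prop
  source' := by simp [param]
  target' := by simp [param]

section Manifold

variable {Tet : Type*} (T : Triangulation Tet) {M : Type*} [TopologicalSpace M]
  (h : M ≃ₜ ↥(T.vertexNbhdᶜ))

/-- The realisation of the two-skeleton in `M`. -/
def surf : Set M := {p | (h p : T.Realisation) ∈ T.skeleton2}

/-- The one-skeleton of `surf`, that is, its branch locus. -/
def locus : Set M := {p | (h p : T.Realisation) ∈ T.skeleton1}

/-- On `[a, b]` the loop `δ` runs in the model tetrahedron `t`, along `d`. -/
def RunsAlong (δ : C(Circle, M)) (t : Tet) (a b : ℝ) (d : ℝ → Simplex3) : Prop :=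
  ContinuousOn d (Set.Icc a b) ∧ ∀ s ∈ Set.Icc a b, T.proj t (d s) = h (param δ s)

/-- The arcs of `δ ∩ t`, as paths in the model tetrahedron: the maximal `d : [a, b] → t` along which
`δ` runs. (An arc may be a single point, `a = b`.) -/
structure IsArc (δ : C(Circle, M)) (t : Tet) (a b : ℝ) (d : ℝ → Simplex3) : Prop where
  le : a ≤ b
  runs : RunsAlong T h δ t a b d
  maximal : ∀ a' b' d', a' ≤ a → b ≤ b' → RunsAlong T h δ t a' b' d' →
    Set.EqOn d' d (Set.Icc a b) → a' = a ∧ b' = b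

variable [ChartedSpace (EuclideanHalfSpace 3) M]

/-- A chart `φ = (φ₀, φ₁, φ₂)` (where `φ₀ ≥ 0`, with equality on `∂M`) of the smooth manifold `M` at
the point `p` of the branched surface, in which the plane `{x₂ = 0}` is the tangent plane at `p`. -/
structure AdaptedChart (angle : Tet → Edge → ℝ)
    (φ : OpenPartialHomeomorph M (EuclideanHalfSpace 3)) (p : M) : Prop where
  mem_atlas : φ ∈ IsManifold.maximalAtlas (𝓡∂ 3) ∞ M
  mem_source : p ∈ φ.source
  /-- In the interior of a face, the branched surface is a smooth, neatly embedded surface. -/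
  face : p ∉ locus T h → ∀ q ∈ φ.source, q ∈ surf T h ↔ (φ q).1 2 = 0
  /-- At an edge, the edge is the axis `{x₁ = x₂ = 0}`. -/
  axis : p ∈ locus T h → ∀ q ∈ φ.source, q ∈ locus T h ↔ ((φ q).1 1 = 0 ∧ (φ q).1 2 = 0)
  /-- At an edge, each incident model face (face `i` of `t` at its point `x`) is a sheet that lies
  in a graph `x₂ = g (x₀, x₁)` tangent to `{x₂ = 0}` along the axis, over one of the two sides
  `{x₁ ≥ 0}`, `{x₁ ≤ 0}` of it. The two faces of a model tetrahedron at a model edge lie to the same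
  side if and only if the dihedral angle is zero (so they lie to opposite sides if it is `π`). -/
  sheets : p ∈ locus T h → ∃ side : Tet → Simplex3 → Fin 4 → ℝ,
    (∀ t x i, T.proj t x = h p → x.1 i = 0 →
      (side t x i = 1 ∨ side t x i = -1) ∧
      ∃ g : ℝ × ℝ → ℝ, ContDiff ℝ ∞ g ∧
        (∀ u, g (u, 0) = 0 ∧ deriv (fun v => g (u, v)) 0 = 0) ∧
        ∀ᶠ y in 𝓝 x, y.1 i = 0 → ∀ q ∈ φ.source, T.proj t y = h q →
          0 ≤ side t x i * (φ q).1 1 ∧ (φ q).1 2 = g ((φ q).1 0, (φ q).1 1)) ∧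
    (∀ t x i j, T.proj t x = h p → i ≠ j → x.1 i = 0 → x.1 j = 0 →
      ∀ e : Edge, i ∉ e.1 → j ∉ e.1 → (side t x i = side t x j ↔ angle t e = 0))

/-- The two-skeleton in `M` is a smooth branched surface that obeys the dihedral angles. -/
def IsBranchedSurface (angle : Tet → Edge → ℝ) : Prop :=
  ∀ p ∈ surf T h, ∃ φ, AdaptedChart T h angle φ p

/-- A smooth embedded loop. -/
structure IsSmoothEmbeddedLoop (δ : C(Circle, M)) : Prop where
  contMDiff : ContMDiff (𝓡 1) (𝓡∂ 3) ∞ δ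
  injective : Function.Injective δ
  immersion : ∀ z, Function.Injective (mfderiv (𝓡 1) (𝓡∂ 3) δ z)

/-- The loop `δ` is transverse to the branched surface: wherever they meet, the velocity of `δ` is not
in the tangent plane. -/
def IsTransverse (angle : Tet → Edge → ℝ) (δ : C(Circle, M)) : Prop :=
  ∀ s₀, param δ s₀ ∈ surf T h → ∃ φ, AdaptedChart T h angle φ (param δ s₀) ∧
    deriv (fun s => (φ (param δ s)).1 2) s₀ ≠ 0

/-- The loop `δ` is vertical with respect to the branched surface: it is a smooth embedded loop,
transverse to the branched surface, which it meets (so it is cut into arcs), and every arc of `δ` in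
every tetrahedron links the equator of that tetrahedron. -/
structure IsVertical (angle : Tet → Edge → ℝ) (δ : C(Circle, M)) : Prop where
  embedded : IsSmoothEmbeddedLoop δ
  transverse : IsTransverse T h angle δ
  meets : ∃ s, param δ s ∈ surf T h
  links : ∀ t a b d, IsArc T h δ t a b d → SeparatedByEquator (angle t) (d a) (d b)

end Manifold

end TautTri

end

/-!
Choose a coorientation of every tetrahedron, that is, call one of the two discs into which its equator
cuts its boundary the upper one. The faces of a disc are the two faces that meet in one of the two edges
with dihedral angle `π`. An arc that links the equator enters through one disc and leaves through the
other, so a vertical loop crosses the faces consistently with the coorientation that it carries along: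
it reads a non-empty *positive* word in letters for the cooriented faces. Around an edge of the
triangulation there are exactly two dihedral angles `π`, and the faces met on the two ways from one to
the other give two positive words, which are the two sides of a relation. Let `TautMatching.EdgeGroup` be
the group that these relations present. To cross a face changes a pair of a coorientation and an element
of this group: the coorientation is carried across, and the element is multiplied by a letter or by the
inverse of one, according to the direction (`TautMatching.cross`). The relations say that the holonomy
around an edge is trivial (`TautMatching.holonomy_eq_one`), so this defines a flat bundle over the
realisation without its vertices. If the loop is null-homotopic, its holonomy is trivial
(`Triangulation.exists_transport`), so that its positive word is trivial in the group.

This is impossible, by `PairedRelations.prod_ne_one`. Every letter is the first letter of exactly one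
side of exactly one relation (the face determines the tetrahedron below it, and so the edge with angle
`π` at which the side starts), and the last letter of at most one side. Suppose that a positive word is
trivial. By folding a finite part of the Cayley tree of the free group along finitely many relation
discs, one obtains a finite labelled graph with discs, in which the word is read along a closed curve,
and whose first rational cohomology vanishes, as it does for the tree. A vertex without outgoing arrows
can be removed without creating cohomology, because the arrows into it are each the last arrow of at most
one kind of side: this is where last letters are used. After all such vertices have been removed, the
closed curve still being there, every vertex has an outgoing arrow. A disc starts with two arrows that
start no other disc, so the arrows at a vertex outnumber the discs that start there; hence there are at
least as many arrows as vertices and discs together, and the Euler characteristic forces the cohomology to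
be non-zero.

The remaining part concerns the position of the loop. By transversality the loop meets the branched
surface in isolated points (`eventually_notMem_surf`). In between it lifts to the model tetrahedra. A
model of a crossing point that is on neither of the adjacent arcs would be an arc by itself, consisting of
one point, which does not link the equator. So at each crossing the loop passes through one face from one
model tetrahedron to the next (`glue_eq_of_links`), and the lifts are arcs (`isArc_of_links`).
-/

/-! ### Labelled graphs with positive relations -/

namespace TautTri

section Walks

variable {V A : Type*}

/-- A walk from `x` to `y`, as a list of arrows `(source, label, target)` in `E`. -/
def IsWalk (E : Set (V × A × V)) : V → List (V × A × V) → V → Prop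
  | x, [], y => x = y
  | x, e :: p, y => e ∈ E ∧ e.1 = x ∧ IsWalk E e.2.2 p y

/-- The word read along a list of arrows. -/
def labels (p : List (V × A × V)) : List A := p.map fun e => e.2.1

/-- A labelled graph in which a vertex and a label determine at most one outgoing and at most one
incoming arrow. -/
structure IsFolded (E : Set (V × A × V)) : Prop where
  target_eq : ∀ {x a y y'}, (x, a, y) ∈ E → (x, a, y') ∈ E → y = y'
  source_eq : ∀ {x x' a y}, (x, a, y) ∈ E → (x', a, y) ∈ E → x = x'

theorem IsWalk.mono {E E' : Set (V × A × V)} (h : E ⊆ E') :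
    ∀ {p : List (V × A × V)} {x y : V}, IsWalk E x p y → IsWalk E' x p y
  | [], _, _, hp => hp
  | _ :: _, _, _, hp => ⟨h hp.1, hp.2.1, hp.2.2.mono h⟩

theorem IsWalk.append {E : Set (V × A × V)} :
    ∀ {p q : List (V × A × V)} {x y : V},
      IsWalk E x (p ++ q) y ↔ ∃ z, IsWalk E x p z ∧ IsWalk E z q y
  | [], q, x, y => by simp [IsWalk]
  | e :: p, q, x, y => by simp [IsWalk, IsWalk.append (p := p), and_assoc]

theorem IsWalk.eq_of_labels_eq {E : Set (V × A × V)} (hE : IsFolded E) :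
    ∀ {p q : List (V × A × V)} {x y z : V}, IsWalk E x p y → IsWalk E x q z →
      labels p = labels q → p = q
  | [], [], _, _, _, _, _, _ => rfl
  | [], _ :: _, _, _, _, _, _, h => by simp [labels] at h
  | _ :: _, [], _, _, _, _, _, h => by simp [labels] at h
  | (u, a, v) :: p, (u', a', v') :: q, x, y, z, hp, hq, h => by
    simp only [labels, List.map_cons, List.cons.injEq] at h
    obtain ⟨rfl, h⟩ := h
    obtain ⟨h1, rfl, h2⟩ := hp
    obtain ⟨h1', h3, h2'⟩ := hq
    simp only at h3
    subst h3
    obtain rfl := hE.target_eq h1 h1'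
    rw [IsWalk.eq_of_labels_eq hE h2 h2' h]

theorem IsWalk.eq_of_labels_eq' {E : Set (V × A × V)} (hE : IsFolded E) {p q : List (V × A × V)}
    {x y z : V} (hp : IsWalk E x p z) (hq : IsWalk E y q z) (h : labels p = labels q) : p = q := by
  induction p using List.reverseRecOn generalizing q x y z with
  | nil =>
    rcases q with _ | ⟨e, q⟩
    · rfl
    · simp [labels] at h
  | append_singleton p e ih =>
    rcases List.eq_nil_or_concat' q with rfl | ⟨q, e', rfl⟩
    · simp [labels] at h
    · obtain ⟨u, a, v⟩ := e
      obtain ⟨u', a', v'⟩ := e'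
      simp only [labels, List.map_append, List.map_cons, List.map_nil,
        List.append_singleton_inj] at h
      obtain ⟨h, rfl⟩ := h
      obtain ⟨w, hp', h1, hw, h2⟩ := IsWalk.append.1 hp
      obtain ⟨w', hq', h1', hw', h2'⟩ := IsWalk.append.1 hq
      simp only [IsWalk] at hw hw' h2 h2'
      subst hw hw' h2 h2'
      obtain rfl := hE.source_eq h1 h1'
      rw [ih hp' hq' h]

/-- A walk that does not end at a vertex without outgoing arrows does not meet it after its start. -/
theorem IsWalk.avoid_sink {E : Set (V × A × V)} {v : V} (hv : ∀ e ∈ E, e.1 ≠ v) :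
    ∀ {p : List (V × A × V)} {x y : V}, IsWalk E x p y → y ≠ v →
      IsWalk {e ∈ E | e.2.2 ≠ v} x p y
  | [], _, _, hp, _ => hp
  | e :: p, x, y, hp, hy => by
    refine ⟨⟨hp.1, ?_⟩, hp.2.1, hp.2.2.avoid_sink hv hy⟩
    rcases p with _ | ⟨e', p⟩
    · obtain ⟨-, -, h⟩ := hp
      exact fun h' => hy (h.symm.trans h')
    · obtain ⟨-, -, h1, h2, -⟩ := hp
      exact fun h' => hv e' h1 (h2.trans h')

theorem IsWalk.mem {E : Set (V × A × V)} :
    ∀ {p : List (V × A × V)} {x y : V}, IsWalk E x p y → ∀ e ∈ p, e ∈ E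
  | [], _, _, _, _, he => by simp at he
  | _ :: _, _, _, hp, e, he => by
    rcases List.mem_cons.1 he with rfl | he
    · exact hp.1
    · exact hp.2.2.mem e he

end Walks

/-- Positive relations `W a = W (mate a)` whose words have first letters `a` and `mate a`: every
letter is the first letter of exactly one side of exactly one relation, and every letter is the
last letter of at most one side. -/
structure PairedRelations (A : Type*) where
  /-- The letters after the first one. -/
  tail : A → List A
  /-- The first letter of the other side of the relation. -/
  mate : A → A
  /-- A choice of one side in each relation. -/
  IsPos : A → Prop
  mate_mate : ∀ a, mate (mate a) = a
  isPos_mate : ∀ a, IsPos (mate a) ↔ ¬ IsPos a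
  last_injective : Function.Injective fun a => (a :: tail a).getLast (List.cons_ne_nil _ _)

namespace PairedRelations

variable {A : Type*} (P : PairedRelations A)

/-- The side with first letter `a`. -/
def word (a : A) : List A := a :: P.tail a

theorem word_ne_nil (a : A) : P.word a ≠ [] := List.cons_ne_nil _ _

theorem eq_of_last_eq {a b : A} {l l' : List A} {c : A} (h : l ++ [c] = P.word a)
    (h' : l' ++ [c] = P.word b) : a = b := by
  apply P.last_injective
  have h1 : (P.word a).getLast (P.word_ne_nil a) = c := by simp [← h]
  have h2 : (P.word b).getLast (P.word_ne_nil b) = c := by simp [← h']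
  exact h1.trans h2.symm

section Cocycles

variable {V : Type*}

/-- The cocycle condition on the two-complex obtained from a labelled graph by attaching a disc to
every closed curve that reads a relation. -/
def IsCocycle (E : Set (V × A × V)) (φ : V × A × V → ℚ) : Prop :=
  ∀ a x y p q, IsWalk E x p y → IsWalk E x q y → labels p = P.word a →
    labels q = P.word (P.mate a) → (p.map φ).sum = (q.map φ).sum

/-- Vanishing of the first rational cohomology group of that two-complex. -/
def H1Vanishes (E : Set (V × A × V)) : Prop :=
  ∀ φ, P.IsCocycle E φ → ∃ ψ : V → ℚ, ∀ e ∈ E, ψ e.2.2 = ψ e.1 + φ e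

open Classical in
/-- Removing a vertex without outgoing arrows from a folded graph preserves the vanishing of the
first cohomology: a cocycle extends to the arrows into this vertex. -/
theorem H1Vanishes.remove_sink {E : Set (V × A × V)} (hE : IsFolded E) (h : P.H1Vanishes E) {v : V}
    (hv : ∀ e ∈ E, e.1 ≠ v) : P.H1Vanishes {e ∈ E | e.2.2 ≠ v} := by
  intro φ hφ
  set E' : Set (V × A × V) := {e ∈ E | e.2.2 ≠ v} with hE'
  have hsub : E' ⊆ E := fun e he => he.1
  -- The extension makes the sum of the cocycle along every side of a relation ending at `v` zero.
  let B : V × A × V → List (V × A × V) → Prop := fun e p =>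
    ∃ a x, IsWalk E x p e.1 ∧ labels p ++ [e.2.1] = P.word a
  let φ' : V × A × V → ℚ := fun e =>
    if e.2.2 = v then (if hb : ∃ p, B e p then -(hb.choose.map φ).sum else 0) else φ e
  have hφ' : ∀ e ∈ E', φ' e = φ e := fun e he => if_neg he.2
  have hsame : ∀ {p : List (V × A × V)} {x y}, IsWalk E x p y → y ≠ v →
      (p.map φ').sum = (p.map φ).sum := fun hp hy => by
    congr 1
    exact List.map_congr_left fun e he => hφ' e ((hp.avoid_sink hv hy).mem e he)
  have hzero : ∀ {p : List (V × A × V)} {x a}, IsWalk E x p v → labels p = P.word a →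
      (p.map φ').sum = 0 := fun {p x a} hp hl => by
    rcases List.eq_nil_or_concat' p with rfl | ⟨p, e, rfl⟩
    · exact absurd hl.symm (P.word_ne_nil a)
    · obtain ⟨w, hp, h1, rfl, h2⟩ := IsWalk.append.1 hp
      simp only [IsWalk] at h2
      have hb : ∃ p, B e p := ⟨p, a, x, hp, by simpa [labels] using hl⟩
      have hc : hb.choose = p := by
        obtain ⟨b, y, hq, hl'⟩ := hb.choose_spec
        have hl2 : labels p ++ [e.2.1] = P.word a := by simpa [labels] using hl
        have hab := P.eq_of_last_eq hl' hl2
        subst hab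
        refine IsWalk.eq_of_labels_eq' hE hq hp ?_
        exact List.append_cancel_right (hl'.trans hl2.symm)
      have h3 : φ' e = -(p.map φ).sum := by
        simp only [φ']
        rw [if_pos h2, dif_pos hb, hc]
      rw [List.map_append, List.sum_append, hsame hp (hv e h1)]
      simp [h3]
  obtain ⟨ψ, hψ⟩ := h φ' fun a x y p q hp hq hlp hlq => by
    by_cases hy : y = v
    · subst hy
      rw [hzero hp hlp, hzero hq hlq]
    · rw [hsame hp hy, hsame hq hy]
      exact hφ a x y p q (hp.avoid_sink hv hy) (hq.avoid_sink hv hy) hlp hlq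
  exact ⟨ψ, fun e he => by rw [hψ e he.1, hφ' e he]⟩

open Classical in
/-- In a finite folded graph in which every vertex has an outgoing arrow, there are at least as many
arrows as vertices and relation discs together. So the first cohomology does not vanish. -/
theorem not_h1Vanishes_of_forall_exists_out {V₀ : Finset V} {E : Finset (V × A × V)}
    (hne : V₀.Nonempty) (hs : ∀ e ∈ E, e.1 ∈ V₀) (ht : ∀ e ∈ E, e.2.2 ∈ V₀)
    (hE : IsFolded (E : Set (V × A × V))) (hout : ∀ v ∈ V₀, ∃ e ∈ E, e.1 = v) :
    ¬ P.H1Vanishes (E : Set (V × A × V)) := by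
  intro h
  let Cell : V × A → List (V × A × V) × List (V × A × V) → Prop := fun c r =>
    ∃ y, IsWalk (E : Set (V × A × V)) c.1 r.1 y ∧ IsWalk (E : Set (V × A × V)) c.1 r.2 y ∧
      labels r.1 = P.word c.2 ∧ labels r.2 = P.word (P.mate c.2)
  let C : Finset (V × A) :=
    (E.image fun e => (e.1, e.2.1)).filter fun c => P.IsPos c.2 ∧ ∃ r, Cell c r
  have hC : ∀ c ∈ C, P.IsPos c.2 ∧ ∃ r, Cell c r := fun c hc => (Finset.mem_filter.1 hc).2
  have hfirst : ∀ {x : V} {p : List (V × A × V)} {y : V} {a : A},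
      IsWalk (E : Set (V × A × V)) x p y → labels p = P.word a →
      ∃ z, (x, a, z) ∈ E := fun {x p y a} hp hl => by
    rcases p with _ | ⟨⟨u, b, w⟩, p⟩
    · exact absurd hl.symm (P.word_ne_nil a)
    · simp only [labels, List.map_cons, word, List.cons.injEq] at hl
      obtain ⟨h1, h2, -⟩ := hp
      simp only at h2
      rw [← h2, ← hl.1]
      exact ⟨w, h1⟩
  -- The count: a disc is charged to the first arrow of its negative side, a vertex to another arrow.
  have hcount : C.card + V₀.card ≤ E.card := by
    have hg : ∀ c ∈ C, ∃ z, (c.1, P.mate c.2, z) ∈ E := fun c hc => by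
      obtain ⟨-, r, y, -, hq, -, hl⟩ := hC c hc
      exact hfirst hq hl
    have : Nonempty V := ⟨hne.choose⟩
    choose! g hg using hg
    let G : V × A → V × A × V := fun c => (c.1, P.mate c.2, g c)
    have hGE : C.image G ⊆ E := Finset.image_subset_iff.2 hg
    have hGinj : Set.InjOn G C := fun c _ c' _ hcc => by
      simp only [G, Prod.mk.injEq] at hcc
      refine Prod.ext hcc.1 ?_
      rw [← P.mate_mate c.2, hcc.2.1, P.mate_mate]
    have hV : V₀ ⊆ (E \ C.image G).image fun e => e.1 := fun v hv => by
      obtain ⟨e, he, rfl⟩ := hout v hv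
      by_cases heG : e ∈ C.image G
      · obtain ⟨c, hc, rfl⟩ := Finset.mem_image.1 heG
        obtain ⟨hpos, r, y, hp, -, hl, -⟩ := hC c hc
        obtain ⟨z, hz⟩ := hfirst hp hl
        refine Finset.mem_image.2 ⟨_, Finset.mem_sdiff.2 ⟨hz, fun hmem => ?_⟩, rfl⟩
        obtain ⟨c', hc', heq⟩ := Finset.mem_image.1 hmem
        simp only [G, Prod.mk.injEq] at heq
        rw [← heq.2.1] at hpos
        exact (P.isPos_mate _).1 hpos (hC c' hc').1
      · exact Finset.mem_image.2 ⟨e, Finset.mem_sdiff.2 ⟨he, heG⟩, rfl⟩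
    have h1 := (Finset.card_le_card hV).trans Finset.card_image_le
    rw [Finset.card_sdiff_of_subset hGE, Finset.card_image_of_injOn hGinj] at h1
    have h2 := Finset.card_le_card hGE
    rw [Finset.card_image_of_injOn hGinj] at h2
    omega
  have hr : ∀ c : C, ∃ r, Cell c.1 r := fun c => (hC c.1 c.2).2
  choose r hr using hr
  let ext : V × A × V → ((E → ℚ) →ₗ[ℚ] ℚ) := fun e =>
    if he : e ∈ E then LinearMap.proj ⟨e, he⟩ else 0
  let L : (E → ℚ) →ₗ[ℚ] (C → ℚ) :=
    LinearMap.pi fun c => ((r c).1.map ext).sum - ((r c).2.map ext).sum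
  let D : (V₀ → ℚ) →ₗ[ℚ] (E → ℚ) :=
    LinearMap.pi fun e => LinearMap.proj ⟨e.1.2.2, ht e.1 e.2⟩ - LinearMap.proj ⟨e.1.1, hs e.1 e.2⟩
  have happ : ∀ (l : List (V × A × V)) (f : E → ℚ),
      (l.map ext).sum f = (l.map fun e => ext e f).sum := fun l f => by
    induction l with
    | nil => simp
    | cons e l ih => simp [ih]
  have hLD : LinearMap.ker L ≤ LinearMap.range D := by
    intro f hf
    have hf' : ∀ c : C, ((r c).1.map fun e => ext e f).sum = ((r c).2.map fun e => ext e f).sum := by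
      intro c
      have := congrFun (LinearMap.mem_ker.1 hf) c
      simpa [L, happ, sub_eq_zero] using this
    have key : ∀ a x y p q, P.IsPos a → IsWalk (E : Set (V × A × V)) x p y →
        IsWalk (E : Set (V × A × V)) x q y → labels p = P.word a →
        labels q = P.word (P.mate a) →
        (p.map fun e => ext e f).sum = (q.map fun e => ext e f).sum := by
      intro a x y p q ha hp hq hlp hlq
      obtain ⟨z, hz⟩ := hfirst hp hlp
      have hc : (x, a) ∈ C := Finset.mem_filter.2
        ⟨Finset.mem_image.2 ⟨_, hz, rfl⟩, ha, ⟨p, q⟩, y, hp, hq, hlp, hlq⟩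
      obtain ⟨y', hp', hq', hlp', hlq'⟩ := hr ⟨(x, a), hc⟩
      rw [IsWalk.eq_of_labels_eq hE hp hp' (hlp.trans hlp'.symm),
        IsWalk.eq_of_labels_eq hE hq hq' (hlq.trans hlq'.symm)]
      exact hf' ⟨(x, a), hc⟩
    obtain ⟨ψ, hψ⟩ := h (fun e => ext e f) fun a x y p q hp hq hlp hlq => by
      by_cases ha : P.IsPos a
      · exact key a x y p q ha hp hq hlp hlq
      · exact (key (P.mate a) x y q p ((P.isPos_mate a).2 ha) hq hp hlq
          (by rw [P.mate_mate, hlp])).symm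
    refine ⟨fun v => ψ v.1, ?_⟩
    ext ⟨e, he⟩
    have := hψ e he
    have hext : ext e f = f ⟨e, he⟩ := by simp [ext, he]
    simp only [D, LinearMap.pi_apply, LinearMap.sub_apply, LinearMap.proj_apply]
    rw [this, hext]
    ring
  have h1 := LinearMap.finrank_range_add_finrank_ker L
  have h2 := LinearMap.finrank_range_add_finrank_ker D
  have h3 := Submodule.finrank_mono hLD
  have h4 : Module.finrank ℚ (LinearMap.range L) ≤ C.card := by
    simpa using (LinearMap.range L).finrank_le
  have h5 : 0 < Module.finrank ℚ (LinearMap.ker D) := by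
    obtain ⟨v, hv⟩ := hne
    have : Nontrivial (LinearMap.ker D) := by
      refine ⟨⟨⟨fun _ => 1, ?_⟩, 0, fun h0 => ?_⟩⟩
      · ext e
        simp [D]
      · simpa using congrFun (congrArg Subtype.val h0) ⟨v, hv⟩
    exact Module.finrank_pos
  simp only [Module.finrank_fintype_fun_eq_card, Fintype.card_coe] at h1 h2
  omega

open Classical in
/-- A finite folded graph with vanishing first cohomology has no set of vertices from which one can
walk forever. -/
theorem H1Vanishes.eq_empty_of_forall_exists_out {E : Finset (V × A × V)}
    (h : P.H1Vanishes (E : Set (V × A × V))) (hE : IsFolded (E : Set (V × A × V)))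
    {X : Set V} (hX : ∀ x ∈ X, ∃ e ∈ E, e.1 = x ∧ e.2.2 ∈ X) : X = ∅ := by
  by_contra hne
  obtain ⟨x₀, hx₀⟩ := Set.nonempty_iff_ne_empty.2 hne
  suffices H : ∀ (n : ℕ) (V₀ : Finset V) (E : Finset (V × A × V)), V₀.card = n →
      P.H1Vanishes (E : Set (V × A × V)) → IsFolded (E : Set (V × A × V)) →
      (∀ e ∈ E, e.1 ∈ V₀) → (∀ e ∈ E, e.2.2 ∈ V₀) →
      (∀ x ∈ X, ∃ e ∈ E, e.1 = x ∧ e.2.2 ∈ X) → False by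
    refine H _ (E.image (fun e => e.1) ∪ E.image fun e => e.2.2) E rfl h hE (fun e he => ?_)
      (fun e he => ?_) hX
    · exact Finset.mem_union_left _ (Finset.mem_image_of_mem (fun e : V × A × V => e.1) he)
    · exact Finset.mem_union_right _ (Finset.mem_image_of_mem (fun e : V × A × V => e.2.2) he)
  clear h hE hX E
  intro n
  induction n with
  | zero =>
    intro V₀ E hn _ _ hs _ hX
    obtain ⟨e, he, -⟩ := hX x₀ hx₀
    rw [Finset.card_eq_zero] at hn
    simpa [hn] using hs e he
  | succ n ih =>
    intro V₀ E hn h hE hs ht hX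
    by_cases hout : ∀ v ∈ V₀, ∃ e ∈ E, e.1 = v
    · obtain ⟨e, he, -⟩ := hX x₀ hx₀
      exact P.not_h1Vanishes_of_forall_exists_out ⟨_, hs e he⟩ hs ht hE hout h
    · push Not at hout
      obtain ⟨v, hv, hsink⟩ := hout
      have hcoe : ((E.filter fun e => e.2.2 ≠ v : Finset _) : Set (V × A × V)) =
          {e ∈ (E : Set (V × A × V)) | e.2.2 ≠ v} := by ext; simp
      refine ih (V₀.erase v) (E.filter fun e => e.2.2 ≠ v) ?_ ?_ ?_ ?_ ?_ ?_
      · rw [Finset.card_erase_of_mem hv, hn]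
        rfl
      · rw [hcoe]
        exact h.remove_sink P hE (fun e he => hsink e he)
      · rw [hcoe]
        exact ⟨fun h1 h2 => hE.target_eq h1.1 h2.1, fun h1 h2 => hE.source_eq h1.1 h2.1⟩
      · intro e he
        rw [Finset.mem_filter] at he
        exact Finset.mem_erase.2 ⟨hsink e he.1, hs e he.1⟩
      · intro e he
        rw [Finset.mem_filter] at he
        exact Finset.mem_erase.2 ⟨he.2, ht e he.1⟩
      · intro x hx
        obtain ⟨e, he, h1, h2⟩ := hX x hx
        refine ⟨e, Finset.mem_filter.2 ⟨he, fun h3 => ?_⟩, h1, h2⟩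
        obtain ⟨e', he', h4, -⟩ := hX _ h2
        exact hsink e' he' (h4.trans h3)

end Cocycles

end PairedRelations

end TautTri

/-! ### Groups with paired positive relations -/

namespace TautTri

namespace PairedRelations

variable {A : Type*} (P : PairedRelations A)

/-- The relators `W a (W (mate a))⁻¹`. -/
def relators : Set (FreeGroup A) :=
  Set.range fun a => ((P.word a).map FreeGroup.of).prod *
    (((P.word (P.mate a)).map FreeGroup.of).prod)⁻¹

/-- The group presented by the positive relations. -/
abbrev Group : Type _ := PresentedGroup P.relators

theorem prod_word_mate (a : A) :
    ((P.word (P.mate a)).map (PresentedGroup.of (rels := P.relators))).prod =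
      ((P.word a).map (PresentedGroup.of (rels := P.relators))).prod := by
  have h : (PresentedGroup.mk P.relators) (((P.word a).map FreeGroup.of).prod *
    (((P.word (P.mate a)).map FreeGroup.of).prod)⁻¹) = 1 :=
    PresentedGroup.one_of_mem ⟨a, rfl⟩
  rw [map_mul, map_inv, mul_inv_eq_one, map_list_prod, map_list_prod, List.map_map,
    List.map_map] at h
  exact h.symm

/-- The edges of the Cayley tree of the free group along which a positive word is read. -/
def trail : FreeGroup A → List A → List (FreeGroup A × A)
  | _, [] => []
  | g, a :: l => (g, a) :: trail (g * FreeGroup.of a) l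

/-- The identifications of vertices of the Cayley tree that result from a set `S` of edges of it, when
a disc is attached to each pair of trails in `S` that read the sides of a relation from the same vertex,
and the result is folded. -/
inductive Fold (S : Set (FreeGroup A × A)) : FreeGroup A → FreeGroup A → Prop
  | refl (g) : Fold S g g
  | symm {g h} : Fold S g h → Fold S h g
  | trans {g h k} : Fold S g h → Fold S h k → Fold S g k
  | disc (g a) : (∀ e ∈ trail g (P.word a), e ∈ S) → (∀ e ∈ trail g (P.word (P.mate a)), e ∈ S) →
      Fold S (g * ((P.word a).map FreeGroup.of).prod)
        (g * ((P.word (P.mate a)).map FreeGroup.of).prod)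
  | target {g h a} : Fold S g h → (g, a) ∈ S → (h, a) ∈ S →
      Fold S (g * FreeGroup.of a) (h * FreeGroup.of a)
  | source {g h a} : Fold S (g * FreeGroup.of a) (h * FreeGroup.of a) → (g, a) ∈ S → (h, a) ∈ S →
      Fold S g h

variable {P}

theorem Fold.mono {S S' : Set (FreeGroup A × A)} (hS : S ⊆ S') {g h : FreeGroup A}
    (hgh : P.Fold S g h) : P.Fold S' g h := by
  induction hgh with
  | refl g => exact .refl g
  | symm _ ih => exact ih.symm
  | trans _ _ ih ih' => exact ih.trans ih'
  | disc g a h1 h2 => exact .disc g a (fun e he => hS (h1 e he)) (fun e he => hS (h2 e he))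
  | target _ h1 h2 ih => exact ih.target (hS h1) (hS h2)
  | source _ h1 h2 ih => exact ih.source (hS h1) (hS h2)

theorem trail_mul_left (k g : FreeGroup A) (l : List A) :
    trail (k * g) l = (trail g l).map fun e => (k * e.1, e.2) := by
  induction l generalizing g with
  | nil => rfl
  | cons a l ih => simp [trail, ← ih, mul_assoc]

/-- The folding is equivariant under left translation of the Cayley tree. -/
theorem Fold.mul_left {S : Set (FreeGroup A × A)} (k : FreeGroup A) {g h : FreeGroup A}
    (hgh : P.Fold S g h) : P.Fold ((fun e => (k * e.1, e.2)) '' S) (k * g) (k * h) := by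
  induction hgh with
  | refl g => exact .refl _
  | symm _ ih => exact ih.symm
  | trans _ _ ih ih' => exact ih.trans ih'
  | disc g a h1 h2 =>
    rw [← mul_assoc, ← mul_assoc]
    refine .disc _ a (fun e he => ?_) (fun e he => ?_)
    · rw [trail_mul_left, List.mem_map] at he
      obtain ⟨e', he', rfl⟩ := he
      exact ⟨e', h1 e' he', rfl⟩
    · rw [trail_mul_left, List.mem_map] at he
      obtain ⟨e', he', rfl⟩ := he
      exact ⟨e', h2 e' he', rfl⟩
  | @target g h a _ h1 h2 ih =>
    rw [← mul_assoc, ← mul_assoc]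
    exact ih.target ⟨_, h1, rfl⟩ ⟨_, h2, rfl⟩
  | @source g h a _ h1 h2 ih =>
    rw [← mul_assoc, ← mul_assoc] at ih
    exact ih.source ⟨_, h1, rfl⟩ ⟨_, h2, rfl⟩

variable (P) in
/-- Two elements of the free group are identified by folding a finite set of edges. -/
def FinFold (g h : FreeGroup A) : Prop := ∃ S : Set (FreeGroup A × A), S.Finite ∧ P.Fold S g h

theorem FinFold.symm {g h : FreeGroup A} : P.FinFold g h → P.FinFold h g :=
  fun ⟨S, hS, hgh⟩ => ⟨S, hS, hgh.symm⟩

theorem FinFold.trans {g h k : FreeGroup A} : P.FinFold g h → P.FinFold h k → P.FinFold g k :=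
  fun ⟨S, hS, h1⟩ ⟨S', hS', h2⟩ => ⟨S ∪ S', hS.union hS',
    (h1.mono Set.subset_union_left).trans (h2.mono Set.subset_union_right)⟩

theorem FinFold.mul_left (k : FreeGroup A) {g h : FreeGroup A} :
    P.FinFold g h → P.FinFold (k * g) (k * h) :=
  fun ⟨_, hS, hgh⟩ => ⟨_, hS.image _, hgh.mul_left k⟩

theorem FinFold.mul_right {g h : FreeGroup A} (hgh : P.FinFold g h) (k : FreeGroup A) :
    P.FinFold (g * k) (h * k) := by
  induction k using FreeGroup.induction_on generalizing g h with
  | C1 => simpa using hgh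
  | of a =>
    obtain ⟨S, hS, hgh⟩ := hgh
    exact ⟨S ∪ {(g, a), (h, a)}, hS.union (Set.toFinite _),
      (hgh.mono Set.subset_union_left).target (by simp) (by simp)⟩
  | inv_of a _ =>
    obtain ⟨S, hS, hgh⟩ := hgh
    refine ⟨S ∪ {(g * (FreeGroup.of a)⁻¹, a), (h * (FreeGroup.of a)⁻¹, a)},
      hS.union (Set.toFinite _), .source (a := a) ?_ (by simp) (by simp)⟩
    rw [inv_mul_cancel_right, inv_mul_cancel_right]
    exact hgh.mono Set.subset_union_left
  | mul x y hx hy =>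
    rw [← mul_assoc, ← mul_assoc]
    exact hy (hx hgh)

theorem finFold_relator (a : A) : P.FinFold 1 (((P.word a).map FreeGroup.of).prod *
    (((P.word (P.mate a)).map FreeGroup.of).prod)⁻¹) := by
  have h : P.FinFold ((P.word a).map FreeGroup.of).prod
      ((P.word (P.mate a)).map FreeGroup.of).prod := by
    refine ⟨{e | e ∈ trail 1 (P.word a)} ∪ {e | e ∈ trail 1 (P.word (P.mate a))},
      (List.finite_toSet _).union (List.finite_toSet _), ?_⟩
    simpa using Fold.disc (P := P) 1 a (S := {e | e ∈ trail 1 (P.word a)} ∪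
      {e | e ∈ trail 1 (P.word (P.mate a))}) (fun e he => Or.inl he) (fun e he => Or.inr he)
  simpa using (h.mul_right (((P.word (P.mate a)).map FreeGroup.of).prod)⁻¹).symm

/-- A relation in the presented group results from folding finitely many edges and discs. -/
theorem finFold_of_mem_normalClosure {g : FreeGroup A}
    (hg : g ∈ Subgroup.normalClosure P.relators) : P.FinFold 1 g := by
  let N : Subgroup (FreeGroup A) :=
    { carrier := {g | P.FinFold 1 g}
      one_mem' := ⟨∅, Set.finite_empty, .refl 1⟩
      mul_mem' := fun {g h} hg hh => hg.trans (by simpa using hh.mul_left g)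
      inv_mem' := fun {g} hg => by simpa using (hg.mul_left g⁻¹).symm }
  have : N.Normal := ⟨fun n hn g => by
    have h := (FinFold.mul_left g (show P.FinFold 1 n from hn)).mul_right g⁻¹
    rw [mul_one, mul_inv_cancel] at h
    exact h⟩
  refine (Subgroup.normalClosure_le_normal (N := N) ?_) hg
  rintro _ ⟨a, rfl⟩
  exact finFold_relator a

/-- Every function on the edges of the Cayley tree of a free group has a potential. -/
theorem exists_potential (φ : FreeGroup A → A → ℚ) :
    ∃ ψ : FreeGroup A → ℚ, ∀ g a, ψ (g * FreeGroup.of a) = ψ g + φ g a := by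
  let s : A → Equiv.Perm (FreeGroup A × ℚ) := fun a =>
    { toFun := fun x => (x.1 * (FreeGroup.of a)⁻¹, x.2 - φ (x.1 * (FreeGroup.of a)⁻¹) a)
      invFun := fun x => (x.1 * FreeGroup.of a, x.2 + φ x.1 a)
      left_inv := fun x => by simp
      right_inv := fun x => by simp }
  let θ := FreeGroup.lift s
  have h1 : ∀ g x, (θ g x).1 = x.1 * g⁻¹ := fun g => by
    induction g using FreeGroup.induction_on with
    | C1 => simp
    | of a => intro x; simp [θ, s]
    | inv_of a _ => intro x; simp [θ, s]
    | mul g h hg hh => intro x; simp [hg, hh, mul_assoc]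
  refine ⟨fun g => (θ g⁻¹ (1, 0)).2, fun g a => ?_⟩
  have h2 : θ (g * FreeGroup.of a)⁻¹ (1, 0) = (s a)⁻¹ (θ g⁻¹ (1, 0)) := by
    rw [mul_inv_rev, map_mul, Equiv.Perm.mul_apply]
    simp [θ]
  simp only [h2]
  have h3 : (θ g⁻¹ (1, 0)).1 = g := by rw [h1, one_mul, inv_inv]
  change (θ g⁻¹ (1, 0)).2 + φ (θ g⁻¹ (1, 0)).1 a = _
  rw [h3]

/-- The setoid of the folding. -/
def foldSetoid (P : PairedRelations A) (S : Set (FreeGroup A × A)) : Setoid (FreeGroup A) :=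
  ⟨P.Fold S, .refl, .symm, .trans⟩

/-- The arrow of the folded graph that comes from an edge of the Cayley tree. -/
def foldArrow (P : PairedRelations A) (S : Set (FreeGroup A × A)) (e : FreeGroup A × A) :
    Quotient (P.foldSetoid S) × A × Quotient (P.foldSetoid S) :=
  (⟦e.1⟧, e.2, ⟦e.1 * FreeGroup.of e.2⟧)

theorem isWalk_trail {S : Set (FreeGroup A × A)} (g : FreeGroup A) (l : List A)
    (h : ∀ e ∈ trail g l, e ∈ S) :
    IsWalk (P.foldArrow S '' S) (Quotient.mk (P.foldSetoid S) g)
      ((trail g l).map (P.foldArrow S)) (Quotient.mk _ (g * (l.map FreeGroup.of).prod)) := by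
  induction l generalizing g with
  | nil => simp [trail, IsWalk]
  | cons a l ih =>
    refine ⟨⟨_, h _ (by simp [trail]), rfl⟩, rfl, ?_⟩
    have := ih (g * FreeGroup.of a) fun e he => h e (by simp [trail, he])
    rw [List.map_cons, List.prod_cons, ← mul_assoc]
    exact this

theorem labels_trail {S : Set (FreeGroup A × A)} (g : FreeGroup A) (l : List A) :
    labels ((trail g l).map (P.foldArrow S)) = l := by
  induction l generalizing g with
  | nil => rfl
  | cons a l ih =>
    simp only [trail, List.map_cons, labels, List.cons.injEq]
    exact ⟨rfl, ih _⟩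

theorem isFolded_foldArrow (S : Set (FreeGroup A × A)) : IsFolded (P.foldArrow S '' S) := by
  constructor
  · rintro x a y y' ⟨⟨g, b⟩, hg, h1⟩ ⟨⟨g', b'⟩, hg', h2⟩
    simp only [foldArrow, Prod.mk.injEq] at h1 h2
    obtain ⟨rfl, rfl, rfl⟩ := h1
    obtain ⟨h2, rfl, rfl⟩ := h2
    exact Quotient.sound (s := P.foldSetoid S)
      (Fold.target (Quotient.exact (s := P.foldSetoid S) h2.symm) hg hg')
  · rintro x x' a y ⟨⟨g, b⟩, hg, h1⟩ ⟨⟨g', b'⟩, hg', h2⟩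
    simp only [foldArrow, Prod.mk.injEq] at h1 h2
    obtain ⟨rfl, rfl, rfl⟩ := h1
    obtain ⟨rfl, rfl, h2⟩ := h2
    exact Quotient.sound (s := P.foldSetoid S)
      (Fold.source (Quotient.exact (s := P.foldSetoid S) h2.symm) hg hg')

/-- The first cohomology of the folded complex vanishes: the potential of a cocycle on the Cayley tree
is invariant under the identifications. -/
theorem h1Vanishes_foldArrow (S : Set (FreeGroup A × A)) : P.H1Vanishes (P.foldArrow S '' S) := by
  intro φ hφ
  obtain ⟨ψ, hψ⟩ := exists_potential fun g a => φ (P.foldArrow S (g, a))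
  have hsum : ∀ g l, ψ (g * (l.map FreeGroup.of).prod) =
      ψ g + (((trail g l).map (P.foldArrow S)).map φ).sum := by
    intro g l
    induction l generalizing g with
    | nil => simp [trail]
    | cons a l ih => simp [trail, ← mul_assoc, ih, hψ, add_assoc]
  have hinv : ∀ g h, P.Fold S g h → ψ g = ψ h := by
    intro g h hgh
    induction hgh with
    | refl => rfl
    | symm _ ih => exact ih.symm
    | trans _ _ ih ih' => exact ih.trans ih'
    | disc g a h1 h2 =>
      rw [hsum, hsum]
      congr 1
      refine hφ a _ _ _ _ (isWalk_trail g _ h1) ?_ (labels_trail _ _) (labels_trail _ _)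
      have h3 := isWalk_trail (P := P) g _ h2
      rwa [← Quotient.sound (s := P.foldSetoid S) (Fold.disc g a h1 h2)] at h3
    | @target g h a hgh h1 h2 ih =>
      have h3 : P.foldArrow S (g, a) = P.foldArrow S (h, a) := by
        simp only [foldArrow, Prod.mk.injEq, true_and]
        exact ⟨Quotient.sound (s := P.foldSetoid S) hgh,
          Quotient.sound (s := P.foldSetoid S) (hgh.target h1 h2)⟩
      rw [hψ, hψ, ih, h3]
    | @source g h a hgh h1 h2 ih =>
      have h3 : P.foldArrow S (g, a) = P.foldArrow S (h, a) := by
        simp only [foldArrow, Prod.mk.injEq, true_and]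
        exact ⟨Quotient.sound (s := P.foldSetoid S) (hgh.source h1 h2),
          Quotient.sound (s := P.foldSetoid S) hgh⟩
      rw [hψ, hψ, h3] at ih
      exact add_right_cancel ih
  refine ⟨Quotient.lift (s := P.foldSetoid S) ψ hinv, ?_⟩
  rintro _ ⟨⟨g, a⟩, -, rfl⟩
  exact hψ g a

/-- A non-empty positive word is non-trivial in a group presented by paired positive relations. -/
theorem prod_ne_one {l : List A} (hl : l ≠ []) :
    (l.map (PresentedGroup.of (rels := P.relators))).prod ≠ 1 := by
  classical
  intro h
  have h' : PresentedGroup.mk P.relators (l.map FreeGroup.of).prod = 1 := by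
    rw [map_list_prod, List.map_map]
    exact h
  obtain ⟨S₀, hS₀, hfold⟩ := finFold_of_mem_normalClosure ((QuotientGroup.eq_one_iff _).1 h')
  set S := S₀ ∪ {e | e ∈ trail 1 l} with hS
  have hSfin : S.Finite := hS₀.union (List.finite_toSet _)
  have hcoe : (((hSfin.image (P.foldArrow S)).toFinset : Finset _) : Set _) = P.foldArrow S '' S :=
    Set.Finite.coe_toFinset _
  have hnil := H1Vanishes.eq_empty_of_forall_exists_out P
    (E := (hSfin.image (P.foldArrow S)).toFinset)
    (X := {x | ∃ e ∈ trail 1 l, x = Quotient.mk (P.foldSetoid S) e.1})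
    (by rw [hcoe]; exact h1Vanishes_foldArrow S) (by rw [hcoe]; exact isFolded_foldArrow S) ?_
  · rcases l with _ | ⟨a, l⟩
    · exact hl rfl
    · have : Quotient.mk (P.foldSetoid S) 1 ∈
          {x | ∃ e ∈ trail 1 (a :: l), x = Quotient.mk (P.foldSetoid S) e.1} :=
        ⟨(1, a), by simp [trail], rfl⟩
      rw [hnil] at this
      exact this
  · rintro _ ⟨e, he, rfl⟩
    refine ⟨P.foldArrow S e, by
      rw [Set.Finite.mem_toFinset]; exact ⟨e, Or.inr he, rfl⟩, rfl, ?_⟩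
    -- The end of the trail is identified with its start.
    have hend : ∀ (l : List A) (g : FreeGroup A) (e), e ∈ trail g l →
        (∃ e' ∈ trail g l, e'.1 = e.1 * FreeGroup.of e.2) ∨
          e.1 * FreeGroup.of e.2 = g * (l.map FreeGroup.of).prod := by
      intro l
      induction l with
      | nil => intro g e he; simp [trail] at he
      | cons a l ih =>
        intro g e he
        rcases List.mem_cons.1 he with rfl | he
        · rcases l with _ | ⟨b, l⟩
          · exact Or.inr (by simp)
          · exact Or.inl ⟨(g * FreeGroup.of a, b), by simp [trail], rfl⟩
        · rcases ih _ e he with ⟨e', he', h1⟩ | h1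
          · exact Or.inl ⟨e', List.mem_cons_of_mem _ he', h1⟩
          · exact Or.inr (by simpa [mul_assoc] using h1)
    rcases hend l 1 e he with ⟨e', he', h1⟩ | h1
    · exact ⟨e', he', by rw [h1]; rfl⟩
    · rcases l with _ | ⟨a, l⟩
      · exact absurd rfl hl
      · refine ⟨(1, a), by simp [trail], ?_⟩
        change Quotient.mk (P.foldSetoid S) (e.1 * FreeGroup.of e.2) = _
        rw [h1, one_mul]
        exact Quotient.sound (s := P.foldSetoid S) (hfold.mono Set.subset_union_left).symm

end PairedRelations

end TautTri

/-! ### Taut angle structures and rotations about edges -/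

noncomputable section

namespace TautTri

/-- The combinatorics of a taut angle structure at the tetrahedra. Faces `i` and `mate t i` of `t` meet
in an edge with dihedral angle `π`, and `side t` distinguishes the two parts, each consisting of two
such faces, into which the equator cuts the boundary of `t`. -/
structure TautMatching {Tet : Type*} (angle : Tet → Edge → ℝ) where
  mate : Tet → Fin 4 → Fin 4
  side : Tet → Fin 4 → Bool
  mate_mate : ∀ t i, mate t (mate t i) = i
  mate_ne : ∀ t i, mate t i ≠ i
  side_eq_iff : ∀ t i j, side t i = side t j ↔ j = i ∨ j = mate t i
  angle_eq_pi_iff : ∀ t i j, i ≠ j → ∀ e : Edge, e.1 = {i, j}ᶜ →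
    (angle t e = Real.pi ↔ j = mate t i)

set_option maxRecDepth 100000 in
/-- The triangle equalities force the angles at opposite edges to agree, and exactly one of the three
pairs of opposite edges to have angle `π`. -/
theorem exists_mate_side {ang : Edge → ℝ} (h0 : ∀ e, ang e = 0 ∨ ang e = Real.pi)
    (ht : ∀ v : Fin 4, ∑ e ∈ (Finset.univ : Finset Edge).filter (fun e => v ∈ e.1), ang e = Real.pi) :
    ∃ (mate : Fin 4 → Fin 4) (side : Fin 4 → Bool), (∀ i, mate (mate i) = i) ∧ (∀ i, mate i ≠ i) ∧
      (∀ i j, side i = side j ↔ j = i ∨ j = mate i) ∧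
      ∀ i j, i ≠ j → ∀ e : Edge, e.1 = {i, j}ᶜ → (ang e = Real.pi ↔ j = mate i) := by
  have hf0 : (Finset.univ : Finset Edge).filter (fun e => (0 : Fin 4) ∈ e.1) =
      {⟨{0, 1}, rfl⟩, ⟨{0, 2}, rfl⟩, ⟨{0, 3}, rfl⟩} := by decide
  have hf1 : (Finset.univ : Finset Edge).filter (fun e => (1 : Fin 4) ∈ e.1) =
      {⟨{0, 1}, rfl⟩, ⟨{1, 2}, rfl⟩, ⟨{1, 3}, rfl⟩} := by decide
  have hf2 : (Finset.univ : Finset Edge).filter (fun e => (2 : Fin 4) ∈ e.1) =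
      {⟨{0, 2}, rfl⟩, ⟨{1, 2}, rfl⟩, ⟨{2, 3}, rfl⟩} := by decide
  have hf3 : (Finset.univ : Finset Edge).filter (fun e => (3 : Fin 4) ∈ e.1) =
      {⟨{0, 3}, rfl⟩, ⟨{1, 3}, rfl⟩, ⟨{2, 3}, rfl⟩} := by decide
  have t0 := ht 0
  have t1 := ht 1
  have t2 := ht 2
  have t3 := ht 3
  rw [hf0, Finset.sum_insert (by decide), Finset.sum_insert (by decide), Finset.sum_singleton] at t0
  rw [hf1, Finset.sum_insert (by decide), Finset.sum_insert (by decide), Finset.sum_singleton] at t1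
  rw [hf2, Finset.sum_insert (by decide), Finset.sum_insert (by decide), Finset.sum_singleton] at t2
  rw [hf3, Finset.sum_insert (by decide), Finset.sum_insert (by decide), Finset.sum_singleton] at t3
  have hpi := Real.pi_pos
  set a := ang ⟨{0, 1}, rfl⟩ with ha
  set b := ang ⟨{0, 2}, rfl⟩ with hb
  set c := ang ⟨{0, 3}, rfl⟩ with hc
  set a' := ang ⟨{2, 3}, rfl⟩ with ha'
  set b' := ang ⟨{1, 3}, rfl⟩ with hb'
  set c' := ang ⟨{1, 2}, rfl⟩ with hc'
  -- The angles at opposite edges agree, so that one of the three pairs has angle `π`.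
  have e1 : a' = a := by linarith
  have e2 : b' = b := by linarith
  have e3 : c' = c := by linarith
  have key : ∀ (mate : Fin 4 → Fin 4), ((a = Real.pi ↔ mate 0 = 1) ∧ (b = Real.pi ↔ mate 0 = 2) ∧
      (c = Real.pi ↔ mate 0 = 3)) → (∀ i, mate (mate i) = i) → (∀ i, mate i ≠ i) →
      ∀ i j, i ≠ j → ∀ e : Edge, e.1 = {i, j}ᶜ → (ang e = Real.pi ↔ j = mate i) := by
    rintro mate ⟨k1, k2, k3⟩ hm1 hm2 i j hij ⟨e, he⟩ hee
    simp only at hee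
    subst hee
    have hmates : ∀ mate : Fin 4 → Fin 4, (∀ i, mate (mate i) = i) → (∀ i, mate i ≠ i) →
        ((1 = mate 0 ↔ mate 0 = 1) ∧ (2 = mate 0 ↔ mate 0 = 2) ∧ (3 = mate 0 ↔ mate 0 = 3)) ∧
        ((0 = mate 1 ↔ mate 0 = 1) ∧ (2 = mate 1 ↔ mate 0 = 3) ∧ (3 = mate 1 ↔ mate 0 = 2)) ∧
        ((0 = mate 2 ↔ mate 0 = 2) ∧ (1 = mate 2 ↔ mate 0 = 3) ∧ (3 = mate 2 ↔ mate 0 = 1)) ∧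
        ((0 = mate 3 ↔ mate 0 = 3) ∧ (1 = mate 3 ↔ mate 0 = 2) ∧ (2 = mate 3 ↔ mate 0 = 1)) := by
      decide
    obtain ⟨⟨p1, p2, p3⟩, ⟨p4, p5, p6⟩, ⟨p7, p8, p9⟩, ⟨p10, p11, p12⟩⟩ := hmates mate hm1 hm2
    have q01 : ∀ h, (⟨({0, 1} : Finset (Fin 4))ᶜ, h⟩ : Edge) = ⟨{2, 3}, rfl⟩ := by decide
    have q02 : ∀ h, (⟨({0, 2} : Finset (Fin 4))ᶜ, h⟩ : Edge) = ⟨{1, 3}, rfl⟩ := by decide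
    have q03 : ∀ h, (⟨({0, 3} : Finset (Fin 4))ᶜ, h⟩ : Edge) = ⟨{1, 2}, rfl⟩ := by decide
    have q12 : ∀ h, (⟨({1, 2} : Finset (Fin 4))ᶜ, h⟩ : Edge) = ⟨{0, 3}, rfl⟩ := by decide
    have q13 : ∀ h, (⟨({1, 3} : Finset (Fin 4))ᶜ, h⟩ : Edge) = ⟨{0, 2}, rfl⟩ := by decide
    have q23 : ∀ h, (⟨({2, 3} : Finset (Fin 4))ᶜ, h⟩ : Edge) = ⟨{0, 1}, rfl⟩ := by decide
    have r10 : ∀ h, (⟨({1, 0} : Finset (Fin 4))ᶜ, h⟩ : Edge) = ⟨{2, 3}, rfl⟩ := by decide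
    have r20 : ∀ h, (⟨({2, 0} : Finset (Fin 4))ᶜ, h⟩ : Edge) = ⟨{1, 3}, rfl⟩ := by decide
    have r30 : ∀ h, (⟨({3, 0} : Finset (Fin 4))ᶜ, h⟩ : Edge) = ⟨{1, 2}, rfl⟩ := by decide
    have r21 : ∀ h, (⟨({2, 1} : Finset (Fin 4))ᶜ, h⟩ : Edge) = ⟨{0, 3}, rfl⟩ := by decide
    have r31 : ∀ h, (⟨({3, 1} : Finset (Fin 4))ᶜ, h⟩ : Edge) = ⟨{0, 2}, rfl⟩ := by decide
    have r32 : ∀ h, (⟨({3, 2} : Finset (Fin 4))ᶜ, h⟩ : Edge) = ⟨{0, 1}, rfl⟩ := by decide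
    have hcases : ∀ i j : Fin 4, i ≠ j → (i = 0 ∧ j = 1) ∨ (i = 0 ∧ j = 2) ∨ (i = 0 ∧ j = 3) ∨
      (i = 1 ∧ j = 0) ∨ (i = 1 ∧ j = 2) ∨ (i = 1 ∧ j = 3) ∨ (i = 2 ∧ j = 0) ∨ (i = 2 ∧ j = 1) ∨
      (i = 2 ∧ j = 3) ∨ (i = 3 ∧ j = 0) ∨ (i = 3 ∧ j = 1) ∨ (i = 3 ∧ j = 2) := by decide
    rcases hcases i j hij with ⟨rfl, rfl⟩ | ⟨rfl, rfl⟩ | ⟨rfl, rfl⟩ | ⟨rfl, rfl⟩ | ⟨rfl, rfl⟩ |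
      ⟨rfl, rfl⟩ | ⟨rfl, rfl⟩ | ⟨rfl, rfl⟩ | ⟨rfl, rfl⟩ | ⟨rfl, rfl⟩ | ⟨rfl, rfl⟩ | ⟨rfl, rfl⟩
    · rw [q01, ← ha', e1, k1, p1]
    · rw [q02, ← hb', e2, k2, p2]
    · rw [q03, ← hc', e3, k3, p3]
    · rw [r10, ← ha', e1, k1, p4]
    · rw [q12, ← hc, k3, p5]
    · rw [q13, ← hb, k2, p6]
    · rw [r20, ← hb', e2, k2, p7]
    · rw [r21, ← hc, k3, p8]
    · rw [q23, ← ha, k1, p9]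
    · rw [r30, ← hc', e3, k3, p10]
    · rw [r31, ← hb, k2, p11]
    · rw [r32, ← ha, k1, p12]
  have hside : ∀ mate : Fin 4 → Fin 4, (∀ i, mate (mate i) = i) → (∀ i, mate i ≠ i) →
      ∀ i j, decide (i = 0 ∨ i = mate 0) = decide (j = 0 ∨ j = mate 0) ↔ j = i ∨ j = mate i := by
    decide
  suffices h : ∃ mate : Fin 4 → Fin 4, (∀ i, mate (mate i) = i) ∧ (∀ i, mate i ≠ i) ∧
      ((a = Real.pi ↔ mate 0 = 1) ∧ (b = Real.pi ↔ mate 0 = 2) ∧ (c = Real.pi ↔ mate 0 = 3)) by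
    obtain ⟨mate, h1, h2, h3⟩ := h
    exact ⟨mate, fun i => decide (i = 0 ∨ i = mate 0), h1, h2, hside mate h1 h2,
      key mate h3 h1 h2⟩
  have hz : (0 : ℝ) ≠ Real.pi := hpi.ne
  rcases h0 ⟨{0, 1}, rfl⟩ with h1 | h1 <;> rcases h0 ⟨{0, 2}, rfl⟩ with h2 | h2 <;>
    rcases h0 ⟨{0, 3}, rfl⟩ with h3 | h3 <;> rw [← ha] at h1 <;> rw [← hb] at h2 <;>
    rw [← hc] at h3 <;> try (exfalso; linarith)
  · refine ⟨![3, 2, 1, 0], by decide, by decide, ?_⟩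
    simp [h1, h2, h3, hz]
  · refine ⟨![2, 3, 0, 1], by decide, by decide, ?_⟩
    simp [h1, h2, h3, hz]
  · refine ⟨![1, 0, 3, 2], by decide, by decide, ?_⟩
    simp [h1, h2, h3, hz]

theorem nonempty_tautMatching {Tet : Type*} [Fintype Tet] {T : Triangulation Tet}
    {angle : Tet → Edge → ℝ} (h : T.IsTautAngleStructure angle) : Nonempty (TautMatching angle) := by
  have := fun t => exists_mate_side (h.zero_or_pi t) (fun v => by
    convert h.triangle_eq t v)
  choose mate side h1 h2 h3 h4 using this
  exact ⟨⟨mate, side, h1, h2, h3, h4⟩⟩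

namespace Triangulation

variable {Tet : Type*} (T : Triangulation Tet)

/-- The face of the adjacent tetrahedron to which a model face is glued. -/
def opp (a : Tet × Fin 4) : Tet × Fin 4 := (T.adj a.1 a.2, T.gluing a.1 a.2 a.2)

theorem opp_opp (a : Tet × Fin 4) : T.opp (T.opp a) = a := by
  simp [opp, T.adj_adj, T.gluing_gluing]

end Triangulation

/-- A triple `(t, i, j)`, for `i ≠ j`, stands for the model edge of `t` in which the faces `i` and `j`
meet, and for the direction of rotation about it from face `i` to face `j`. -/
abbrev Flag (Tet : Type*) : Type _ := Tet × Fin 4 × Fin 4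

namespace Flag

variable {Tet : Type*}

/-- Reversal of the direction of rotation. -/
def flip (s : Flag Tet) : Flag Tet := (s.1, s.2.2, s.2.1)

/-- The model face through which the rotation leaves the tetrahedron. -/
def exit (s : Flag Tet) : Tet × Fin 4 := (s.1, s.2.2)

@[simp] theorem flip_flip (s : Flag Tet) : s.flip.flip = s := rfl

end Flag

namespace Triangulation

variable {Tet : Type*} (T : Triangulation Tet)

/-- One step of the rotation about an edge: to the next tetrahedron. -/
def rotFun (s : Flag Tet) : Flag Tet :=
  (T.adj s.1 s.2.2, T.gluing s.1 s.2.2 s.2.2, T.gluing s.1 s.2.2 s.2.1)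

theorem rotFun_flip_rotFun (s : Flag Tet) : T.rotFun (T.rotFun s).flip = s.flip := by
  simp [rotFun, Flag.flip, T.adj_adj, T.gluing_gluing]

/-- The rotation about edges, as a permutation of the flags. -/
def rot : Equiv.Perm (Flag Tet) where
  toFun := T.rotFun
  invFun s := (T.rotFun s.flip).flip
  left_inv s := by beta_reduce; rw [rotFun_flip_rotFun, Flag.flip_flip]
  right_inv s := by beta_reduce; rw [rotFun_flip_rotFun, Flag.flip_flip]

theorem rot_apply (s : Flag Tet) : T.rot s =
    (T.adj s.1 s.2.2, T.gluing s.1 s.2.2 s.2.2, T.gluing s.1 s.2.2 s.2.1) := rfl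

theorem rot_flip_rot (s : Flag Tet) : T.rot (T.rot s).flip = s.flip := T.rotFun_flip_rotFun s

theorem flip_rot (s : Flag Tet) : (T.rot s).flip = T.rot⁻¹ s.flip := by
  rw [Equiv.Perm.eq_inv_iff_eq, rot_flip_rot]

theorem flip_rot_pow (n : ℕ) (s : Flag Tet) : ((T.rot ^ n) s).flip = (T.rot⁻¹ ^ n) s.flip := by
  induction n generalizing s with
  | zero => rfl
  | succ n ih => rw [pow_succ, pow_succ, Equiv.Perm.mul_apply, Equiv.Perm.mul_apply, ih, flip_rot]

theorem flip_rot_zpow (n : ℤ) (s : Flag Tet) : ((T.rot ^ n) s).flip = (T.rot ^ (-n)) s.flip := by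
  obtain ⟨m, rfl | rfl⟩ := n.eq_nat_or_neg
  · rw [zpow_natCast, flip_rot_pow, zpow_neg, zpow_natCast, inv_pow]
  · rw [neg_neg, zpow_natCast, zpow_neg, zpow_natCast, ← inv_pow]
    have := T.flip_rot_pow m s.flip
    rw [Flag.flip_flip] at this
    rw [← this, Flag.flip_flip]

theorem rot_ne {s : Flag Tet} (hs : s.2.1 ≠ s.2.2) : (T.rot s).2.1 ≠ (T.rot s).2.2 := by
  simpa [rot_apply] using hs.symm

theorem rot_pow_ne (n : ℕ) {s : Flag Tet} (hs : s.2.1 ≠ s.2.2) :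
    ((T.rot ^ n) s).2.1 ≠ ((T.rot ^ n) s).2.2 := by
  induction n with
  | zero => exact hs
  | succ n ih =>
    rw [pow_succ', Equiv.Perm.mul_apply]
    exact T.rot_ne ih

theorem rot_zpow_ne (n : ℤ) {s : Flag Tet} (hs : s.2.1 ≠ s.2.2) :
    ((T.rot ^ n) s).2.1 ≠ ((T.rot ^ n) s).2.2 := by
  obtain ⟨m, rfl | rfl⟩ := n.eq_nat_or_neg
  · exact T.rot_pow_ne m hs
  · have h := T.flip_rot_pow m s.flip
    rw [Flag.flip_flip] at h
    rw [zpow_neg, zpow_natCast, ← inv_pow, ← h]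
    exact (T.rot_pow_ne m (s := s.flip) hs.symm).symm

/-- Rotation about an edge does not reverse its own direction: a reflection of a cycle fixes a point
or the midpoint of two neighbours, and no model face is glued to itself. -/
theorem not_sameCycle_flip {s : Flag Tet} (hs : s.2.1 ≠ s.2.2) : ¬ T.rot.SameCycle s s.flip := by
  rintro ⟨n, hn⟩
  obtain ⟨m, rfl | rfl⟩ := n.even_or_odd'
  · have h : ((T.rot ^ m) s).flip = (T.rot ^ m) s := by
      rw [flip_rot_zpow, ← hn, ← Equiv.Perm.mul_apply, ← zpow_add]
      congr 2
      ring
    exact T.rot_zpow_ne m hs (congrArg (fun x : Flag Tet => x.2.2) h)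
  · have h : ((T.rot ^ m) s).flip = T.rot ((T.rot ^ m) s) := by
      rw [flip_rot_zpow, ← hn, ← Equiv.Perm.mul_apply, ← zpow_add, ← Equiv.Perm.mul_apply,
        ← zpow_one_add]
      congr 2
      ring
    generalize (T.rot ^ m) s = x at h
    refine T.ne_self x.1 x.2.2 ?_
    rw [rot_apply] at h
    exact Prod.ext (congrArg (fun y : Flag Tet => y.1) h).symm
      (congrArg (fun y : Flag Tet => y.2.1) h).symm

/-- The model edge of a flag `(t, i, j)` (a junk edge, if `i = j`). -/
def modelEdge (s : Flag Tet) : Tet × Edge :=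
  (s.1, if h : s.2.1 ≠ s.2.2 then ⟨{s.2.1, s.2.2}ᶜ, by
    rw [Finset.card_compl, Finset.card_pair h]; rfl⟩ else ⟨{0, 1}, rfl⟩)

theorem modelEdge_snd {s : Flag Tet} (hs : s.2.1 ≠ s.2.2) :
    (modelEdge s).2.1 = {s.2.1, s.2.2}ᶜ := by
  simp only [modelEdge]
  rw [dif_pos hs]

theorem modelEdge_flip (s : Flag Tet) : modelEdge s.flip = modelEdge s := by
  by_cases h : s.2.1 = s.2.2
  · rw [show s.flip = s from Prod.ext rfl (Prod.ext h.symm h)]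
  · refine Prod.ext rfl (Subtype.ext ?_)
    rw [modelEdge_snd h, modelEdge_snd (s := s.flip) (Ne.symm h), Finset.pair_comm]
    rfl

theorem eq_or_eq_flip_of_modelEdge_eq {s s' : Flag Tet} (hs : s.2.1 ≠ s.2.2) (hs' : s'.2.1 ≠ s'.2.2)
    (h : modelEdge s = modelEdge s') : s' = s ∨ s' = s.flip := by
  have h1 : s.1 = s'.1 := congrArg (fun m : Tet × Edge => m.1) h
  have h2 : ({s.2.1, s.2.2} : Finset (Fin 4)) = {s'.2.1, s'.2.2} := by
    rw [← compl_inj_iff, ← modelEdge_snd hs, ← modelEdge_snd hs', h]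
  have h3 : ({s.2.1, s.2.2} : Set (Fin 4)) = {s'.2.1, s'.2.2} := by
    simpa using congrArg (fun S : Finset (Fin 4) => (S : Set (Fin 4))) h2
  rcases Set.pair_eq_pair_iff.1 h3 with ⟨h4, h5⟩ | ⟨h4, h5⟩
  · exact Or.inl (Prod.ext h1.symm (Prod.ext h4.symm h5.symm))
  · exact Or.inr (Prod.ext h1.symm (Prod.ext h5.symm h4.symm))

theorem modelEdge_rot_eq {s : Flag Tet} (hs : s.2.1 ≠ s.2.2) {m : Tet × Edge}
    (h1 : m.1 = T.adj s.1 s.2.2)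
    (h2 : m.2.1 = (modelEdge s).2.1.map (T.gluing s.1 s.2.2).toEmbedding) :
    modelEdge (T.rot s) = m := by
  refine Prod.ext h1.symm (Subtype.ext ?_)
  rw [modelEdge_snd (T.rot_ne hs), h2, modelEdge_snd hs]
  ext x
  simp only [Finset.mem_compl, Finset.mem_insert, Finset.mem_singleton, Finset.mem_map_equiv,
    Equiv.symm_apply_eq]
  simp only [rot_apply]
  tauto

/-- The two models of an edge that are glued along a face are neighbours under rotation. -/
theorem modelEdge_of_edgeGlued {s : Flag Tet} (hs : s.2.1 ≠ s.2.2) {m : Tet × Edge}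
    (h : T.EdgeGlued (modelEdge s) m) : modelEdge (T.rot s) = m ∨ modelEdge (T.rot⁻¹ s) = m := by
  obtain ⟨i, hi, h1, h2⟩ := h
  rw [modelEdge_snd hs] at hi
  simp only [Finset.mem_compl, Finset.mem_insert, Finset.mem_singleton, not_not] at hi
  rcases hi with rfl | rfl
  · right
    have h3 := T.flip_rot s.flip
    rw [Flag.flip_flip] at h3
    rw [← h3, modelEdge_flip]
    refine T.modelEdge_rot_eq (s := s.flip) hs.symm h1 ?_
    rw [modelEdge_flip]
    exact h2
  · exact Or.inl (T.modelEdge_rot_eq hs h1 h2)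

theorem EdgeGlued.symm {m m' : Tet × Edge} (h : T.EdgeGlued m m') : T.EdgeGlued m' m := by
  obtain ⟨i, hi, h1, h2⟩ := h
  refine ⟨T.gluing m.1 i i, ?_, ?_, ?_⟩
  · rw [h2]
    simpa using hi
  · rw [h1, T.adj_adj]
  · rw [h1, T.gluing_gluing, h2]
    ext x
    simp

theorem sameEdge_rot {s : Flag Tet} (hs : s.2.1 ≠ s.2.2) :
    T.EdgeGlued (modelEdge s) (modelEdge (T.rot s)) := by
  refine ⟨s.2.2, ?_, rfl, ?_⟩
  · rw [modelEdge_snd hs]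
    simp
  · have : ((modelEdge s).2.1.map (T.gluing s.1 s.2.2).toEmbedding).card = 2 := by
      rw [Finset.card_map, (modelEdge s).2.2]
    rw [T.modelEdge_rot_eq (m := (T.adj s.1 s.2.2, ⟨_, this⟩)) hs rfl rfl]
    rfl

/-- The models of an edge are the model edges met when rotating about it. -/
theorem sameEdge_iff {s : Flag Tet} (hs : s.2.1 ≠ s.2.2) {m : Tet × Edge} :
    T.SameEdge (modelEdge s) m ↔ ∃ s', T.rot.SameCycle s s' ∧ modelEdge s' = m := by
  constructor
  · intro h
    have hgen : ∀ m₁ m₂, T.SameEdge m₁ m₂ →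
        ((∃ s', T.rot.SameCycle s s' ∧ modelEdge s' = m₁) ↔
          ∃ s', T.rot.SameCycle s s' ∧ modelEdge s' = m₂) := by
      have hstep : ∀ m₁ m₂, T.EdgeGlued m₁ m₂ →
          (∃ s', T.rot.SameCycle s s' ∧ modelEdge s' = m₁) →
          ∃ s', T.rot.SameCycle s s' ∧ modelEdge s' = m₂ := by
        rintro _ m₂ h ⟨s', hs', rfl⟩
        have hne : s'.2.1 ≠ s'.2.2 := by
          obtain ⟨n, rfl⟩ := hs'
          exact T.rot_zpow_ne n hs
        rcases T.modelEdge_of_edgeGlued hne h with h1 | h1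
        · exact ⟨_, Equiv.Perm.sameCycle_apply_right.2 hs', h1⟩
        · exact ⟨_, Equiv.Perm.sameCycle_symm_apply_right.2 hs', h1⟩
      intro m₁ m₂ h
      induction h with
      | rel _ _ h => exact ⟨hstep _ _ h, hstep _ _ (EdgeGlued.symm T h)⟩
      | refl => rfl
      | symm _ _ _ ih => exact ih.symm
      | trans _ _ _ _ _ ih ih' => exact ih.trans ih'
    exact (hgen _ _ h).1 ⟨s, .refl _ _, rfl⟩
  · rintro ⟨s', ⟨n, rfl⟩, rfl⟩
    have hpow : ∀ (n : ℕ) (s : Flag Tet), s.2.1 ≠ s.2.2 →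
        T.SameEdge (modelEdge s) (modelEdge ((T.rot ^ n) s)) := by
      intro n s hs
      induction n with
      | zero => exact .refl _
      | succ n ih =>
        rw [pow_succ', Equiv.Perm.mul_apply]
        exact ih.trans _ _ _ (.rel _ _ (T.sameEdge_rot (T.rot_pow_ne n hs)))
    obtain ⟨m, rfl | rfl⟩ := n.eq_nat_or_neg
    · exact hpow m s hs
    · have h1 := hpow m ((T.rot ^ (-(m : ℤ))) s) (T.rot_zpow_ne _ hs)
      have h2 : (T.rot ^ m) ((T.rot ^ (-(m : ℤ))) s) = s := by
        rw [← zpow_natCast, ← Equiv.Perm.mul_apply, ← zpow_add]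
        simp
      rw [h2] at h1
      exact h1.symm

end Triangulation

namespace TautMatching

variable {Tet : Type*} {angle : Tet → Edge → ℝ} (μ : TautMatching angle)

/-- The dihedral angle between the two faces of the flag is `π`. -/
def IsPi (s : Flag Tet) : Prop := s.2.2 = μ.mate s.1 s.2.1

variable {μ} in
theorem IsPi.ne {s : Flag Tet} (h : μ.IsPi s) : s.2.1 ≠ s.2.2 := by
  rw [h]
  exact (μ.mate_ne _ _).symm

variable {μ} in
theorem IsPi.flip {s : Flag Tet} (h : μ.IsPi s) : μ.IsPi s.flip := by
  simp only [IsPi, Flag.flip] at *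
  rw [h, μ.mate_mate]

variable {μ} in
theorem isPi_flip {s : Flag Tet} : μ.IsPi s.flip ↔ μ.IsPi s := ⟨fun h => h.flip, fun h => h.flip⟩

theorem angle_modelEdge {s : Flag Tet} (hs : s.2.1 ≠ s.2.2) :
    angle (Triangulation.modelEdge s).1 (Triangulation.modelEdge s).2 = Real.pi ↔ μ.IsPi s :=
  μ.angle_eq_pi_iff s.1 s.2.1 s.2.2 hs _ (Triangulation.modelEdge_snd hs)

open Classical in
/-- Rotation about an edge meets exactly two dihedral angles `π`. -/
theorem card_isPi [Fintype Tet] {T : Triangulation Tet} (h : T.IsTautAngleStructure angle)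
    {s : Flag Tet} (hs : s.2.1 ≠ s.2.2) :
    (Finset.univ.filter fun s' => T.rot.SameCycle s s' ∧ μ.IsPi s').card = 2 := by
  have hne : ∀ s', T.rot.SameCycle s s' → s'.2.1 ≠ s'.2.2 := by
    rintro _ ⟨n, rfl⟩
    exact T.rot_zpow_ne n hs
  have himage : (Finset.univ.filter fun m' => T.SameEdge (Triangulation.modelEdge s) m') =
      (Finset.univ.filter fun s' => T.rot.SameCycle s s').image Triangulation.modelEdge := by
    ext m
    simp [T.sameEdge_iff hs]
  have hinj : Set.InjOn Triangulation.modelEdge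
      ((Finset.univ.filter fun s' => T.rot.SameCycle s s' : Finset (Flag Tet)) :
        Set (Flag Tet)) := by
    intro s₁ h₁ s₂ h₂ h12
    simp only [Finset.coe_filter, Finset.mem_univ, true_and, Set.mem_ofPred_eq] at h₁ h₂
    rcases Triangulation.eq_or_eq_flip_of_modelEdge_eq (hne _ h₁) (hne _ h₂) h12 with h3 | h3
    · exact h3.symm
    · exact absurd (h3 ▸ h₁.symm.trans h₂) (T.not_sameCycle_flip (hne _ h₁))
  have hsum := h.edge_eq (Triangulation.modelEdge s)
  rw [himage, Finset.sum_image hinj] at hsum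
  have hval : ∀ s' ∈ Finset.univ.filter fun s' => T.rot.SameCycle s s',
      angle (Triangulation.modelEdge s').1 (Triangulation.modelEdge s').2 =
        if μ.IsPi s' then Real.pi else 0 := by
    intro s' hs'
    rw [Finset.mem_filter] at hs'
    split_ifs with hpi
    · exact (μ.angle_modelEdge (hne _ hs'.2)).2 hpi
    · exact (h.zero_or_pi _ _).resolve_right (fun h' => hpi ((μ.angle_modelEdge (hne _ hs'.2)).1 h'))
  rw [Finset.sum_congr rfl hval, ← Finset.sum_filter, Finset.sum_const, Finset.filter_filter,
    nsmul_eq_mul] at hsum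
  exact_mod_cast mul_right_cancel₀ Real.pi_ne_zero hsum

end TautMatching

end TautTri

end

/-! ### The edge group and its holonomy -/

noncomputable section

namespace TautTri

namespace Triangulation

variable {Tet : Type*} (T : Triangulation Tet) {K : Type*} [Monoid K] (ρ : Tet × Fin 4 → K)

/-- The holonomy of the rotation by `n` steps about an edge, when the crossing of a model face
contributes its value under `ρ`. The factors of later crossings stand on the left. -/
def holonomy (s : Flag Tet) : ℕ → K
  | 0 => 1
  | n + 1 => ρ ((T.rot ^ n) s).exit * holonomy s n

theorem holonomy_add (s : Flag Tet) (m n : ℕ) :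
    T.holonomy ρ s (m + n) = T.holonomy ρ ((T.rot ^ m) s) n * T.holonomy ρ s m := by
  induction n with
  | zero => simp [holonomy]
  | succ n ih =>
    rw [← add_assoc, holonomy, ih, holonomy, ← mul_assoc, ← Equiv.Perm.mul_apply, ← pow_add,
      add_comm n m]

end Triangulation

namespace TautMatching

variable {Tet : Type*} {angle : Tet → Edge → ℝ} (μ : TautMatching angle) (T : Triangulation Tet)

/-- The number of steps of rotation to the next dihedral angle `π` (and zero if there is none). -/
def len (s : Flag Tet) : ℕ := sInf {n | 0 < n ∧ μ.IsPi ((T.rot ^ n) s)}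

/-- The next flag with dihedral angle `π`. -/
def next (s : Flag Tet) : Flag Tet := (T.rot ^ μ.len T s) s

theorem len_eq {s : Flag Tet} {n : ℕ} (hn : 0 < n) (h : μ.IsPi ((T.rot ^ n) s))
    (hmin : ∀ k, 0 < k → k < n → ¬ μ.IsPi ((T.rot ^ k) s)) : μ.len T s = n := by
  refine le_antisymm (Nat.sInf_le ⟨hn, h⟩) (le_csInf ⟨n, hn, h⟩ fun k hk => ?_)
  by_contra hlt
  exact hmin k hk.1 (not_le.1 hlt) hk.2

theorem not_isPi_of_lt_len {s : Flag Tet} {k : ℕ} (hk : 0 < k) (hlt : k < μ.len T s) :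
    ¬ μ.IsPi ((T.rot ^ k) s) := fun h => Nat.notMem_of_lt_sInf hlt ⟨hk, h⟩

section Finite

variable {T} [Finite Tet] {s : Flag Tet} (hs : μ.IsPi s)
include hs

variable {μ} in
theorem len_spec : 0 < μ.len T s ∧ μ.IsPi (μ.next T s) :=
  Nat.sInf_mem (s := {n | 0 < n ∧ μ.IsPi ((T.rot ^ n) s)})
    ⟨orderOf T.rot, orderOf_pos _, by rwa [pow_orderOf_eq_one]⟩

variable {μ} in
theorem len_pos : 0 < μ.len T s := (len_spec hs).1

variable {μ} in
theorem isPi_next : μ.IsPi (μ.next T s) := (len_spec hs).2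

variable {μ} in
/-- The reversed rotation from the next dihedral angle `π` leads back. -/
theorem len_flip_next : μ.len T (μ.next T s).flip = μ.len T s ∧
    μ.next T (μ.next T s).flip = s.flip := by
  have hback : ∀ k ≤ μ.len T s,
      (T.rot ^ k) (μ.next T s).flip = ((T.rot ^ (μ.len T s - k)) s).flip := by
    intro k hk
    have h1 : μ.next T s = (T.rot ^ k) ((T.rot ^ (μ.len T s - k)) s) := by
      rw [next, ← Equiv.Perm.mul_apply, ← pow_add, Nat.add_sub_cancel' hk]
    rw [h1, T.flip_rot_pow, inv_pow, ← Equiv.Perm.mul_apply,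
      mul_inv_cancel, Equiv.Perm.one_apply]
  have hlen : μ.len T (μ.next T s).flip = μ.len T s := by
    refine μ.len_eq T (len_pos hs) ?_ fun k hk hlt => ?_
    · rw [hback _ le_rfl, Nat.sub_self]
      exact hs.flip
    · rw [hback _ hlt.le, isPi_flip]
      exact μ.not_isPi_of_lt_len T (by omega) (by omega)
  refine ⟨hlen, ?_⟩
  rw [next, hlen, hback _ le_rfl, Nat.sub_self]
  rfl

end Finite

section Taut

variable {T} [Fintype Tet] (h : T.IsTautAngleStructure angle)
include h

theorem next_ne {s : Flag Tet} (hs : μ.IsPi s) : μ.next T s ≠ s := by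
  classical
  intro heq
  have hcard := μ.card_isPi h hs.ne
  have hsub : (Finset.univ.filter fun s' => T.rot.SameCycle s s' ∧ μ.IsPi s') ⊆ {s} := by
    intro s' hs'
    rw [Finset.mem_filter] at hs'
    obtain ⟨-, ⟨z, rfl⟩, hpi⟩ := hs'
    set L := μ.len T s with hL
    have hLpos : 0 < L := len_pos hs
    have hfix : (T.rot ^ (L : ℤ)) s = s := by
      rw [zpow_natCast]
      exact heq
    have hred : (T.rot ^ z) s = (T.rot ^ (z % L).toNat) s := by
      rw [← zpow_natCast, Int.toNat_of_nonneg (Int.emod_nonneg _ (by omega))]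
      conv_lhs => rw [← Int.emod_add_mul_ediv z L, zpow_add, Equiv.Perm.mul_apply, zpow_mul]
      congr 1
      exact Function.IsFixedPt.perm_zpow hfix _
    rw [hred] at hpi ⊢
    have hlt : (z % L).toNat < L := by
      have := Int.emod_lt_of_pos z (show (0 : ℤ) < L by omega)
      have := Int.emod_nonneg z (show (L : ℤ) ≠ 0 by omega)
      omega
    rcases Nat.eq_zero_or_pos (z % L).toNat with h0 | h0
    · rw [h0]
      simp
    · exact absurd hpi (μ.not_isPi_of_lt_len T h0 hlt)
  have := Finset.card_le_card hsub
  rw [hcard] at this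
  simp at this

/-- Around an edge there are only two dihedral angles `π`. -/
theorem next_next {s : Flag Tet} (hs : μ.IsPi s) : μ.next T (μ.next T s) = s := by
  classical
  have hcard := μ.card_isPi h hs.ne
  have hmem : ∀ {s'}, T.rot.SameCycle s s' → μ.IsPi s' →
      s' ∈ Finset.univ.filter fun s' => T.rot.SameCycle s s' ∧ μ.IsPi s' := fun h1 h2 =>
    Finset.mem_filter.2 ⟨Finset.mem_univ _, h1, h2⟩
  have hnext : ∀ s', T.rot.SameCycle s' (μ.next T s') := fun s' => ⟨μ.len T s', by
    rw [zpow_natCast]; rfl⟩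
  have hs1 := isPi_next (T := T) hs
  have hs2 := isPi_next (T := T) hs1
  by_contra hne
  have hsub : ({s, μ.next T s, μ.next T (μ.next T s)} : Finset (Flag Tet)) ⊆
      Finset.univ.filter fun s' => T.rot.SameCycle s s' ∧ μ.IsPi s' := by
    intro x hx
    simp only [Finset.mem_insert, Finset.mem_singleton] at hx
    rcases hx with rfl | rfl | rfl
    · exact hmem (.refl _ _) hs
    · exact hmem (hnext _) hs1
    · exact hmem ((hnext _).trans (hnext _)) hs2
  have h3 := Finset.card_le_card hsub
  rw [hcard, Finset.card_eq_three.2 ⟨_, _, _, (μ.next_ne h hs).symm, Ne.symm hne,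
    (μ.next_ne h hs1).symm, rfl⟩] at h3
  omega

theorem len_flip {s : Flag Tet} (hs : μ.IsPi s) : μ.len T s.flip = μ.len T (μ.next T s) := by
  have := (len_flip_next (T := T) (isPi_next (T := T) hs)).1
  rwa [μ.next_next h hs] at this

/-- The upward transverse path around an edge that starts in the direction `a`: the letters are the
faces crossed. The two such paths around an edge, from the lower to the upper tetrahedron with dihedral
angle `π`, are the sides of a relation. A letter is a model face, crossed away from its tetrahedron, so
that a face of the triangulation gives two letters, one for each of its coorientations. -/
def relations : PairedRelations (Tet × Fin 4) where
  tail a := (List.range (μ.len T (a.1, μ.mate a.1 a.2, a.2) - 1)).map fun k =>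
    ((T.rot ^ (k + 1)) (a.1, μ.mate a.1 a.2, a.2)).exit
  mate a := (a.1, μ.mate a.1 a.2)
  IsPos a := a.2 < μ.mate a.1 a.2
  mate_mate a := by simp [μ.mate_mate]
  isPos_mate a := by
    rw [μ.mate_mate, not_lt]
    exact ⟨le_of_lt, fun hle => lt_of_le_of_ne hle (μ.mate_ne _ _)⟩
  last_injective := by
    let start : Tet × Fin 4 → Flag Tet := fun a => (a.1, μ.mate a.1 a.2, a.2)
    have hstart : ∀ a, μ.IsPi (start a) := fun a => (μ.mate_mate a.1 a.2).symm
    have hlast : ∀ a, (a :: (List.range (μ.len T (start a) - 1)).map fun k =>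
        ((T.rot ^ (k + 1)) (start a)).exit).getLast (List.cons_ne_nil _ _) =
        ((T.rot ^ (μ.len T (start a) - 1)) (start a)).exit := by
      intro a
      rcases hn : μ.len T (start a) - 1 with _ | n
      · rfl
      · simp [List.range_succ]
    have hnext : ∀ a, μ.next T (start a) =
        T.rot ((T.rot ^ (μ.len T (start a) - 1)) (start a)) := by
      intro a
      rw [← Equiv.Perm.mul_apply, ← pow_succ', Nat.sub_add_cancel (len_pos (hstart a))]
      rfl
    intro a b hab
    simp only at hab
    rw [hlast, hlast] at hab
    -- The last letter determines the upper tetrahedron and its lower faces, hence the whole path.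
    have heq : μ.next T (start a) = μ.next T (start b) := by
      have ha := isPi_next (T := T) (hstart a)
      have hb := isPi_next (T := T) (hstart b)
      rw [hnext] at ha hb ⊢
      rw [hnext b]
      simp only [Flag.exit, Prod.mk.injEq] at hab
      simp only [IsPi, T.rot_apply] at ha hb ⊢
      rw [ha, hb, hab.1, hab.2]
    have heq' : start a = start b := by
      rw [← μ.next_next h (hstart a), heq, μ.next_next h (hstart b)]
    simp only [start, Prod.mk.injEq] at heq'
    exact Prod.ext heq'.1 heq'.2.2

/-- The group of the relations. The two-complex dual to the triangulation has a double cover whose points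
are cooriented, and the group is the fundamental group of this cover after identification of all its
vertices. -/
abbrev EdgeGroup : Type _ := (μ.relations h).Group

/-- The generator for an upward crossing. -/
def gen (a : Tet × Fin 4) : μ.EdgeGroup h := PresentedGroup.of a

/-- The product of the generators along an upward rotation about an edge. -/
def upProd (s : Flag Tet) (n : ℕ) : μ.EdgeGroup h :=
  ((List.range n).map fun k => μ.gen h ((T.rot ^ k) s).exit).prod

/-- The product of the inverses of the generators along a downward rotation about an edge. -/
def downProd (s : Flag Tet) (n : ℕ) : μ.EdgeGroup h :=
  ((List.range n).map fun k => (μ.gen h (T.opp ((T.rot ^ k) s).exit))⁻¹).prod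

theorem upProd_succ (s : Flag Tet) (n : ℕ) :
    μ.upProd h s (n + 1) = μ.upProd h s n * μ.gen h ((T.rot ^ n) s).exit := by
  simp [upProd, List.range_succ]

theorem upProd_succ' (s : Flag Tet) (n : ℕ) :
    μ.upProd h s (n + 1) = μ.gen h s.exit * μ.upProd h (T.rot s) n := by
  simp [upProd, List.range_succ_eq_map, Function.comp_def, pow_succ]

theorem downProd_succ (s : Flag Tet) (n : ℕ) : μ.downProd h s (n + 1) =
    μ.downProd h s n * (μ.gen h (T.opp ((T.rot ^ n) s).exit))⁻¹ := by
  simp [downProd, List.range_succ]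

theorem downProd_eq (s : Flag Tet) (n : ℕ) :
    μ.downProd h s n = (μ.upProd h ((T.rot ^ n) s).flip n)⁻¹ := by
  rw [eq_inv_iff_mul_eq_one]
  induction n with
  | zero => simp [downProd, upProd]
  | succ n ih =>
    have h1 : T.rot ((T.rot ^ (n + 1)) s).flip = ((T.rot ^ n) s).flip := by
      rw [pow_succ', Equiv.Perm.mul_apply, T.rot_flip_rot]
    have h2 : ((T.rot ^ (n + 1)) s).flip.exit = T.opp ((T.rot ^ n) s).exit := by
      rw [pow_succ', Equiv.Perm.mul_apply]
      rfl
    rw [downProd_succ, upProd_succ', h1, h2, mul_assoc, inv_mul_cancel_left, ih]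

theorem prod_word {s : Flag Tet} (hs : μ.IsPi s) :
    (((μ.relations h).word s.exit).map (μ.gen h)).prod = μ.upProd h s (μ.len T s) := by
  have hstart : (s.exit.1, μ.mate s.exit.1 s.exit.2, s.exit.2) = s := by
    refine Prod.ext rfl (Prod.ext ?_ rfl)
    simp only [Flag.exit]
    rw [hs, μ.mate_mate]
  have hword : (μ.relations h).word s.exit =
      (List.range (μ.len T s)).map fun k => ((T.rot ^ k) s).exit := by
    rw [← Nat.sub_add_cancel (len_pos (T := T) hs), List.range_succ_eq_map, List.map_cons,
      List.map_map]
    simp only [PairedRelations.word, relations]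
    rw [hstart]
    rfl
  rw [hword, upProd, List.map_map]
  rfl

theorem upProd_flip {s : Flag Tet} (hs : μ.IsPi s) :
    μ.upProd h s.flip (μ.len T s.flip) = μ.upProd h s (μ.len T s) := by
  rw [← μ.prod_word h hs, ← μ.prod_word h hs.flip]
  have : s.flip.exit = (μ.relations h).mate s.exit := by
    refine Prod.ext rfl ?_
    simp only [Flag.exit, Flag.flip, relations]
    rw [hs, μ.mate_mate]
  rw [this]
  exact (μ.relations h).prod_word_mate s.exit

/-- Crossing the model face `a` acts on pairs of a coorientation (a choice of the upper side of the
tetrahedron) and an element of the group. -/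
def crossFun (a : Tet × Fin 4) (x : Bool × μ.EdgeGroup h) : Bool × μ.EdgeGroup h :=
  if x.1 = μ.side a.1 a.2 then (!μ.side (T.opp a).1 (T.opp a).2, x.2 * μ.gen h a)
  else (μ.side (T.opp a).1 (T.opp a).2, x.2 * (μ.gen h (T.opp a))⁻¹)

theorem crossFun_opp (a : Tet × Fin 4) (x : Bool × μ.EdgeGroup h) :
    μ.crossFun h (T.opp a) (μ.crossFun h a x) = x := by
  obtain ⟨b, g⟩ := x
  by_cases hb : b = μ.side a.1 a.2
  · simp [crossFun, hb, T.opp_opp]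
  · have hb' : (!μ.side a.1 a.2) = b := by
      cases b <;> cases hc : μ.side a.1 a.2 <;> simp_all
    simp [crossFun, hb, T.opp_opp, hb']

/-- The permutation by which the crossing of a model face acts. -/
def cross (a : Tet × Fin 4) : Equiv.Perm (Bool × μ.EdgeGroup h) where
  toFun := μ.crossFun h a
  invFun := μ.crossFun h (T.opp a)
  left_inv := μ.crossFun_opp h a
  right_inv x := by simpa [T.opp_opp] using μ.crossFun_opp h (T.opp a) x

theorem cross_opp (a : Tet × Fin 4) : μ.cross h (T.opp a) = (μ.cross h a)⁻¹ := by
  ext x : 1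
  rfl

/-- Up to the next dihedral angle `π`, an upward rotation stays upward: in a tetrahedron in between, the
angle is zero and the rotation passes from one side of the equator to the other. -/
theorem holonomy_up {s : Flag Tet} (hs : s.2.1 ≠ s.2.2) (g : μ.EdgeGroup h) (n : ℕ)
    (hn : ∀ k, 0 < k → k ≤ n → ¬ μ.IsPi ((T.rot ^ k) s)) :
    T.holonomy (μ.cross h) s (n + 1) (μ.side s.1 s.2.2, g) =
      (!μ.side ((T.rot ^ (n + 1)) s).1 ((T.rot ^ (n + 1)) s).2.1, g * μ.upProd h s (n + 1)) := by
  induction n with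
  | zero => simp [Triangulation.holonomy, upProd, cross, crossFun, Flag.exit, Triangulation.opp,
      T.rot_apply]
  | succ n ih =>
    rw [Triangulation.holonomy, Equiv.Perm.mul_apply, ih fun k hk hk' => hn k hk (hk'.trans n.le_succ),
      upProd_succ μ h s (n + 1), ← mul_assoc, pow_succ' T.rot (n + 1), Equiv.Perm.mul_apply]
    have hne := T.rot_pow_ne (n + 1) hs
    have hpi := hn (n + 1) n.succ_pos le_rfl
    generalize (T.rot ^ (n + 1)) s = u at *
    have hside : (!μ.side u.1 u.2.1) = μ.side u.1 u.2.2 := by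
      have : μ.side u.1 u.2.1 ≠ μ.side u.1 u.2.2 := by
        rw [Ne, μ.side_eq_iff]
        rintro (h1 | h1)
        · exact hne h1.symm
        · exact hpi h1
      cases h1 : μ.side u.1 u.2.1 <;> cases h2 : μ.side u.1 u.2.2 <;> simp_all
    change μ.crossFun h u.exit _ = _
    exact if_pos hside

theorem holonomy_down {s : Flag Tet} (hs : s.2.1 ≠ s.2.2) (g : μ.EdgeGroup h) (n : ℕ)
    (hn : ∀ k, 0 < k → k ≤ n → ¬ μ.IsPi ((T.rot ^ k) s)) :
    T.holonomy (μ.cross h) s (n + 1) (!μ.side s.1 s.2.2, g) =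
      (μ.side ((T.rot ^ (n + 1)) s).1 ((T.rot ^ (n + 1)) s).2.1, g * μ.downProd h s (n + 1)) := by
  induction n with
  | zero => simp [Triangulation.holonomy, downProd, cross, crossFun, Flag.exit, Triangulation.opp,
      T.rot_apply]
  | succ n ih =>
    rw [Triangulation.holonomy, Equiv.Perm.mul_apply, ih fun k hk hk' => hn k hk (hk'.trans n.le_succ),
      downProd_succ μ h s (n + 1), ← mul_assoc, pow_succ' T.rot (n + 1), Equiv.Perm.mul_apply]
    have hne := T.rot_pow_ne (n + 1) hs
    have hpi := hn (n + 1) n.succ_pos le_rfl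
    generalize (T.rot ^ (n + 1)) s = u at *
    have hside : μ.side u.1 u.2.1 ≠ μ.side u.1 u.2.2 := by
      rw [Ne, μ.side_eq_iff]
      rintro (h1 | h1)
      · exact hne h1.symm
      · exact hpi h1
    change μ.crossFun h u.exit _ = _
    exact if_neg hside

theorem holonomy_len_up {s : Flag Tet} (hs : μ.IsPi s) (g : μ.EdgeGroup h) :
    T.holonomy (μ.cross h) s (μ.len T s) (μ.side s.1 s.2.2, g) =
      (!μ.side (μ.next T s).1 (μ.next T s).2.2, g * μ.upProd h s (μ.len T s)) := by
  have hpos := len_pos (T := T) hs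
  have hmate := (μ.side_eq_iff _ _ _).2 (Or.inr (isPi_next (T := T) hs))
  rw [← hmate, next]
  obtain ⟨n, hn⟩ : ∃ n, μ.len T s = n + 1 := ⟨μ.len T s - 1, by omega⟩
  rw [hn]
  exact μ.holonomy_up h hs.ne g n fun k hk hk' => μ.not_isPi_of_lt_len T hk (by omega)

theorem holonomy_len_down {s : Flag Tet} (hs : μ.IsPi s) (g : μ.EdgeGroup h) :
    T.holonomy (μ.cross h) s (μ.len T s) (!μ.side s.1 s.2.2, g) =
      (μ.side (μ.next T s).1 (μ.next T s).2.2, g * (μ.upProd h (μ.next T s).flip (μ.len T s))⁻¹) := by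
  have hpos := len_pos (T := T) hs
  have hmate := (μ.side_eq_iff _ _ _).2 (Or.inr (isPi_next (T := T) hs))
  rw [← hmate, next, ← downProd_eq]
  obtain ⟨n, hn⟩ : ∃ n, μ.len T s = n + 1 := ⟨μ.len T s - 1, by omega⟩
  rw [hn]
  exact μ.holonomy_down h hs.ne g n fun k hk hk' => μ.not_isPi_of_lt_len T hk (by omega)

/-- A full rotation acts trivially: it goes up one side of a relation and down the other. -/
theorem holonomy_full {s : Flag Tet} (hs : μ.IsPi s) :
    T.holonomy (μ.cross h) s (μ.len T s + μ.len T (μ.next T s)) = 1 := by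
  have hs1 := isPi_next (T := T) hs
  have hnn := μ.next_next h hs
  ext ⟨b, g⟩ : 1
  rw [Triangulation.holonomy_add, Equiv.Perm.mul_apply]
  change T.holonomy (μ.cross h) (μ.next T s) _ _ = _
  by_cases hb : b = μ.side s.1 s.2.2
  · rw [hb, holonomy_len_up μ h hs, holonomy_len_down μ h hs1, hnn, ← μ.len_flip h hs,
      μ.upProd_flip h hs, mul_inv_cancel_right]
    rfl
  · have hb' : b = !μ.side s.1 s.2.2 := by
      cases b <;> cases hc : μ.side s.1 s.2.2 <;> simp_all
    have hlen : μ.len T s = μ.len T (μ.next T s).flip := by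
      rw [μ.len_flip h hs1, hnn]
    rw [hb', holonomy_len_down μ h hs, holonomy_len_up μ h hs1, hnn, hlen, μ.upProd_flip h hs1,
      inv_mul_cancel_right]
    rfl

/-- A rotation that ends where it starts acts trivially. -/
theorem holonomy_eq_one {s : Flag Tet} (hs : s.2.1 ≠ s.2.2) {n : ℕ} (hn : (T.rot ^ n) s = s) :
    T.holonomy (μ.cross h) s n = 1 := by
  classical
  obtain ⟨s₀, hs₀⟩ : ∃ s₀, T.rot.SameCycle s s₀ ∧ μ.IsPi s₀ := by
    have := μ.card_isPi h hs
    obtain ⟨s₀, hs₀⟩ := Finset.card_pos.1 (by rw [this]; norm_num)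
    exact ⟨s₀, (Finset.mem_filter.1 hs₀).2⟩
  obtain ⟨⟨m, rfl⟩, hpi⟩ : (∃ m : ℕ, (T.rot ^ m) s = s₀) ∧ μ.IsPi s₀ :=
    ⟨hs₀.1.exists_nat_pow_eq, hs₀.2⟩
  have hfix : (T.rot ^ n) ((T.rot ^ m) s) = (T.rot ^ m) s := by
    rw [← Equiv.Perm.mul_apply, ← pow_add, add_comm, pow_add, Equiv.Perm.mul_apply, hn]
  suffices h0 : T.holonomy (μ.cross h) ((T.rot ^ m) s) n = 1 by
    have h1 := T.holonomy_add (μ.cross h) s m n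
    rw [add_comm m n, Triangulation.holonomy_add, hn, h0, one_mul] at h1
    exact mul_left_cancel (h1.trans (mul_one _).symm)
  generalize (T.rot ^ m) s = u at hpi hfix
  set N := μ.len T u + μ.len T (μ.next T u) with hN
  have hNfix : (T.rot ^ N) u = u := by
    rw [hN, add_comm, pow_add, Equiv.Perm.mul_apply]
    exact μ.next_next h hpi
  have hmul : ∀ q, (T.rot ^ (N * q)) u = u ∧ T.holonomy (μ.cross h) u (N * q) = 1 := by
    intro q
    induction q with
    | zero => simp [Triangulation.holonomy]
    | succ q ih =>
      rw [mul_add, mul_one, pow_add, Equiv.Perm.mul_apply, hNfix, Triangulation.holonomy_add, ih.1, ih.2]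
      exact ⟨rfl, by rw [mul_one]; exact μ.holonomy_full h hpi⟩
  have hr : n % N = 0 := by
    have hNpos : 0 < N := by have := len_pos (T := T) hpi; omega
    have hlt := Nat.mod_lt n hNpos
    have hrfix : (T.rot ^ (n % N)) u = u := by
      conv_rhs => rw [← hfix, ← Nat.mod_add_div n N, pow_add, Equiv.Perm.mul_apply, (hmul _).1]
    by_contra hne
    rcases lt_trichotomy (n % N) (μ.len T u) with h1 | h1 | h1
    · exact μ.not_isPi_of_lt_len T (by omega) h1 (by rwa [hrfix])
    · rw [h1] at hrfix
      exact μ.next_ne h hpi hrfix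
    · have h2 : (T.rot ^ (n % N - μ.len T u)) (μ.next T u) = u := by
        rw [next, ← Equiv.Perm.mul_apply, ← pow_add, Nat.sub_add_cancel h1.le, hrfix]
      exact μ.not_isPi_of_lt_len T (s := μ.next T u) (k := n % N - μ.len T u) (by omega) (by omega)
        (by rwa [h2])
  rw [← Nat.mod_add_div n N, hr, zero_add]
  exact (hmul _).2

end Taut

end TautMatching

end TautTri

end

/-! ### Flat bundles over the realisation -/

noncomputable section

namespace TautTri

theorem permute_apply (g : Equiv.Perm (Fin 4)) (x : Simplex3) (i : Fin 4) :
    (permute g x).1 (g i) = x.1 i := by simp [permute]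

theorem permute_symm_permute (g : Equiv.Perm (Fin 4)) (x : Simplex3) :
    permute g.symm (permute g x) = x := by
  apply Subtype.ext
  funext i
  simp [permute]

theorem coord_nonneg (x : Simplex3) (i : Fin 4) : 0 ≤ x.1 i := x.2.1 i

theorem continuous_coord (i : Fin 4) : Continuous fun x : Simplex3 => x.1 i :=
  (continuous_apply i).comp continuous_subtype_val

/-- A point of a model tetrahedron. -/
abbrev ModelPoint (Tet : Type*) : Type _ := Σ _ : Tet, Simplex3

namespace Triangulation

variable {Tet : Type*} (T : Triangulation Tet)

/-- The point of the adjacent tetrahedron to which a point of face `a.2` of `a.1` is glued. -/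
def glue (a : Tet × Fin 4) (x : Simplex3) : ModelPoint Tet :=
  ⟨T.adj a.1 a.2, permute (T.gluing a.1 a.2) x⟩

theorem glue_opp_glue (a : Tet × Fin 4) (x : Simplex3) :
    T.glue (T.opp a) (T.glue a x).2 = ⟨a.1, x⟩ := by
  have h1 : T.adj (T.opp a).1 (T.opp a).2 = a.1 := T.adj_adj _ _
  have h2 : permute (T.gluing (T.opp a).1 (T.opp a).2) (T.glue a x).2 = x := by
    simp only [opp, glue, T.gluing_gluing, permute_symm_permute]
  exact Sigma.ext h1 (heq_of_eq h2)

theorem glue_coord (a : Tet × Fin 4) (x : Simplex3) (j : Fin 4) :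
    (T.glue a x).2.1 (T.gluing a.1 a.2 j) = x.1 j := permute_apply _ _ _

theorem glue_coord_opp {a : Tet × Fin 4} {x : Simplex3} (hx : x.1 a.2 = 0) :
    (T.glue a x).2.1 (T.opp a).2 = 0 := (T.glue_coord a x a.2).trans hx

theorem proj_glue {a : Tet × Fin 4} {x : Simplex3} (hx : x.1 a.2 = 0) :
    T.proj (T.glue a x).1 (T.glue a x).2 = T.proj a.1 x :=
  (Quot.sound (Glued.glue a.1 a.2 x hx)).symm

variable {T} in
/-- A property of model points that is inherited by the points to which they are glued only depends on
the point of the realisation. -/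
theorem iff_of_mk_eq {P : ModelPoint Tet → Prop}
    (hP : ∀ (a : Tet × Fin 4) x, x.1 a.2 = 0 → P ⟨a.1, x⟩ → P (T.glue a x)) {z z' : ModelPoint Tet}
    (h : Quot.mk T.Glued z = Quot.mk T.Glued z') : P z ↔ P z' := by
  replace h := Quot.eqvGen_exact h
  induction h with
  | rel _ _ h =>
    obtain ⟨t, i, x, hx⟩ := h
    refine ⟨hP (t, i) x hx, fun h => ?_⟩
    rw [← T.glue_opp_glue (t, i) x]
    exact hP (T.opp (t, i)) _ (T.glue_coord_opp (a := (t, i)) hx) h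
  | refl => rfl
  | symm _ _ _ ih => exact ih.symm
  | trans _ _ _ _ _ ih1 ih2 => exact ih1.trans ih2

variable {K : Type*} [Group K] (ρ : Tet × Fin 4 → K)

/-- A section over an open subset `dom` of the realisation (given by its preimage in the model
tetrahedra) of the flat bundle with fibre `K` whose transition functions across the faces are `ρ`. -/
structure LocalSection where
  dom : Set (ModelPoint Tet)
  val : ModelPoint Tet → K
  glue_mem : ∀ a x, x.1 a.2 = 0 → ⟨a.1, x⟩ ∈ dom → T.glue a x ∈ dom
  val_glue : ∀ a x, x.1 a.2 = 0 → ⟨a.1, x⟩ ∈ dom → val (T.glue a x) = ρ a * val ⟨a.1, x⟩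
  isOpen_fiber : ∀ k, IsOpen {z | z ∈ dom ∧ val z = k}

theorem isOpen_modelPoint {P : Tet → Simplex3 → Prop} (h : ∀ t, IsOpen {x | P t x}) :
    IsOpen {z : ModelPoint Tet | P z.1 z.2} :=
  isOpen_sigma_iff.2 h

/-- The local section over the interior of a tetrahedron. -/
def LocalSection.tet (t : Tet) : T.LocalSection ρ where
  dom := {z | z.1 = t ∧ ∀ i, 0 < z.2.1 i}
  val _ := 1
  glue_mem a x hx h := absurd hx (h.2 a.2).ne'
  val_glue a x hx h := absurd hx (h.2 a.2).ne'
  isOpen_fiber k := by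
    refine isOpen_modelPoint (P := fun t' x => (t' = t ∧ ∀ i, 0 < x.1 i) ∧ (1 : K) = k) fun t' => ?_
    simp only [Set.ofPred_and, Set.ofPred_forall]
    exact (isOpen_const.inter (isOpen_iInter_of_finite fun i =>
      isOpen_lt continuous_const (continuous_coord i))).inter isOpen_const

/-- The coordinate `i` is smaller than the others: the point is near the interior of face `i`. -/
def NearFace (i : Fin 4) (x : Simplex3) : Prop := ∀ j, j ≠ i → x.1 i < x.1 j

theorem isOpen_nearFace (i : Fin 4) : IsOpen {x | NearFace i x} := by
  simp only [NearFace, Set.ofPred_forall]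
  exact isOpen_iInter_of_finite fun j => isOpen_iInter_of_finite fun _ =>
    isOpen_lt (continuous_coord i) (continuous_coord j)

theorem NearFace.eq_of_zero {i j : Fin 4} {x : Simplex3} (h : NearFace i x) (hj : x.1 j = 0) :
    j = i := by
  by_contra hne
  exact absurd (h j hne) (by rw [hj]; exact (coord_nonneg x i).not_gt)

theorem NearFace.eq {i j : Fin 4} {x : Simplex3} (h : NearFace i x) (h' : NearFace j x) : i = j := by
  by_contra hne
  exact lt_asymm (h j (Ne.symm hne)) (h' i hne)

theorem NearFace.glue {a : Tet × Fin 4} {x : Simplex3} (h : NearFace a.2 x) :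
    NearFace (T.opp a).2 (T.glue a x).2 := by
  intro j hj
  obtain ⟨j, rfl⟩ := (T.gluing a.1 a.2).surjective j
  rw [glue_coord]
  have h1 : (T.glue a x).2.1 (T.opp a).2 = x.1 a.2 := T.glue_coord a x a.2
  rw [h1]
  exact h j fun h2 => hj (by rw [h2]; rfl)

open Classical in
/-- The local section near the interior of a face. -/
def LocalSection.face (hρ : ∀ a, ρ (T.opp a) = (ρ a)⁻¹) (a : Tet × Fin 4) : T.LocalSection ρ where
  dom := {z | (z.1 = a.1 ∧ NearFace a.2 z.2) ∨ (z.1 = (T.opp a).1 ∧ NearFace (T.opp a).2 z.2)}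
  val z := if z.1 = a.1 ∧ NearFace a.2 z.2 then 1 else ρ a
  glue_mem := by
    rintro ⟨t, i⟩ x hx (⟨h1, h2⟩ | ⟨h1, h2⟩)
    · obtain rfl : (t, i) = a := Prod.ext h1 (h2.eq_of_zero hx)
      exact Or.inr ⟨rfl, h2.glue T⟩
    · have h3 : (t, i) = T.opp a := Prod.ext h1 (h2.eq_of_zero hx)
      have h4 : T.opp (t, i) = a := by rw [h3, T.opp_opp]
      refine Or.inl ⟨congrArg Prod.fst h4, ?_⟩
      rw [← h4]
      have h5 : NearFace (t, i).2 x := by rw [h3]; exact h2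
      exact h5.glue T
  val_glue := by
    have hne : ∀ (z : ModelPoint Tet), z.1 = (T.opp a).1 ∧ NearFace (T.opp a).2 z.2 →
        ¬ (z.1 = a.1 ∧ NearFace a.2 z.2) := fun z h h' =>
      T.ne_self a.1 a.2 (Prod.ext (h.1.symm.trans h'.1) (h.2.eq h'.2))
    rintro ⟨t, i⟩ x hx (⟨h1, h2⟩ | ⟨h1, h2⟩)
    · obtain rfl : (t, i) = a := Prod.ext h1 (h2.eq_of_zero hx)
      rw [if_neg (hne _ ⟨rfl, h2.glue T⟩), if_pos ⟨h1, h2⟩, mul_one]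
    · have h3 : (t, i) = T.opp a := Prod.ext h1 (h2.eq_of_zero hx)
      have h4 : T.opp (t, i) = a := by rw [h3, T.opp_opp]
      have h5 : NearFace (t, i).2 x := by rw [h3]; exact h2
      have h6 := h5.glue T
      rw [if_neg (hne _ ⟨h1, h2⟩), if_pos, h3, hρ, inv_mul_cancel]
      refine ⟨congrArg Prod.fst h4, ?_⟩
      rwa [h4] at h6
  isOpen_fiber k := by
    have heq : {z : ModelPoint Tet | ((z.1 = a.1 ∧ NearFace a.2 z.2) ∨
        (z.1 = (T.opp a).1 ∧ NearFace (T.opp a).2 z.2)) ∧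
          (if z.1 = a.1 ∧ NearFace a.2 z.2 then 1 else ρ a) = k} =
        {z | (z.1 = a.1 ∧ NearFace a.2 z.2) ∧ 1 = k} ∪
          {z | (z.1 = (T.opp a).1 ∧ NearFace (T.opp a).2 z.2) ∧ ρ a = k} := by
      ext z
      have hne : z.1 = (T.opp a).1 ∧ NearFace (T.opp a).2 z.2 →
          ¬ (z.1 = a.1 ∧ NearFace a.2 z.2) := fun h h' =>
        T.ne_self a.1 a.2 (Prod.ext (h.1.symm.trans h'.1) (h.2.eq h'.2))
      simp only [Set.mem_ofPred_eq, Set.mem_union]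
      split_ifs with h <;> tauto
    refine heq ▸ IsOpen.union ?_ ?_
    · refine isOpen_modelPoint (P := fun t x => (t = a.1 ∧ NearFace a.2 x) ∧ (1 : K) = k) fun t => ?_
      exact (isOpen_const.inter (isOpen_nearFace _)).inter isOpen_const
    · refine isOpen_modelPoint
        (P := fun t x => (t = (T.opp a).1 ∧ NearFace (T.opp a).2 x) ∧ ρ a = k) fun t => ?_
      exact (isOpen_const.inter (isOpen_nearFace _)).inter isOpen_const

/-- The point lies in the tetrahedron of the flag, and near the interior of its edge: the coordinates
that vanish on this edge are smaller than the others. -/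
def NearEdge (s : Flag Tet) (z : ModelPoint Tet) : Prop :=
  s.1 = z.1 ∧ ∀ k, k ≠ s.2.1 → k ≠ s.2.2 → z.2.1 s.2.1 < z.2.1 k ∧ z.2.1 s.2.2 < z.2.1 k

theorem isOpen_nearEdge (s : Flag Tet) : IsOpen {z | NearEdge s z} := by
  refine isOpen_modelPoint (P := fun t x => s.1 = t ∧ ∀ k, k ≠ s.2.1 → k ≠ s.2.2 →
    x.1 s.2.1 < x.1 k ∧ x.1 s.2.2 < x.1 k) fun t => ?_
  simp only [Set.ofPred_and, Set.ofPred_forall]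
  exact isOpen_const.inter (isOpen_iInter_of_finite fun k => isOpen_iInter_of_finite fun _ =>
    isOpen_iInter_of_finite fun _ => (isOpen_lt (continuous_coord _) (continuous_coord _)).inter
      (isOpen_lt (continuous_coord _) (continuous_coord _)))

theorem NearEdge.flip {s : Flag Tet} {z : ModelPoint Tet} (h : NearEdge s z) : NearEdge s.flip z :=
  ⟨h.1, fun k h1 h2 => (h.2 k h2 h1).symm⟩

theorem NearEdge.eq_or_eq_of_zero {s : Flag Tet} {z : ModelPoint Tet} (h : NearEdge s z) {m : Fin 4}
    (hm : z.2.1 m = 0) : m = s.2.1 ∨ m = s.2.2 := by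
  by_contra! hne
  exact absurd (h.2 m hne.1 hne.2).1 (by rw [hm]; exact (coord_nonneg _ _).not_gt)

theorem NearEdge.rot {s : Flag Tet} {x : Simplex3} (h : NearEdge s ⟨s.1, x⟩) :
    NearEdge (T.rot s) (T.glue s.exit x) := by
  refine ⟨rfl, fun k h1 h2 => ?_⟩
  obtain ⟨k, rfl⟩ := (T.gluing s.1 s.2.2).surjective k
  rw [rot_apply] at h1 h2 ⊢
  have h3 := h.2 k (fun h => h2 (by rw [h])) (fun h => h1 (by rw [h]))
  simp only [Flag.exit]
  have e := T.glue_coord (s.1, s.2.2) x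
  simp only at e
  rw [e, e, e]
  exact h3.symm

theorem NearEdge.eq_or_eq_flip {s s' : Flag Tet} {z : ModelPoint Tet} (h : NearEdge s z)
    (h' : NearEdge s' z) (hs : s.2.1 ≠ s.2.2) (hs' : s'.2.1 ≠ s'.2.2) : s' = s ∨ s' = s.flip := by
  refine eq_or_eq_flip_of_modelEdge_eq hs hs' ?_
  refine Prod.ext (h.1.trans h'.1.symm) (Subtype.ext ?_)
  rw [modelEdge_snd hs, modelEdge_snd hs', compl_inj_iff]
  have hsub : ∀ k, k ∈ ({s'.2.1, s'.2.2} : Finset (Fin 4)) →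
      k ∈ ({s.2.1, s.2.2} : Finset (Fin 4)) := by
    intro k hk
    by_contra hk'
    simp only [Finset.mem_insert, Finset.mem_singleton, not_or] at hk hk'
    obtain ⟨h1, h2⟩ := h.2 k hk'.1 hk'.2
    have h3 : s.2.1 = s'.2.1 ∨ s.2.1 = s'.2.2 := by
      by_contra! hne
      have := h'.2 s.2.1 hne.1 hne.2
      rcases hk with rfl | rfl
      · exact lt_asymm h1 this.1
      · exact lt_asymm h1 this.2
    have h4 : s.2.2 = s'.2.1 ∨ s.2.2 = s'.2.2 := by
      by_contra! hne
      have := h'.2 s.2.2 hne.1 hne.2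
      rcases hk with rfl | rfl
      · exact lt_asymm h2 this.1
      · exact lt_asymm h2 this.2
    rcases hk with rfl | rfl
    · exact hs ((h3.resolve_left (Ne.symm hk'.1)).trans (h4.resolve_left (Ne.symm hk'.2)).symm)
    · exact hs ((h3.resolve_right (Ne.symm hk'.1)).trans (h4.resolve_right (Ne.symm hk'.2)).symm)
  refine (Finset.eq_of_subset_of_card_le hsub ?_).symm
  rw [Finset.card_pair hs, Finset.card_pair hs']

/-- Near an edge, a step of rotation is determined by the point. -/
theorem NearEdge.holonomy_eq {s : Flag Tet} (hs : s.2.1 ≠ s.2.2)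
    (hflat : ∀ s : Flag Tet, s.2.1 ≠ s.2.2 → ∀ n, (T.rot ^ n) s = s → T.holonomy ρ s n = 1)
    {m n : ℕ} {z : ModelPoint Tet} (hm : NearEdge ((T.rot ^ m) s) z)
    (hn : NearEdge ((T.rot ^ n) s) z) : T.holonomy ρ s m = T.holonomy ρ s n := by
  wlog hmn : m ≤ n generalizing m n
  · exact (this hn hm (le_of_not_ge hmn)).symm
  have hcyc : (T.rot ^ n) s = (T.rot ^ (n - m)) ((T.rot ^ m) s) := by
    rw [← Equiv.Perm.mul_apply, ← pow_add, Nat.sub_add_cancel hmn]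
  have hfix : (T.rot ^ (n - m)) ((T.rot ^ m) s) = (T.rot ^ m) s := by
    rw [← hcyc]
    refine (hm.eq_or_eq_flip hn (T.rot_pow_ne m hs) (T.rot_pow_ne n hs)).resolve_right fun h => ?_
    refine T.not_sameCycle_flip (T.rot_pow_ne m hs) ⟨(n - m : ℕ), ?_⟩
    rw [zpow_natCast, ← hcyc, h]
  have h := T.holonomy_add ρ s m (n - m)
  rw [hflat _ (T.rot_pow_ne m hs) _ hfix, one_mul, Nat.add_sub_cancel' hmn] at h
  exact h.symm

open Classical in
/-- The local section near the interior of an edge: the holonomy of the rotation about the edge. -/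
def LocalSection.edge [Finite Tet] (hρ : ∀ a, ρ (T.opp a) = (ρ a)⁻¹)
    (hflat : ∀ s : Flag Tet, s.2.1 ≠ s.2.2 → ∀ n, (T.rot ^ n) s = s → T.holonomy ρ s n = 1)
    (s : Flag Tet) (hs : s.2.1 ≠ s.2.2) : T.LocalSection ρ :=
  have hval : ∀ {n : ℕ} {z : ModelPoint Tet}, NearEdge ((T.rot ^ n) s) z →
      (if hz : ∃ n : ℕ, NearEdge ((T.rot ^ n) s) z then T.holonomy ρ s hz.choose else 1) =
        T.holonomy ρ s n := fun {n z} h => by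
    have hz : ∃ n : ℕ, NearEdge ((T.rot ^ n) s) z := ⟨n, h⟩
    rw [dif_pos hz]
    exact NearEdge.holonomy_eq T ρ hs hflat hz.choose_spec h
  have hglue : ∀ (a : Tet × Fin 4) (x : Simplex3), x.1 a.2 = 0 → ∀ n : ℕ,
      NearEdge ((T.rot ^ n) s) ⟨a.1, x⟩ →
      ∃ m : ℕ, NearEdge ((T.rot ^ m) s) (T.glue a x) ∧
        T.holonomy ρ s m = ρ a * T.holonomy ρ s n := by
    rintro ⟨t, i⟩ x hx n h
    obtain rfl : ((T.rot ^ n) s).1 = t := h.1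
    rcases h.eq_or_eq_of_zero hx with h1 | h1
    · obtain ⟨m, hm⟩ : ∃ m : ℕ, T.rot ((T.rot ^ m) s) = (T.rot ^ n) s := by
        refine ⟨n + (orderOf T.rot - 1), ?_⟩
        rw [← Equiv.Perm.mul_apply, ← pow_succ', add_assoc,
          Nat.sub_add_cancel (orderOf_pos T.rot), pow_add, pow_orderOf_eq_one, mul_one]
      have hflip : T.rot ((T.rot ^ n) s).flip = ((T.rot ^ m) s).flip := by
        rw [← hm, T.rot_flip_rot]
      have hexit : T.opp ((T.rot ^ m) s).exit = (((T.rot ^ n) s).1, i) := by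
        simp only at h1
        rw [h1, ← hm]
        rfl
      refine ⟨m, ?_, ?_⟩
      · have h2 := NearEdge.rot T (s := ((T.rot ^ n) s).flip) (x := x) h.flip
        rw [hflip] at h2
        have h3 := h2.flip
        rw [Flag.flip_flip] at h3
        simp only at h1
        rw [h1]
        exact h3
      · have h2 : T.holonomy ρ s (m + 1) = T.holonomy ρ s n := by
          refine NearEdge.holonomy_eq T ρ hs hflat (z := ⟨_, x⟩) ?_ h
          rw [pow_succ', Equiv.Perm.mul_apply, hm]
          exact h
        rw [← h2, holonomy, ← hexit, hρ, inv_mul_cancel_left]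
    · simp only at h1
      refine ⟨n + 1, ?_, ?_⟩
      · rw [pow_succ', Equiv.Perm.mul_apply, h1]
        exact NearEdge.rot T h
      · rw [h1]
        rfl
  { dom := {z | ∃ n : ℕ, NearEdge ((T.rot ^ n) s) z}
    val := fun z =>
      if hz : ∃ n : ℕ, NearEdge ((T.rot ^ n) s) z then T.holonomy ρ s hz.choose else 1
    glue_mem := fun a x hx ⟨n, h⟩ => (hglue a x hx n h).imp fun _ h => h.1
    val_glue := fun a x hx ⟨n, h⟩ => by
      obtain ⟨m, h1, h2⟩ := hglue a x hx n h
      rw [hval h1, hval h, h2]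
    isOpen_fiber := fun k => by
      have heq : {z : ModelPoint Tet | (∃ n : ℕ, NearEdge ((T.rot ^ n) s) z) ∧
          (if hz : ∃ n : ℕ, NearEdge ((T.rot ^ n) s) z then T.holonomy ρ s hz.choose else 1) = k} =
          ⋃ (n : ℕ) (_ : T.holonomy ρ s n = k), {z | NearEdge ((T.rot ^ n) s) z} := by
        ext z
        simp only [Set.mem_ofPred_eq, Set.mem_iUnion, exists_prop]
        constructor
        · rintro ⟨⟨n, hn⟩, h⟩
          exact ⟨n, (hval hn).symm.trans h, hn⟩
        · rintro ⟨n, h, hn⟩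
          exact ⟨⟨n, hn⟩, (hval hn).trans h⟩
      exact heq ▸ isOpen_iUnion fun n => isOpen_iUnion fun _ => isOpen_nearEdge _ }

/-- Every point other than a vertex has a local section near it. -/
theorem exists_localSection [Finite Tet] (hρ : ∀ a, ρ (T.opp a) = (ρ a)⁻¹)
    (hflat : ∀ s : Flag Tet, s.2.1 ≠ s.2.2 → ∀ n, (T.rot ^ n) s = s → T.holonomy ρ s n = 1)
    (z : ModelPoint Tet) (hz : ∃ k l, k ≠ l ∧ 0 < z.2.1 k ∧ 0 < z.2.1 l) :
    ∃ α : T.LocalSection ρ, z ∈ α.dom := by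
  obtain ⟨k, l, hkl, hk, hl⟩ := hz
  by_cases h0 : ∀ i, 0 < z.2.1 i
  · exact ⟨.tet T ρ z.1, rfl, h0⟩
  push Not at h0
  obtain ⟨i, hi⟩ := h0
  have hi0 : z.2.1 i = 0 := le_antisymm hi (coord_nonneg _ _)
  by_cases h1 : ∀ j, j ≠ i → 0 < z.2.1 j
  · refine ⟨.face T ρ hρ (z.1, i), Or.inl ⟨rfl, fun j hj => ?_⟩⟩
    rw [hi0]
    exact h1 j hj
  · push Not at h1
    obtain ⟨j, hji, hj⟩ := h1
    have hj0 : z.2.1 j = 0 := le_antisymm hj (coord_nonneg _ _)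
    refine ⟨.edge T ρ hρ hflat (z.1, i, j) hji.symm, 0, rfl, fun m hm1 hm2 => ?_⟩
    have hm : m = k ∨ m = l := by
      have : ∀ i j k l m : Fin 4, i ≠ j → k ≠ l → k ≠ i → k ≠ j → l ≠ i → l ≠ j → m ≠ i → m ≠ j →
          m = k ∨ m = l := by decide
      refine this i j k l m hji.symm hkl ?_ ?_ ?_ ?_ hm1 hm2
      · rintro rfl
        exact hk.ne' hi0
      · rintro rfl
        exact hk.ne' hj0
      · rintro rfl
        exact hl.ne' hi0
      · rintro rfl
        exact hl.ne' hj0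
    simp only [pow_zero, Equiv.Perm.one_apply, hi0, hj0, and_self]
    rcases hm with rfl | rfl
    · exact hk
    · exact hl

variable {T ρ}

theorem LocalSection.isOpen_dom (α : T.LocalSection ρ) : IsOpen α.dom := by
  have : α.dom = ⋃ k, {z | z ∈ α.dom ∧ α.val z = k} := by
    ext z
    simp
  rw [this]
  exact isOpen_iUnion α.isOpen_fiber

/-- The transition function between two local sections. -/
def LocalSection.trans (α β : T.LocalSection ρ) (z : ModelPoint Tet) : K := (β.val z)⁻¹ * α.val z

theorem LocalSection.mem_iff_of_eq (α : T.LocalSection ρ) {z z' : ModelPoint Tet}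
    (h : (Quot.mk T.Glued z) = Quot.mk T.Glued z') : z ∈ α.dom ↔ z' ∈ α.dom :=
  iff_of_mk_eq α.glue_mem h

theorem LocalSection.trans_eq_of_eq (α β : T.LocalSection ρ) {z z' : ModelPoint Tet}
    (h : (Quot.mk T.Glued z) = Quot.mk T.Glued z') (hα : z ∈ α.dom) (hβ : z ∈ β.dom) :
    α.trans β z = α.trans β z' := by
  replace h := Quot.eqvGen_exact h
  induction h with
  | rel _ _ h =>
    obtain ⟨t, i, x, hx⟩ := h
    have h1 := α.val_glue (t, i) x hx hα
    have h2 := β.val_glue (t, i) x hx hβ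
    change _ = (β.val (T.glue (t, i) x))⁻¹ * α.val (T.glue (t, i) x)
    rw [h1, h2, trans]
    group
  | refl => rfl
  | symm y y' h' ih =>
    have h1 := Quot.eqvGen_sound h'
    exact (ih ((α.mem_iff_of_eq h1).2 hα) ((β.mem_iff_of_eq h1).2 hβ)).symm
  | trans y y' y'' h1 h2 ih1 ih2 =>
    have h3 := Quot.eqvGen_sound h1
    exact (ih1 hα hβ).trans (ih2 ((α.mem_iff_of_eq h3).1 hα)
      ((β.mem_iff_of_eq h3).1 hβ))

/-- A property of model points that is compatible with the gluing and open gives an open subset of the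
realisation. -/
theorem isOpen_of_forall_mk {P : ModelPoint Tet → Prop}
    (hP : ∀ z z', (Quot.mk T.Glued z) = Quot.mk T.Glued z' → P z → P z')
    (ho : IsOpen {z | P z}) : IsOpen {p : T.Realisation | P p.out} := by
  rw [← isQuotientMap_quot_mk.isOpen_preimage]
  convert ho using 1
  ext z
  have h : Quot.mk T.Glued (Quot.mk T.Glued z).out = Quot.mk T.Glued z := Quot.out_eq _
  exact ⟨hP _ _ h, hP _ _ h.symm⟩

section Bundle

variable [TopologicalSpace K] [DiscreteTopology K] {M : Type*} [TopologicalSpace M]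
  (f : M → T.Realisation) (hf : Continuous f) (hcov : ∀ m, ∃ α : T.LocalSection ρ, (f m).out ∈ α.dom)

/-- The flat bundle with fibre `K` and transition functions `ρ`, pulled back to a space `M` along a map
to the realisation that avoids the vertices. -/
def flatBundle : FiberBundleCore (T.LocalSection ρ) M K where
  baseSet α := {m | (f m).out ∈ α.dom}
  isOpen_baseSet α := (isOpen_of_forall_mk (P := fun z => z ∈ α.dom)
    (fun _ _ h => (α.mem_iff_of_eq h).1) α.isOpen_dom).preimage hf
  indexAt m := (hcov m).choose
  mem_baseSet_at m := (hcov m).choose_spec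
  coordChange α β m k := α.trans β (f m).out * k
  coordChange_self α m _ k := by simp [LocalSection.trans]
  continuousOn_coordChange α β := by
    rintro ⟨m, k⟩ ⟨⟨h1, h2⟩, -⟩
    have hopen : IsOpen {m' | (f m').out ∈ α.dom ∧ (f m').out ∈ β.dom ∧
        α.trans β (f m').out = α.trans β (f m).out} := by
      refine (isOpen_of_forall_mk (P := fun z => z ∈ α.dom ∧ z ∈ β.dom ∧
        α.trans β z = α.trans β (f m).out) ?_ ?_).preimage hf
      · rintro z z' h ⟨h3, h4, h5⟩
        exact ⟨(α.mem_iff_of_eq h).1 h3, (β.mem_iff_of_eq h).1 h4,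
          (α.trans_eq_of_eq β h h3 h4).symm.trans h5⟩
      · have : {z | z ∈ α.dom ∧ z ∈ β.dom ∧ α.trans β z = α.trans β (f m).out} =
            ⋃ (a : K) (b : K) (_ : b⁻¹ * a = α.trans β (f m).out),
              {z | z ∈ α.dom ∧ α.val z = a} ∩ {z | z ∈ β.dom ∧ β.val z = b} := by
          ext z
          simp only [Set.mem_ofPred_eq, Set.mem_iUnion, Set.mem_inter_iff, LocalSection.trans]
          constructor
          · rintro ⟨h3, h4, h5⟩
            exact ⟨_, _, h5, ⟨h3, rfl⟩, h4, rfl⟩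
          · rintro ⟨_, _, h5, ⟨h3, rfl⟩, h4, rfl⟩
            exact ⟨h3, h4, h5⟩
        rw [this]
        exact isOpen_iUnion fun a => isOpen_iUnion fun b => isOpen_iUnion fun _ =>
          (α.isOpen_fiber a).inter (β.isOpen_fiber b)
    have hev : ∀ᶠ p : M × K in 𝓝 (m, k), α.trans β (f m).out * p.2 = α.trans β (f p.1).out * p.2 := by
      filter_upwards [(hopen.preimage continuous_fst).mem_nhds ⟨h1, h2, rfl⟩] with p hp
      rw [hp.2.2]
    exact ((by fun_prop : ContinuousAt (fun p : M × K => α.trans β (f m).out * p.2) (m, k)).congr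
      hev).continuousWithinAt
  coordChange_comp α β γ m _ k := by
    simp only [LocalSection.trans]
    group

include hf hcov in
/-- A null-homotopic loop lifts to a loop in the flat bundle. In terms of the model tetrahedra, this is
a function with values in the fibre that is constant along the arcs of the loop in the tetrahedra,
changes by `ρ` when the loop crosses a face, and has the period of the loop. -/
theorem exists_transport {x : M} (γ : Path x x) (hγ : γ.Homotopic (Path.refl x)) {c : ℝ → M}
    (hper : ∀ s, c (s + 1) = c s) (hc : ∀ s : unitInterval, γ s = c s) :
    ∃ v : ℝ → ModelPoint Tet → K,
      (∀ s z, v (s + 1) z = v s z) ∧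
      (∀ s a x, T.proj a.1 x = f (c s) → x.1 a.2 = 0 → v s (T.glue a x) = ρ a * v s ⟨a.1, x⟩) ∧
      ∀ t a b (d : ℝ → Simplex3), a ≤ b → ContinuousOn d (Set.Icc a b) →
        (∀ s ∈ Set.Icc a b, T.proj t (d s) = f (c s)) → v a ⟨t, d a⟩ = v b ⟨t, d b⟩ := by
  set Z := flatBundle f hf hcov
  have cov : IsCoveringMap Z.proj := IsFiberBundle.isCoveringMap fun m =>
    ⟨Z.localTriv (Z.indexAt m), Z.mem_baseSet_at m⟩
  let e₀ : Z.TotalSpace := ⟨x, (1 : K)⟩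
  let fib : Z.TotalSpace → K := fun e => e.2
  let Γ : C(unitInterval, Z.TotalSpace) := cov.liftPath γ.toContinuousMap e₀ γ.source
  have hΓ : ∀ s : unitInterval, Z.proj (Γ s) = γ s := fun s =>
    congrFun (cov.liftPath_lifts γ.toContinuousMap e₀ γ.source) s
  have hΓ01 : Γ 0 = Γ 1 := by
    have h1 : Γ 0 = e₀ := cov.liftPath_zero γ.toContinuousMap e₀ γ.source
    have h2 := cov.liftPath_apply_one_eq_of_homotopicRel (γ₀ := γ.toContinuousMap)
      (γ₁ := ContinuousMap.const unitInterval x) hγ e₀ γ.source rfl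
    have h3 := congrArg (fun g : C(unitInterval, Z.TotalSpace) => g 1) (cov.liftPath_const (e := e₀) (x := x) rfl)
    rw [h1]
    exact (h2.trans h3).symm
  let G : ℝ → Z.TotalSpace := fun s => Γ ⟨Int.fract s, (unitInterval.fract_mem s)⟩
  have hGcont : Continuous G := by
    have h1 : ContinuousOn (fun s : ℝ => Γ (Set.projIcc 0 1 zero_le_one s)) (Set.Icc 0 1) :=
      (Γ.continuous.comp continuous_projIcc).continuousOn
    have h2 := h1.comp_fract'' (by simpa using hΓ01)
    refine h2.congr fun s => ?_
    simp only [Function.comp, G]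
    rw [Set.projIcc_of_mem]
  have hGper : ∀ s, G (s + 1) = G s := fun s => by
    simp only [G, Int.fract_add_one]
  have hcfract : ∀ s, c (Int.fract s) = c s := fun s => by
    have h1 : Function.Periodic c 1 := hper
    have h2 := h1.sub_int_mul_eq (x := s) ⌊s⌋
    rwa [mul_one] at h2
  have hG : ∀ s, (G s).proj = c s := fun s => by
    rw [← hcfract s]
    exact (hΓ _).trans (hc _)
  have hmem : ∀ s z, Quot.mk T.Glued z = f (c s) → z ∈ (Z.indexAt (G s).proj).dom := fun s z hz => by
    have h1 := Z.mem_baseSet_at (G s).proj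
    refine (LocalSection.mem_iff_of_eq _ ?_).1 h1
    rw [Quot.out_eq, hG, hz]
  refine ⟨fun s z => (Z.indexAt (G s).proj).val z * fib (G s), fun s z => by beta_reduce; rw [hGper],
    fun s a x hx h0 => ?_, fun t a b d hab hd hrun => ?_⟩
  · beta_reduce
    rw [LocalSection.val_glue _ a x h0 (hmem s _ hx), mul_assoc]
  · -- The values along an arc are locally constant, as they are the product of the value of a local
    -- section and the coordinate of the lift in the corresponding trivialisation.
    set g : ℝ → K := fun s => (Z.indexAt (G s).proj).val ⟨t, d s⟩ * fib (G s) with hg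
    have hgc : ContinuousOn g (Set.Icc a b) := by
      intro s₀ hs₀
      set α := Z.indexAt (G s₀).proj with hα
      have hα₀ : (⟨t, d s₀⟩ : ModelPoint Tet) ∈ α.dom := hmem s₀ _ (hrun s₀ hs₀)
      have hdc : ContinuousWithinAt (fun s => (⟨t, d s⟩ : ModelPoint Tet)) (Set.Icc a b) s₀ :=
        (continuous_sigmaMk.continuousAt).comp_continuousWithinAt (hd s₀ hs₀)
      have hev1 := hdc ((α.isOpen_fiber (α.val ⟨t, d s₀⟩)).mem_nhds ⟨hα₀, rfl⟩)
      have htriv : ContinuousAt (fun s => (Z.localTriv α (G s)).2) s₀ := by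
        have h1 := (Z.localTriv α).continuousOn_toFun.continuousAt
          ((Z.localTriv α).open_source.mem_nhds (Z.mem_baseSet_at (G s₀).proj))
        exact continuous_snd.continuousAt.comp (ContinuousAt.comp h1 hGcont.continuousAt)
      have h2 : ContinuousWithinAt (fun s => α.val ⟨t, d s₀⟩ * (Z.localTriv α (G s)).2)
          (Set.Icc a b) s₀ := (continuousAt_const.mul htriv).continuousWithinAt
      have key : ∀ s ∈ Set.Icc a b, (⟨t, d s⟩ : ModelPoint Tet) ∈ α.dom →
          α.val ⟨t, d s⟩ = α.val ⟨t, d s₀⟩ →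
          g s = α.val ⟨t, d s₀⟩ * (Z.localTriv α (G s)).2 := by
        intro s hs h3 h4
        have h5 : (Z.localTriv α (G s)).2 =
            (Z.indexAt (G s).proj).trans α (f (G s).proj).out * fib (G s) := rfl
        rw [h5, ← LocalSection.trans_eq_of_eq (z := ⟨t, d s⟩) _ _ ?_ (hmem s _ (hrun s hs)) h3,
          LocalSection.trans, h4]
        · simp only [hg]
          group
        · rw [Quot.out_eq, hG]
          exact hrun s hs
      refine h2.congr_of_eventuallyEq ?_ (key s₀ hs₀ hα₀ rfl)
      filter_upwards [hev1, self_mem_nhdsWithin] with s h3 h4 using key s h4 h3.1 h3.2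
    exact isPreconnected_Icc.constant hgc (Set.left_mem_Icc.2 hab) (Set.right_mem_Icc.2 hab)

end Bundle

end Triangulation

end TautTri

end

/-! ### Lifts to the model tetrahedra -/

noncomputable section

namespace TautTri

namespace Triangulation

variable {Tet : Type*} {T : Triangulation Tet}

theorem mk_mem_skeleton2 {z : ModelPoint Tet} :
    Quot.mk T.Glued z ∈ T.skeleton2 ↔ ∃ i, z.2.1 i = 0 := by
  constructor
  · rintro ⟨t, x, h, hx⟩
    refine (iff_of_mk_eq (T := T) (P := fun z => ∃ i, z.2.1 i = 0) ?_ h).2 hx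
    rintro a x hx -
    exact ⟨_, T.glue_coord_opp hx⟩
  · rintro ⟨i, hi⟩
    exact ⟨z.1, z.2, rfl, i, hi⟩

theorem isOpen_compl_skeleton2 : IsOpen (T.skeleton2)ᶜ := by
  have h1 : IsOpen {z : ModelPoint Tet | ¬ ∃ i, z.2.1 i = 0} := by
    refine isOpen_modelPoint (P := fun _ x => ¬ ∃ i, x.1 i = 0) fun _ => ?_
    simp only [not_exists, Set.ofPred_forall]
    exact isOpen_iInter_of_finite fun i =>
      isOpen_ne_fun (continuous_coord i) continuous_const
  have h2 := isOpen_of_forall_mk (T := T) (P := fun z => ¬ ∃ i, z.2.1 i = 0) (fun z z' h => by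
    rw [← mk_mem_skeleton2 (T := T), ← mk_mem_skeleton2 (T := T), h]
    exact id) h1
  convert h2 using 1
  ext p
  rw [Set.mem_compl_iff, Set.mem_ofPred_eq, ← mk_mem_skeleton2 (T := T), Quot.out_eq]

/-- A point off the two-skeleton has only one model. -/
theorem eq_of_mk_eq_of_notMem {z z' : ModelPoint Tet} (h : Quot.mk T.Glued z = Quot.mk T.Glued z')
    (hz : Quot.mk T.Glued z ∉ T.skeleton2) : z' = z := by
  rw [mk_mem_skeleton2] at hz
  refine (iff_of_mk_eq (T := T) (P := fun z' => z' = z) ?_ h).1 rfl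
  rintro a x hx rfl
  exact absurd ⟨_, hx⟩ hz

theorem exists_pos_of_notMem_vertexNbhd {z : ModelPoint Tet}
    (hz : Quot.mk T.Glued z ∉ T.vertexNbhd) : ∃ k l, k ≠ l ∧ 0 < z.2.1 k ∧ 0 < z.2.1 l := by
  have h1 : ∀ i, z.2.1 i ≤ 3 / 4 := fun i => by
    by_contra! h
    exact hz ⟨z.1, z.2, rfl, i, h⟩
  have hsum : ∑ i, z.2.1 i = 1 := z.2.2.2
  obtain ⟨k, hk⟩ : ∃ k, 0 < z.2.1 k := by
    by_contra! h
    have : ∑ i, z.2.1 i ≤ 0 := Finset.sum_nonpos fun i _ => h i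
    linarith
  by_contra! h
  have h2 : ∑ i, z.2.1 i = z.2.1 k := Finset.sum_eq_single k
    (fun l _ hl => le_antisymm (h k l hl.symm hk) (coord_nonneg _ _)) (by simp)
  have := h1 k
  linarith

theorem exists_permute_of_mk_eq {z z' : ModelPoint Tet}
    (h : Quot.mk T.Glued z = Quot.mk T.Glued z') : ∃ g : Equiv.Perm (Fin 4), z'.2 = permute g z.2 := by
  refine (iff_of_mk_eq (T := T) (P := fun z' => ∃ g : Equiv.Perm (Fin 4), z'.2 = permute g z.2)
    ?_ h).1 ⟨1, rfl⟩
  rintro a x - ⟨g, hg⟩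
  refine ⟨T.gluing a.1 a.2 * g, ?_⟩
  simp only at hg
  rw [hg]
  rfl

theorem finite_models [Finite Tet] (p : T.Realisation) : {z | Quot.mk T.Glued z = p}.Finite := by
  refine (Set.finite_range fun y : Tet × Equiv.Perm (Fin 4) =>
    (⟨y.1, permute y.2 p.out.2⟩ : ModelPoint Tet)).subset ?_
  rintro ⟨t, x⟩ hz
  obtain ⟨g, hg⟩ := exists_permute_of_mk_eq (T := T) (z := p.out) (z' := ⟨t, x⟩)
    ((Quot.out_eq p).trans hz.symm)
  exact ⟨(t, g), Sigma.ext rfl (heq_of_eq hg.symm)⟩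

theorem dist_permute_le (g : Equiv.Perm (Fin 4)) (x y : Simplex3) :
    dist (permute g x) (permute g y) ≤ dist x y :=
  (dist_pi_le_iff dist_nonneg).2 fun j => dist_le_pi_dist x.1 y.1 (g.symm j)

theorem exists_pos_le_of_finite {α : Type*} {S : Set α} (hS : S.Finite) {g : α → ℝ}
    (hg : ∀ x ∈ S, 0 < g x) : ∃ ε > 0, ∀ x ∈ S, ε ≤ g x := by
  induction S, hS using Set.Finite.induction_on with
  | empty => exact ⟨1, one_pos, by simp⟩
  | @insert a S _ _ ih =>
    obtain ⟨ε, hε, h⟩ := ih fun x hx => hg x (Set.mem_insert_of_mem _ hx)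
    refine ⟨min ε (g a), lt_min hε (hg a (Set.mem_insert _ _)), ?_⟩
    rintro x (rfl | hx)
    · exact min_le_right _ _
    · exact (min_le_left _ _).trans (h x hx)

/-- The models of the points near `p` are near the models of `p`. -/
theorem eventually_exists_model_near [Finite Tet] (p : T.Realisation) {ε : ℝ} (hε : 0 < ε) :
    ∀ᶠ q in 𝓝 p, ∀ t y, T.proj t y = q → ∃ x, T.proj t x = p ∧ dist y x < ε := by
  obtain ⟨ε₀, hε₀, hmin⟩ := exists_pos_le_of_finite (S := {i | 0 < p.out.2.1 i}) (Set.toFinite _)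
    (g := fun i => p.out.2.1 i) fun i hi => hi
  set η := min ε ε₀
  have hη : 0 < η := lt_min hε hε₀
  let P : ModelPoint Tet → Prop := fun z => ∃ x, T.proj z.1 x = p ∧ dist z.2 x < η
  -- Close to a face, a model of `p` lies on this face, as its positive coordinates are at least `η`.
  have hP : ∀ (a : Tet × Fin 4) y, y.1 a.2 = 0 → P ⟨a.1, y⟩ → P (T.glue a y) := by
    rintro a y hy ⟨x, hx, hd⟩
    have hx0 : x.1 a.2 = 0 := by
      by_contra hne
      obtain ⟨g, hg⟩ := exists_permute_of_mk_eq (T := T) (z := p.out) (z' := ⟨a.1, x⟩)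
        ((Quot.out_eq p).trans hx.symm)
      simp only at hg
      have h1 : x.1 a.2 = p.out.2.1 (g.symm a.2) := by rw [hg]; rfl
      have h2 := hmin (g.symm a.2)
        (by rw [Set.mem_ofPred_eq, ← h1]; exact lt_of_le_of_ne (coord_nonneg _ _) (Ne.symm hne))
      have h3 : dist (y.1 a.2) (x.1 a.2) < η := (dist_le_pi_dist y.1 x.1 a.2).trans_lt hd
      rw [hy, dist_comm, Real.dist_eq, sub_zero, abs_of_nonneg (coord_nonneg _ _)] at h3
      have h4 : η ≤ ε₀ := min_le_right _ _
      linarith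
    exact ⟨(T.glue a x).2, (T.proj_glue hx0).trans hx, (dist_permute_le _ _ _).trans_lt hd⟩
  have hopen : IsOpen {z : ModelPoint Tet | P z} := by
    refine isOpen_modelPoint (P := fun t y => ∃ x, T.proj t x = p ∧ dist y x < η) fun t => ?_
    have : {y | ∃ x, T.proj t x = p ∧ dist y x < η} =
        ⋃ (x : Simplex3) (_ : T.proj t x = p), Metric.ball x η := by
      ext y
      simp
    rw [this]
    exact isOpen_iUnion fun x => isOpen_iUnion fun _ => Metric.isOpen_ball
  have h := (isOpen_of_forall_mk (T := T) (P := P) (fun z z' h => (iff_of_mk_eq hP h).1) hopen).mem_nhds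
    (x := p) ⟨p.out.2, Quot.out_eq p, by rw [dist_self]; exact hη⟩
  filter_upwards [h] with q hq t y hy
  obtain ⟨x, hx, hd⟩ := (iff_of_mk_eq hP (z := q.out) (z' := ⟨t, y⟩)
    ((Quot.out_eq q).trans hy.symm)).1 hq
  exact ⟨x, hx, hd.trans_le (min_le_left _ _)⟩

/-- A lift to a model tetrahedron of a path that converges has a limit. -/
theorem exists_tendsto_lift [Finite Tet] {f : ℝ → T.Realisation} {p : T.Realisation} {l : Filter ℝ}
    [l.NeBot] (hl : ∀ u ∈ l, ∃ w ∈ l, w ⊆ u ∧ IsPreconnected w) (hf : Filter.Tendsto f l (𝓝 p))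
    {t : Tet} {d : ℝ → Simplex3} {u : Set ℝ} (hu : u ∈ l) (hd : ContinuousOn d u)
    (hrun : ∀ s ∈ u, T.proj t (d s) = f s) :
    ∃ x, T.proj t x = p ∧ Filter.Tendsto d l (𝓝 x) := by
  have hfin : {x | T.proj t x = p}.Finite :=
    (finite_models (T := T) p).preimage (f := fun x : Simplex3 => (⟨t, x⟩ : ModelPoint Tet))
      (fun x _ y _ h => by simpa using h)
  have hfin2 : {y : Simplex3 × Simplex3 |
      (T.proj t y.1 = p ∧ T.proj t y.2 = p) ∧ y.1 ≠ y.2}.Finite :=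
    (hfin.prod hfin).subset fun y hy => ⟨hy.1.1, hy.1.2⟩
  obtain ⟨ε, hε, hsep⟩ := exists_pos_le_of_finite hfin2
    (g := fun y => dist y.1 y.2) fun y hy => dist_pos.2 hy.2
  have hunique : ∀ {x x' y : Simplex3}, T.proj t x = p → T.proj t x' = p → dist y x < ε / 2 →
      dist y x' < ε / 2 → x = x' := by
    intro x x' y hx hx' h1 h2
    by_contra hne
    have h3 := hsep (x, x') ⟨⟨hx, hx'⟩, hne⟩
    have h4 := dist_triangle_left x x' y
    simp only at h3
    linarith
  have hnear : ∀ η > 0, ∀ᶠ s in l, ∃ x, T.proj t x = p ∧ dist (d s) x < η := fun η hη => by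
    filter_upwards [hf.eventually (eventually_exists_model_near p hη), hu] with s h1 h2
    exact h1 t (d s) (hrun s h2)
  obtain ⟨w, hw, hwu, hwc⟩ := hl _ (Filter.inter_mem hu (hnear (ε / 2) (half_pos hε)))
  obtain ⟨s₀, hs₀⟩ := Filter.nonempty_of_mem hw
  have hex : ∀ s, ∃ x : {x | T.proj t x = p}, s ∈ w → dist (d s) x < ε / 2 := by
    intro s
    by_cases hs : s ∈ w
    · obtain ⟨x, hx, h⟩ := (hwu hs).2
      exact ⟨⟨x, hx⟩, fun _ => h⟩
    · obtain ⟨x, hx, -⟩ := (hwu hs₀).2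
      exact ⟨⟨x, hx⟩, fun h => absurd h hs⟩
  choose n hn using hex
  have : Finite {x | T.proj t x = p} := hfin
  have hncont : ContinuousOn n w := by
    intro s hs
    have h1 := ((hd.mono fun s hs => (hwu hs).1) s hs).eventually
      (Metric.isOpen_ball.mem_nhds (Metric.mem_ball.2 (hn s hs)))
    refine (continuousWithinAt_const (b := n s)).congr_of_eventuallyEq ?_ rfl
    filter_upwards [h1, self_mem_nhdsWithin] with s' h2 h3
    exact Subtype.ext (hunique (n s').2 (n s).2 (hn s' h3) h2)
  refine ⟨n s₀, (n s₀).2, Metric.tendsto_nhds.2 fun η hη => ?_⟩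
  filter_upwards [hnear (min η (ε / 2)) (lt_min hη (half_pos hε)), hw] with s h1 hs
  obtain ⟨x, hx, h1⟩ := h1
  have h2 : x = n s₀ := by
    rw [← hwc.constant hncont hs hs₀]
    exact hunique hx (n s).2 (h1.trans_le (min_le_right _ _)) (hn s hs)
  rw [← h2]
  exact h1.trans_le (min_le_left _ _)

/-- A path that meets the two-skeleton at its endpoints only lifts to a model tetrahedron. -/
theorem exists_lift [Finite Tet] {f : ℝ → T.Realisation} (hf : Continuous f) {a b : ℝ} (hab : a < b)
    (h : ∀ s ∈ Set.Ioo a b, f s ∉ T.skeleton2) : ∃ (t : Tet) (d : ℝ → Simplex3),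
      ContinuousOn d (Set.Icc a b) ∧ ∀ s ∈ Set.Icc a b, T.proj t (d s) = f s := by
  have hout : ∀ s, T.proj (f s).out.1 (f s).out.2 = f s := fun s => Quot.out_eq _
  have huniq : ∀ s ∈ Set.Ioo a b, ∀ t x, T.proj t x = f s → (⟨t, x⟩ : ModelPoint Tet) = (f s).out := by
    intro s hs t x hx
    refine eq_of_mk_eq_of_notMem (T := T) ((hout s).trans hx.symm) ?_
    exact fun h' => h s hs ((hout s) ▸ h')
  have hnear : ∀ s₀ ∈ Set.Ioo a b, ∀ ε > 0, ∀ᶠ s in 𝓝 s₀,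
      (f s).out.1 = (f s₀).out.1 ∧ dist (f s).out.2 (f s₀).out.2 < ε := by
    intro s₀ hs₀ ε hε
    filter_upwards [hf.continuousAt.eventually (eventually_exists_model_near (f s₀) hε)] with s hs
    obtain ⟨x, hx, hd⟩ := hs _ _ (hout s)
    have := huniq s₀ hs₀ _ _ hx
    rw [← this]
    exact ⟨rfl, hd⟩
  obtain ⟨m, hm⟩ := Set.nonempty_Ioo.2 hab
  have hconst : ∀ s ∈ Set.Ioo a b, (f s).out.1 = (f m).out.1 := by
    intro s hs
    let _ : TopologicalSpace Tet := ⊥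
    have : DiscreteTopology Tet := ⟨rfl⟩
    refine isPreconnected_Ioo.constant (f := fun s => (f s).out.1) (fun s₀ hs₀ => ?_) hs hm
    refine ContinuousAt.continuousWithinAt (ContinuousAt.congr (continuousAt_const
      (y := (f s₀).out.1)) ?_)
    filter_upwards [hnear s₀ hs₀ 1 one_pos] with s h1 using h1.1.symm
  set t := (f m).out.1 with ht
  set d : ℝ → Simplex3 := fun s => (f s).out.2 with hd
  have hdcont : ContinuousOn d (Set.Ioo a b) := fun s₀ hs₀ =>
    ContinuousAt.continuousWithinAt (Metric.tendsto_nhds.2 fun ε hε =>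
      (hnear s₀ hs₀ ε hε).mono fun _ h => h.2)
  have hdrun : ∀ s ∈ Set.Ioo a b, T.proj t (d s) = f s := fun s hs => by
    rw [← hconst s hs]
    exact hout s
  obtain ⟨xa, hxa, hla⟩ := exists_tendsto_lift (l := 𝓝[>] a) (fun u hu => by
    obtain ⟨c, hc, hsub⟩ := mem_nhdsGT_iff_exists_Ioo_subset.1 hu
    exact ⟨Set.Ioo a c, Ioo_mem_nhdsGT hc, hsub, isPreconnected_Ioo⟩)
    (hf.continuousAt.tendsto.mono_left nhdsWithin_le_nhds) (Ioo_mem_nhdsGT hab) hdcont hdrun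
  obtain ⟨xb, hxb, hlb⟩ := exists_tendsto_lift (l := 𝓝[<] b) (fun u hu => by
    obtain ⟨c, hc, hsub⟩ := mem_nhdsLT_iff_exists_Ioo_subset.1 hu
    exact ⟨Set.Ioo c b, Ioo_mem_nhdsLT hc, hsub, isPreconnected_Ioo⟩)
    (hf.continuousAt.tendsto.mono_left nhdsWithin_le_nhds) (Ioo_mem_nhdsLT hab) hdcont hdrun
  refine ⟨t, extendFrom (Set.Ioo a b) d, continuousOn_Icc_extendFrom_Ioo hdcont hla hlb,
    fun s hs => ?_⟩
  rcases hs.1.eq_or_lt with rfl | h1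
  · rw [eq_lim_at_left_extendFrom_Ioo hab hla, hxa]
  rcases hs.2.eq_or_lt with rfl | h2
  · rw [eq_lim_at_right_extendFrom_Ioo hab hlb, hxb]
  have h3 : extendFrom (Set.Ioo a b) d s = d s :=
    extendFrom_eq (subset_closure ⟨h1, h2⟩) (hdcont s ⟨h1, h2⟩)
  rw [h3]
  exact hdrun s ⟨h1, h2⟩

/-- Such a lift is unique. -/
theorem lift_unique {f : ℝ → T.Realisation} {a b : ℝ} (hab : a < b)
    (h : ∀ s ∈ Set.Ioo a b, f s ∉ T.skeleton2) {t t' : Tet} {d d' : ℝ → Simplex3}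
    (hd : ContinuousOn d (Set.Icc a b)) (hrun : ∀ s ∈ Set.Icc a b, T.proj t (d s) = f s)
    (hd' : ContinuousOn d' (Set.Icc a b)) (hrun' : ∀ s ∈ Set.Icc a b, T.proj t' (d' s) = f s)
    {s : ℝ} (hs : s ∈ Set.Icc a b) : (⟨t, d s⟩ : ModelPoint Tet) = ⟨t', d' s⟩ := by
  have hint : ∀ s ∈ Set.Ioo a b, (⟨t, d s⟩ : ModelPoint Tet) = ⟨t', d' s⟩ := by
    intro s hs
    have hs' := Set.Ioo_subset_Icc_self hs
    refine eq_of_mk_eq_of_notMem (T := T) ((hrun' s hs').trans (hrun s hs').symm) fun h' => h s hs ?_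
    rw [← hrun' s hs']
    exact h'
  obtain ⟨m, hm⟩ := Set.nonempty_Ioo.2 hab
  obtain rfl : t = t' := congrArg Sigma.fst (hint m hm)
  have heq : Set.EqOn d d' (Set.Ioo a b) := fun s hs => by simpa using hint s hs
  rw [heq.of_subset_closure hd hd' Set.Ioo_subset_Icc_self (by rw [closure_Ioo hab.ne]) hs]

/-- A point of a face which is not a vertex is not glued to itself, unless a rotation about an edge
through it has a fixed flag. -/
theorem glue_ne (hrot : ∀ s : Flag Tet, s.2.1 ≠ s.2.2 → T.rot s ≠ s) {a : Tet × Fin 4} {x : Simplex3}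
    (hx : ∃ k l, k ≠ l ∧ 0 < x.1 k ∧ 0 < x.1 l) (h0 : x.1 a.2 = 0) : T.glue a x ≠ ⟨a.1, x⟩ := by
  obtain ⟨t, j⟩ := a
  intro h
  simp only at h0
  have h1 : T.adj t j = t := congrArg Sigma.fst h
  have h2 : permute (T.gluing t j) x = x := by
    have := (Sigma.ext_iff.1 h).2
    exact eq_of_heq this
  have hcoord : ∀ i, x.1 (T.gluing t j i) = x.1 i := fun i => by
    conv_lhs => rw [← h2]
    exact permute_apply _ _ _
  have hne : T.gluing t j j ≠ j := fun h' => T.ne_self t j (Prod.ext h1 h')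
  have hi0 : x.1 (T.gluing t j j) = 0 := (hcoord j).trans h0
  have hii0 : x.1 (T.gluing t j (T.gluing t j j)) = 0 := (hcoord _).trans hi0
  have hinj : T.gluing t j (T.gluing t j j) ≠ T.gluing t j j := fun h' =>
    hne ((T.gluing t j).injective h')
  obtain ⟨k, l, hkl, hk, hl⟩ := hx
  have hfin : ∀ i j m k l : Fin 4, i ≠ j → m ≠ i → k ≠ l → k ≠ i → k ≠ j → l ≠ i → l ≠ j →
      m ≠ k → m ≠ l → m = j := by decide
  have hback : T.gluing t j (T.gluing t j j) = j := by
    refine hfin _ j _ k l hne hinj hkl ?_ ?_ ?_ ?_ ?_ ?_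
    · rintro rfl; exact hk.ne' hi0
    · rintro rfl; exact hk.ne' h0
    · rintro rfl; exact hl.ne' hi0
    · rintro rfl; exact hl.ne' h0
    · rintro rfl; exact hk.ne' hii0
    · rintro rfl; exact hl.ne' hii0
  exact hrot (t, T.gluing t j j, j) hne (by
    rw [rot_apply]
    exact Prod.ext h1 (Prod.ext rfl hback))

end Triangulation

namespace TautMatching

variable {Tet : Type*} {angle : Tet → Edge → ℝ}

theorem rot_ne_self (μ : TautMatching angle) [Fintype Tet] {T : Triangulation Tet} (h : T.IsTautAngleStructure angle)
    {s : Flag Tet} (hs : s.2.1 ≠ s.2.2) : T.rot s ≠ s := by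
  classical
  intro hfix
  have hcard := μ.card_isPi h hs
  have hsub : (Finset.univ.filter fun s' => T.rot.SameCycle s s' ∧ μ.IsPi s') ⊆ {s} := by
    intro s' hs'
    obtain ⟨-, ⟨z, rfl⟩, -⟩ := Finset.mem_filter.1 hs'
    rw [Finset.mem_singleton]
    exact Function.IsFixedPt.perm_zpow hfix z
  have := Finset.card_le_card hsub
  rw [hcard] at this
  simp at this

/-- Two points of the boundary of a tetrahedron that are separated by the equator do not lie on faces on
the same side of the equator. -/
theorem side_ne_of_separated (μ : TautMatching angle) {t : Tet} {x y : Simplex3} (h : SeparatedByEquator (angle t) x y)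
    (h0 : ∀ e, angle t e = 0 ∨ angle t e = Real.pi) {i j : Fin 4} (hi : x.1 i = 0) (hj : y.1 j = 0) :
    μ.side t i ≠ μ.side t j := by
  intro hside
  obtain ⟨hx, hy, hjoin⟩ := h
  rw [μ.side_eq_iff] at hside
  have hmate := μ.mate_mate t i
  have hmne := μ.mate_ne t i
  -- The two other vertices are the endpoints of the edge with angle `π` on this side.
  obtain ⟨k, l, hkl, hki, hkm, hli, hlm⟩ : ∃ k l : Fin 4, k ≠ l ∧ k ≠ i ∧ k ≠ μ.mate t i ∧
      l ≠ i ∧ l ≠ μ.mate t i := by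
    have : ∀ i m : Fin 4, m ≠ i →
        ∃ k l : Fin 4, k ≠ l ∧ k ≠ i ∧ k ≠ m ∧ l ≠ i ∧ l ≠ m := by decide
    exact this i _ hmne
  have hall : ∀ n, n = i ∨ n = μ.mate t i ∨ n = k ∨ n = l := by
    have : ∀ i m k l n : Fin 4, m ≠ i → k ≠ l → k ≠ i → k ≠ m → l ≠ i → l ≠ m →
        n = i ∨ n = m ∨ n = k ∨ n = l := by decide
    exact fun n => this i (μ.mate t i) k l n hmne hkl hki hkm hli hlm
  have hpi : ∀ e : Edge, k ∈ e.1 → l ∈ e.1 → angle t e = Real.pi := by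
    intro e hk hl
    refine (μ.angle_eq_pi_iff t i (μ.mate t i) hmne.symm e ?_).2 rfl
    have hsub : ({k, l} : Finset (Fin 4)) ⊆ e.1 := by
      intro n hn
      rcases Finset.mem_insert.1 hn with rfl | hn
      · exact hk
      · rwa [Finset.mem_singleton.1 hn]
    rw [← Finset.eq_of_subset_of_card_le hsub (by rw [e.2, Finset.card_pair hkl])]
    ext n
    simp only [Finset.mem_insert, Finset.mem_singleton, Finset.mem_compl, not_or]
    constructor
    · rintro (rfl | rfl)
      · exact ⟨hki, hkm⟩
      · exact ⟨hli, hlm⟩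
    · rintro ⟨h1, h2⟩
      rcases hall n with h3 | h3 | h3
      · exact absurd h3 h1
      · exact absurd h3 h2
      · exact h3
  have hmem : ∀ z : Simplex3, (∃ n, z.1 n = 0) → 0 < z.1 k → 0 < z.1 l →
      z ∈ simplexBoundary \ equator (angle t) := by
    rintro z hz hk hl
    refine ⟨hz, ?_⟩
    rintro ⟨e, he, hze⟩
    have h1 : k ∈ e.1 := by
      by_contra h
      exact hk.ne' (hze k h)
    have h2 : l ∈ e.1 := by
      by_contra h
      exact hl.ne' (hze l h)
    rw [hpi e h1 h2] at he
    exact Real.pi_ne_zero he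
  have hpos : ∀ z : Simplex3, z ∈ simplexBoundary \ equator (angle t) →
      ∀ n, (n = i ∨ n = μ.mate t i) → z.1 n = 0 → 0 < z.1 k ∧ 0 < z.1 l := by
    intro z hz n hn hzn
    have hnk : n ≠ k ∧ n ≠ l ∧ μ.mate t n ≠ k ∧ μ.mate t n ≠ l := by
      rcases hn with rfl | rfl
      · exact ⟨hki.symm, hli.symm, hkm.symm, hlm.symm⟩
      · rw [hmate]
        exact ⟨hkm.symm, hlm.symm, hki.symm, hli.symm⟩
    have hfin : ∀ n m a b : Fin 4, m ≠ n → n ≠ a → n ≠ b → m ≠ a → m ≠ b → a ≠ b →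
        ({b, m} : Finset (Fin 4)) = {n, a}ᶜ := by decide
    -- Otherwise the point would lie on an edge that ends at `mate n`, with angle zero.
    have hedge : ∀ a b, a ≠ b → n ≠ a → n ≠ b → μ.mate t n ≠ a → μ.mate t n ≠ b → 0 < z.1 a := by
      intro a b hab hna hnb hma hmb
      by_contra! hle
      have hza : z.1 a = 0 := le_antisymm hle (coord_nonneg _ _)
      have heq := hfin n (μ.mate t n) a b (μ.mate_ne t n) hna hnb hma hmb hab
      refine hz.2 ⟨⟨{b, μ.mate t n}, Finset.card_pair hmb.symm⟩, (h0 _).resolve_right fun h' => ?_,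
        ?_⟩
      · exact hma ((μ.angle_eq_pi_iff t n a hna _ heq).1 h').symm
      · intro c hc
        change c ∉ ({b, μ.mate t n} : Finset (Fin 4)) at hc
        rw [heq, Finset.mem_compl, not_not, Finset.mem_insert, Finset.mem_singleton] at hc
        rcases hc with rfl | rfl
        · exact hzn
        · exact hza
    exact ⟨hedge k l hkl hnk.1 hnk.2.1 hnk.2.2.1 hnk.2.2.2,
      hedge l k hkl.symm hnk.2.1 hnk.1 hnk.2.2.2 hnk.2.2.1⟩
  -- Both points are joined by a segment in their face to the midpoint of the edge with angle `π`.
  let c : Simplex3 := ⟨fun n => if n = k ∨ n = l then 1 / 2 else 0, fun n => by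
    beta_reduce; split_ifs <;> norm_num, by
    have : (Finset.univ.filter fun n : Fin 4 => n = k ∨ n = l).card = 2 := by
      rw [show (Finset.univ.filter fun n : Fin 4 => n = k ∨ n = l) = {k, l} by
        ext n; simp, Finset.card_pair hkl]
    rw [← Finset.sum_filter, Finset.sum_const, this]
    norm_num⟩
  have hck : c.1 k = 1 / 2 := if_pos (Or.inl rfl)
  have hcl : c.1 l = 1 / 2 := if_pos (Or.inr rfl)
  have hc0 : ∀ n, (n = i ∨ n = μ.mate t i) → c.1 n = 0 := by
    intro n hn
    refine if_neg ?_
    rintro (rfl | rfl) <;> rcases hn with h3 | h3 <;> simp_all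
  have hjoinc : ∀ z : Simplex3, z ∈ simplexBoundary \ equator (angle t) →
      ∀ n, (n = i ∨ n = μ.mate t i) → z.1 n = 0 →
      JoinedIn (simplexBoundary \ equator (angle t)) z c := by
    intro z hz n hn hzn
    obtain ⟨hzk, hzl⟩ := hpos z hz n hn hzn
    have hconv : ∀ r : unitInterval, (1 - r.1) • z.1 + r.1 • c.1 ∈ stdSimplex ℝ (Fin 4) := fun r =>
      convex_stdSimplex ℝ (Fin 4) z.2 c.2 (sub_nonneg.2 r.2.2) r.2.1 (by ring)
    let p : Path z c :=
      { toFun := fun r => ⟨(1 - r.1) • z.1 + r.1 • c.1, hconv r⟩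
        continuous_toFun := by
          refine Continuous.subtype_mk ?_ _
          fun_prop
        source' := by
          apply Subtype.ext
          simp
        target' := by
          apply Subtype.ext
          simp }
    refine ⟨p, fun r => hmem _ ⟨n, ?_⟩ ?_ ?_⟩
    · change (1 - r.1) * z.1 n + r.1 * c.1 n = 0
      rw [hzn, hc0 n hn]
      ring
    · change 0 < (1 - r.1) * z.1 k + r.1 * c.1 k
      rw [hck]
      rcases r.2.1.eq_or_lt with h3 | h3
      · rw [← h3]; linarith
      · have := mul_nonneg (sub_nonneg.2 r.2.2) hzk.le
        linarith
    · change 0 < (1 - r.1) * z.1 l + r.1 * c.1 l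
      rw [hcl]
      rcases r.2.1.eq_or_lt with h3 | h3
      · rw [← h3]; linarith
      · have := mul_nonneg (sub_nonneg.2 r.2.2) hzl.le
        linarith
  exact hjoin ((hjoinc x hx i (Or.inl rfl) hi).trans (hjoinc y hy j hside hj).symm)

end TautMatching

end TautTri

end

/-! ### Transverse loops meet the branched surface in isolated points -/

noncomputable section

namespace TautTri

theorem param_add_one {M : Type*} [TopologicalSpace M] (δ : C(Circle, M)) (s : ℝ) :
    param δ (s + 1) = param δ s := by
  simp only [param]
  rw [mul_add, mul_one, Circle.exp_add, Circle.exp_two_pi, mul_one]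

theorem continuous_param {M : Type*} [TopologicalSpace M] (δ : C(Circle, M)) :
    Continuous (param δ) := by
  unfold param
  fun_prop

/-- A function whose graph is tangent to the plane `{x₂ = 0}` along the axis has derivative zero
there. -/
theorem fderiv_eq_zero_of_tangent {g : ℝ × ℝ → ℝ} (hg : ContDiff ℝ ∞ g)
    (h0 : ∀ u, g (u, 0) = 0 ∧ deriv (fun v => g (u, v)) 0 = 0) (u : ℝ) : fderiv ℝ g (u, 0) = 0 := by
  have hd : HasFDerivAt g (fderiv ℝ g (u, 0)) (u, 0) :=
    (hg.differentiable (by simp) (u, 0)).hasFDerivAt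
  have h1 : fderiv ℝ g (u, 0) (1, 0) = 0 := by
    have h2 : HasDerivAt (fun u' : ℝ => g (u', 0)) (fderiv ℝ g (u, 0) (1, 0)) u :=
      hd.comp_hasDerivAt u ((hasDerivAt_id u).prodMk (hasDerivAt_const u (0 : ℝ)))
    have h3 : (fun u' : ℝ => g (u', 0)) = fun _ => 0 := funext fun u' => (h0 u').1
    rw [h3] at h2
    exact h2.unique (hasDerivAt_const u 0)
  have h2 : fderiv ℝ g (u, 0) (0, 1) = 0 := by
    have h2 : HasDerivAt (fun v : ℝ => g (u, v)) (fderiv ℝ g (u, 0) (0, 1)) 0 :=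
      hd.comp_hasDerivAt 0 ((hasDerivAt_const (0 : ℝ) u).prodMk (hasDerivAt_id 0))
    rw [← h2.deriv]
    exact (h0 u).2
  ext
  · simpa using h1
  · simpa using h2

variable {Tet : Type*} {T : Triangulation Tet} {M : Type*} [TopologicalSpace M]
  {h : M ≃ₜ ↥(T.vertexNbhdᶜ)} [ChartedSpace (EuclideanHalfSpace 3) M]

theorem differentiableAt_coord {δ : C(Circle, M)} (hδ : ContMDiff (𝓡 1) (𝓡∂ 3) ∞ δ)
    {φ : OpenPartialHomeomorph M (EuclideanHalfSpace 3)}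
    (hφ : φ ∈ IsManifold.maximalAtlas (𝓡∂ 3) ∞ M) {b : ℝ} (hb : param δ b ∈ φ.source) (i : Fin 3) :
    DifferentiableAt ℝ (fun s => (φ (param δ s)).1 i) b := by
  have h1 : ContMDiff 𝓘(ℝ, ℝ) (𝓡∂ 3) ∞ (param δ) := by
    refine hδ.comp (contMDiff_circleExp.comp ?_)
    exact (contDiff_const.mul contDiff_id).contMDiff
  have h2 : ContMDiffAt 𝓘(ℝ, ℝ) (𝓡∂ 3) ∞ (fun s => φ (param δ s)) b :=
    (contMDiffAt_of_mem_maximalAtlas hφ hb).comp b h1.contMDiffAt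
  have h3 : ContMDiffAt 𝓘(ℝ, ℝ) 𝓘(ℝ, EuclideanSpace ℝ (Fin 3)) ∞
      (fun s => (𝓡∂ 3) (φ (param δ s))) b :=
    ((𝓡∂ 3).contMDiff (n := ∞)).contMDiffAt.comp b h2
  have h4 := h3.contDiffAt.differentiableAt (by simp)
  exact (EuclideanSpace.proj (𝕜 := ℝ) i).differentiableAt.comp b h4

/-- A loop that is transverse to the branched surface meets it in isolated points. -/
theorem eventually_notMem_surf [Finite Tet] {angle : Tet → Edge → ℝ} {δ : C(Circle, M)}
    (hδ : ContMDiff (𝓡 1) (𝓡∂ 3) ∞ δ) (htr : IsTransverse T h angle δ) {b : ℝ}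
    (hb : param δ b ∈ surf T h) : ∀ᶠ s in 𝓝[≠] b, param δ s ∉ surf T h := by
  obtain ⟨φ, hφ, hder⟩ := htr b hb
  have hd : ∀ i, HasDerivAt (fun s => (φ (param δ s)).1 i)
      (deriv (fun s => (φ (param δ s)).1 i) b) b := fun i =>
    (differentiableAt_coord hδ hφ.mem_atlas hφ.mem_source i).hasDerivAt
  have hsrc : ∀ᶠ s in 𝓝[≠] b, param δ s ∈ φ.source :=
    ((continuous_param δ).continuousAt.eventually
      (φ.open_source.mem_nhds hφ.mem_source)).filter_mono nhdsWithin_le_nhds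
  by_cases hloc : param δ b ∈ locus T h
  · obtain ⟨h1, h2⟩ := (hφ.axis hloc _ hφ.mem_source).1 hloc
    obtain ⟨side, hside, -⟩ := hφ.sheets hloc
    -- For every model `z` of the point and every face `i` through it, the loop leaves the sheet.
    have hsheet : ∀ z : ModelPoint Tet, Quot.mk T.Glued z = h (param δ b) → ∀ i, ∃ ε > 0,
        (z.2.1 i = 0 → ∀ᶠ s in 𝓝[≠] b, ∀ y, dist y z.2 < ε → y.1 i = 0 →
          T.proj z.1 y ≠ h (param δ s)) := by
      intro z hz i
      by_cases hi : z.2.1 i = 0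
      swap
      · exact ⟨1, one_pos, fun h => absurd h hi⟩
      obtain ⟨-, g, hg, hg0, hev⟩ := hside z.1 z.2 i hz hi
      obtain ⟨ε, hε, hball⟩ := Metric.eventually_nhds_iff.1 hev
      refine ⟨ε, hε, fun _ => ?_⟩
      have hpt : ((φ (param δ b)).1 0, (φ (param δ b)).1 1) = ((φ (param δ b)).1 0, (0 : ℝ)) := by
        rw [h1]
      have hgd : HasFDerivAt g (0 : ℝ × ℝ →L[ℝ] ℝ)
          ((φ (param δ b)).1 0, (φ (param δ b)).1 1) := by
        rw [hpt, ← fderiv_eq_zero_of_tangent hg hg0]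
        exact (hg.differentiable (by simp) _).hasFDerivAt
      have hF := (hd 2).sub (hgd.comp_hasDerivAt b ((hd 0).prodMk (hd 1)))
      rw [zero_apply, sub_zero] at hF
      filter_upwards [hF.eventually_ne (c := 0) hder, hsrc] with s h3 h4 y h5 h6 h7
      refine h3 (sub_eq_zero.2 ?_)
      exact (hball h5 h6 _ h4 h7).2
    choose! ε hε hsheet using hsheet
    have hfin := Triangulation.finite_models (T := T) (h (param δ b) : T.Realisation)
    have hfin2 : {y : ModelPoint Tet × Fin 4 | Quot.mk T.Glued y.1 = h (param δ b)}.Finite :=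
      (hfin.prod (Set.finite_univ (α := Fin 4))).subset fun y hy => ⟨hy, trivial⟩
    obtain ⟨η, hη, hηle⟩ := Triangulation.exists_pos_le_of_finite hfin2
      (g := fun y => min (ε y.1 y.2) (if y.1.2.1 y.2 = 0 then 1 else y.1.2.1 y.2))
      fun y hy => lt_min (hε _ hy _) (by
        split_ifs with h3
        · exact one_pos
        · exact lt_of_le_of_ne (coord_nonneg _ _) (Ne.symm h3))
    have hnear : ∀ᶠ s in 𝓝[≠] b, ∀ t y, T.proj t y = h (param δ s) →
        ∃ x, T.proj t x = h (param δ b) ∧ dist y x < η := by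
      have hc : Continuous fun s => (h (param δ s) : T.Realisation) :=
        continuous_subtype_val.comp (h.continuous.comp (continuous_param δ))
      exact (hc.continuousAt.eventually (Triangulation.eventually_exists_model_near _ hη)).filter_mono
        nhdsWithin_le_nhds
    have hall : ∀ᶠ s in 𝓝[≠] b, ∀ y ∈ {y : ModelPoint Tet × Fin 4 |
        Quot.mk T.Glued y.1 = h (param δ b)}, y.1.2.1 y.2 = 0 →
        ∀ x, dist x y.1.2 < ε y.1 y.2 → x.1 y.2 = 0 → T.proj y.1.1 x ≠ h (param δ s) := by
      refine (Filter.eventually_all_finite hfin2).2 fun y hy => ?_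
      by_cases h3 : y.1.2.1 y.2 = 0
      · exact (hsheet _ hy _ h3).mono fun _ h _ => h
      · exact Filter.Eventually.of_forall fun _ h => absurd h h3
    filter_upwards [hnear, hall] with s h3 h4 h5
    obtain ⟨t, y, h6, i, h7⟩ := h5
    obtain ⟨x, hx, hdist⟩ := h3 t y h6.symm
    have h8 := hηle (⟨t, x⟩, i) hx
    have hx0 : x.1 i = 0 := by
      by_contra hne
      have h9 := h8.trans (min_le_right _ _)
      simp only at h9
      rw [if_neg hne] at h9
      have h10 := (dist_le_pi_dist y.1 x.1 i).trans_lt hdist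
      rw [h7, dist_comm, Real.dist_eq, sub_zero, abs_of_nonneg (coord_nonneg _ _)] at h10
      linarith
    exact h4 (⟨t, x⟩, i) hx hx0 y (hdist.trans_le (h8.trans (min_le_left _ _))) h7 h6.symm
  · have h0 := (hφ.face hloc _ hφ.mem_source).1 hb
    filter_upwards [(hd 2).eventually_ne (c := 0) hder, hsrc] with s h1 h2 h3
    exact h1 ((hφ.face hloc _ h2).1 h3)

end TautTri

end

/-! ### The arcs of a vertical loop -/

noncomputable section

namespace TautTri

/-- The elements of a discrete closed set of real numbers with period one, in increasing order. -/
theorem exists_enumeration {S : Set ℝ} (hcl : IsClosed S) (hne : S.Nonempty)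
    (hper : ∀ s ∈ S, s + 1 ∈ S) (hper' : ∀ s, s + 1 ∈ S → s ∈ S)
    (hdisc : ∀ b, ∀ᶠ s in 𝓝[≠] b, s ∉ S) :
    ∃ (σ : ℕ → ℝ) (n : ℕ), n ≠ 0 ∧ (∀ k, σ k ∈ S) ∧ (∀ k, σ k < σ (k + 1)) ∧
      (∀ k, ∀ s ∈ Set.Ioo (σ k) (σ (k + 1)), s ∉ S) ∧ ∀ k, σ (k + n) = σ k + 1 := by
  have hnext : ∀ b : S, ∃ b' : S, b.1 < b'.1 ∧ ∀ s ∈ Set.Ioo b.1 b'.1, s ∉ S := by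
    rintro ⟨b, hb⟩
    obtain ⟨c, hc, hsub⟩ := mem_nhdsGT_iff_exists_Ioo_subset.1
      ((hdisc b).filter_mono (nhdsWithin_mono b fun s (hs : b < s) => hs.ne'))
    have hcb : c ≤ b + 1 := by
      by_contra! hlt
      exact hsub ⟨lt_add_one b, hlt⟩ (hper b hb)
    obtain ⟨b', hb', hle⟩ := (isCompact_Icc.inter_left hcl).exists_isLeast
      ⟨b + 1, hper b hb, hcb, le_rfl⟩
    refine ⟨⟨b', hb'.1⟩, lt_of_lt_of_le hc hb'.2.1, fun s hs hsS => ?_⟩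
    have h1 : c ≤ s := by
      by_contra! hlt
      exact hsub ⟨hs.1, hlt⟩ hsS
    exact absurd (hle ⟨hsS, h1, hs.2.le.trans hb'.2.2⟩) hs.2.not_ge
  choose next hlt hfree using hnext
  let τ : ℕ → S := fun k => next^[k] ⟨hne.some, hne.some_mem⟩
  have hτ : ∀ k, τ (k + 1) = next (τ k) := fun k => Function.iterate_succ_apply' _ _ _
  have hlt' : ∀ k, (τ k).1 < (τ (k + 1)).1 := fun k => by rw [hτ]; exact hlt _
  have hfree' : ∀ k, ∀ s ∈ Set.Ioo (τ k).1 (τ (k + 1)).1, s ∉ S := fun k => by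
    rw [hτ]; exact hfree _
  have hmono : StrictMono fun k => (τ k).1 := strictMono_nat_of_lt_succ hlt'
  obtain ⟨n, hn⟩ : ∃ n, (τ n).1 = (τ 0).1 + 1 := by
    by_contra! hne'
    have hbdd : ∀ k, (τ k).1 < (τ 0).1 + 1 := by
      intro k
      induction k with
      | zero => exact lt_add_one _
      | succ k ih =>
        refine lt_of_le_of_ne ?_ (hne' _)
        by_contra! h
        exact hfree' k _ ⟨ih, h⟩ (hper _ (τ 0).2)
    have hba : BddAbove (Set.range fun k => (τ k).1) := ⟨_, by
      rintro _ ⟨k, rfl⟩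
      exact (hbdd k).le⟩
    have htend := tendsto_atTop_ciSup hmono.monotone hba
    have htend' : Filter.Tendsto (fun k => (τ k).1) Filter.atTop (𝓝[≠] (⨆ k, (τ k).1)) :=
      tendsto_nhdsWithin_iff.2 ⟨htend, Filter.Eventually.of_forall fun k =>
        ((hmono (Nat.lt_succ_self k)).trans_le (le_ciSup hba (k + 1))).ne⟩
    obtain ⟨k, hk⟩ := (htend'.eventually (hdisc _)).exists
    exact hk (τ k).2
  refine ⟨fun k => τ k, n, ?_, fun k => (τ k).2, hlt', hfree', fun k => ?_⟩
  · rintro rfl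
    linarith
  · induction k with
    | zero => rw [Nat.zero_add]; exact hn
    | succ k ih =>
      have e : τ (k + 1 + n) = τ (k + n + 1) := by rw [Nat.add_right_comm]
      simp only at ih ⊢
      rw [e]
      refine le_antisymm ?_ ?_ <;> by_contra! h
      · exact hfree' (k + n) _ ⟨by rw [ih]; linarith [hlt' k], h⟩ (hper _ (τ (k + 1)).2)
      · have h1 := hlt' (k + n)
        rw [ih] at h1
        refine hfree' k ((τ (k + n + 1)).1 - 1) ⟨by linarith, by linarith⟩ (hper' _ ?_)
        rw [sub_add_cancel]
        exact (τ (k + n + 1)).2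

section Arcs

variable {Tet : Type*} {T : Triangulation Tet} {M : Type*} [TopologicalSpace M]
  {h : M ≃ₜ ↥(T.vertexNbhdᶜ)} {δ : C(Circle, M)} {angle : Tet → Edge → ℝ}

/-- `δ` does not meet the two-skeleton at the times between `a` and `b`. -/
def AvoidsBetween (T : Triangulation Tet) (h : M ≃ₜ ↥(T.vertexNbhdᶜ)) (δ : C(Circle, M))
    (a b : ℝ) : Prop :=
  ∀ s ∈ Set.Ioo a b, (h (param δ s) : T.Realisation) ∉ T.skeleton2

theorem RunsAlong.mono {t : Tet} {a b a' b' : ℝ} {d : ℝ → Simplex3} (hd : RunsAlong T h δ t a b d)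
    (ha : a ≤ a') (hb : b' ≤ b) : RunsAlong T h δ t a' b' d :=
  ⟨hd.1.mono (Set.Icc_subset_Icc ha hb), fun s hs => hd.2 s (Set.Icc_subset_Icc ha hb hs)⟩

theorem RunsAlong.eq {t t' : Tet} {a b : ℝ} {d d' : ℝ → Simplex3} (hd : RunsAlong T h δ t a b d)
    (hd' : RunsAlong T h δ t' a b d') (hab : a < b) (hfree : AvoidsBetween T h δ a b) {s : ℝ}
    (hs : s ∈ Set.Icc a b) : (⟨t, d s⟩ : ModelPoint Tet) = ⟨t', d' s⟩ :=
  Triangulation.lift_unique hab hfree hd.1 hd.2 hd'.1 hd'.2 hs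

/-- The two lifts of `δ` ending at time `b` agree there. -/
theorem RunsAlong.eq_right {t t' : Tet} {a a' b b' : ℝ} {d d' : ℝ → Simplex3}
    (hd : RunsAlong T h δ t a b d) (hd' : RunsAlong T h δ t' a' b' d') (hab : a < b) (ha : a' < b)
    (hb : b ≤ b') (hfree : AvoidsBetween T h δ a b) : (⟨t, d b⟩ : ModelPoint Tet) = ⟨t', d' b⟩ :=
  (hd.mono (le_max_left a a') le_rfl).eq (hd'.mono (le_max_right a a') hb) (max_lt hab ha)
    (fun s hs => hfree s ⟨(le_max_left _ _).trans_lt hs.1, hs.2⟩) ⟨(max_lt hab ha).le, le_rfl⟩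

/-- The two lifts of `δ` beginning at time `b` agree there. -/
theorem RunsAlong.eq_left {t t' : Tet} {a' b b' c : ℝ} {d d' : ℝ → Simplex3}
    (hd : RunsAlong T h δ t b c d) (hd' : RunsAlong T h δ t' a' b' d') (hbc : b < c) (ha : a' ≤ b)
    (hb : b < b') (hfree : AvoidsBetween T h δ b c) : (⟨t, d b⟩ : ModelPoint Tet) = ⟨t', d' b⟩ :=
  (hd.mono le_rfl (min_le_left c b')).eq (hd'.mono ha (min_le_right c b')) (lt_min hbc hb)
    (fun s hs => hfree s ⟨hs.1, hs.2.trans_le (min_le_left _ _)⟩) ⟨le_rfl, (lt_min hbc hb).le⟩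

variable (links : ∀ t a b d, IsArc T h δ t a b d → SeparatedByEquator (angle t) (d a) (d b))
include links

/-- A model of a point of `δ` in the two-skeleton lies on the arc that ends there or on the arc that
begins there: otherwise it would be an arc by itself, and a point does not link the equator. -/
theorem eq_or_eq_of_links {t t' : Tet} {a b c : ℝ} {d d' : ℝ → Simplex3}
    (hab : a < b) (hbc : b < c) (hd : RunsAlong T h δ t a b d) (hd' : RunsAlong T h δ t' b c d')
    (hfree : AvoidsBetween T h δ a b) (hfree' : AvoidsBetween T h δ b c) {z : ModelPoint Tet}
    (hz : T.proj z.1 z.2 = h (param δ b)) : z = ⟨t, d b⟩ ∨ z = ⟨t', d' b⟩ := by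
  by_contra! hne
  have harc : IsArc T h δ z.1 b b fun _ => z.2 :=
    { le := le_rfl
      runs := ⟨continuousOn_const, fun s hs => by
        rw [le_antisymm hs.2 hs.1]
        exact hz⟩
      maximal := fun a' b' d'' ha hb hrun heq => by
        have hb0 : d'' b = z.2 := heq ⟨le_rfl, le_rfl⟩
        constructor
        · by_contra hne'
          have h1 := hd.eq_right hrun hab (lt_of_le_of_ne ha hne') hb hfree
          rw [hb0] at h1
          exact hne.1 h1.symm
        · by_contra hne'
          have h1 := hd'.eq_left hrun hbc ha (lt_of_le_of_ne hb (Ne.symm hne')) hfree'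
          rw [hb0] at h1
          exact hne.2 h1.symm }
  have hsep := links _ _ _ _ harc
  exact hsep.2.2 (JoinedIn.refl hsep.1)

/-- At the two-skeleton, `δ` crosses from a tetrahedron to the next one through a face. -/
theorem glue_eq_of_links (hrot : ∀ s : Flag Tet, s.2.1 ≠ s.2.2 → T.rot s ≠ s)
    {t t' : Tet} {a b c : ℝ} {d d' : ℝ → Simplex3}
    (hab : a < b) (hbc : b < c) (hd : RunsAlong T h δ t a b d) (hd' : RunsAlong T h δ t' b c d')
    (hfree : AvoidsBetween T h δ a b) (hfree' : AvoidsBetween T h δ b c) {j : Fin 4}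
    (hj : (d b).1 j = 0) :
    T.glue (t, j) (d b) = ⟨t', d' b⟩ ∧ (⟨t, d b⟩ : ModelPoint Tet) ≠ ⟨t', d' b⟩ := by
  have hb := hd.2 b ⟨hab.le, le_rfl⟩
  have hne : T.glue (t, j) (d b) ≠ ⟨t, d b⟩ := by
    refine Triangulation.glue_ne hrot (a := (t, j)) ?_ hj
    refine Triangulation.exists_pos_of_notMem_vertexNbhd (T := T) (z := ⟨t, d b⟩) ?_
    exact (congrArg (· ∈ T.vertexNbhd) hb).mp.mt (h (param δ b)).2
  have heq := (eq_or_eq_of_links links hab hbc hd hd' hfree hfree' (z := T.glue (t, j) (d b))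
    ((T.proj_glue (a := (t, j)) hj).trans hb)).resolve_left hne
  exact ⟨heq, fun h' => hne (heq.trans h'.symm)⟩

/-- The lift between successive times at which `δ` meets the two-skeleton is an arc. -/
theorem isArc_of_links (hrot : ∀ s : Flag Tet, s.2.1 ≠ s.2.2 → T.rot s ≠ s)
    {t t' t'' : Tet} {a b c e : ℝ} {d d' d'' : ℝ → Simplex3} (hab : a < b) (hbc : b < c) (hce : c < e)
    (hd : RunsAlong T h δ t a b d) (hd' : RunsAlong T h δ t' b c d')
    (hd'' : RunsAlong T h δ t'' c e d'') (hfree : AvoidsBetween T h δ a b)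
    (hfree' : AvoidsBetween T h δ b c) (hfree'' : AvoidsBetween T h δ c e)
    (hb : param δ b ∈ surf T h) (hc : param δ c ∈ surf T h) : IsArc T h δ t' b c d' := by
  have hzero : ∀ {t : Tet} {s : ℝ} {x : Simplex3}, param δ s ∈ surf T h →
      T.proj t x = h (param δ s) → ∃ j, x.1 j = 0 := by
    intro t s x hs hx
    refine (Triangulation.mk_mem_skeleton2 (T := T) (z := ⟨t, x⟩)).1 ?_
    exact (congrArg (· ∈ T.skeleton2) hx).mpr hs
  obtain ⟨j, hj⟩ := hzero hb (hd.2 b ⟨hab.le, le_rfl⟩)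
  obtain ⟨j', hj'⟩ := hzero hc (hd'.2 c ⟨hbc.le, le_rfl⟩)
  have h1 := (glue_eq_of_links links hrot hab hbc hd hd' hfree hfree' hj).2
  have h2 := (glue_eq_of_links links hrot hbc hce hd' hd'' hfree' hfree'' hj').2
  refine ⟨hbc.le, hd', fun a' b' D ha hb' hrun heq => ⟨?_, ?_⟩⟩ <;> by_contra hne
  · have h3 := hd.eq_right hrun hab (lt_of_le_of_ne ha hne) (hbc.le.trans hb') hfree
    rw [heq ⟨le_rfl, hbc.le⟩] at h3
    exact h1 h3
  · have h3 := hd''.eq_left hrun hce (ha.trans hbc.le) (lt_of_le_of_ne hb' (Ne.symm hne)) hfree''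
    rw [heq ⟨hbc.le, le_rfl⟩] at h3
    exact h2 h3.symm

end Arcs

end TautTri

end

/-! ### Vertical loops are essential -/

noncomputable section

namespace TautTri

section Transport

variable {Tet : Type*} [Fintype Tet] {T : Triangulation Tet} {angle : Tet → Edge → ℝ}
  (μ : TautMatching angle) (hangle : T.IsTautAngleStructure angle)

/-- If the faces `a 0`, `a 1`, … are crossed in turn, always leaving a tetrahedron on the other side of
its equator, then the value transported from `(side (a 0), 1)` records the product of the
corresponding generators of the edge group. -/
theorem transport_apply {a : ℕ → Tet × Fin 4} {V : ℕ → Equiv.Perm (Bool × μ.EdgeGroup hangle)}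
    (hV : ∀ k, V (k + 1) = μ.cross hangle (a k) * V k)
    (hside : ∀ k, μ.side (T.opp (a k)).1 (T.opp (a k)).2 ≠ μ.side (a (k + 1)).1 (a (k + 1)).2)
    (k : ℕ) : (V k * (V 0)⁻¹) (μ.side (a 0).1 (a 0).2, 1) =
      (μ.side (a k).1 (a k).2, (((List.range k).map a).map (μ.gen hangle)).prod) := by
  induction k with
  | zero => simp
  | succ k ih =>
    rw [hV, mul_assoc, Equiv.Perm.mul_apply, ih]
    change μ.crossFun hangle (a k) _ = _
    rw [TautMatching.crossFun, if_pos rfl, List.range_succ, List.map_append, List.map_append,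
      List.prod_append]
    exact Prod.ext (Bool.eq_not_iff.2 (hside k).symm).symm (by simp)

end Transport

theorem IsVertical.not_homotopic_refl {Tet : Type*} [Fintype Tet] {T : Triangulation Tet}
    {M : Type*} [TopologicalSpace M] [ChartedSpace (EuclideanHalfSpace 3) M]
    {h : M ≃ₜ ↥(T.vertexNbhdᶜ)} {angle : Tet → Edge → ℝ} (hangle : T.IsTautAngleStructure angle)
    {δ : C(Circle, M)} (hδ : IsVertical T h angle δ) :
    ¬ (loopPath δ).Homotopic (Path.refl (δ 1)) := by
  intro hnull
  obtain ⟨μ⟩ := nonempty_tautMatching hangle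
  have hrot : ∀ s : Flag Tet, s.2.1 ≠ s.2.2 → T.rot s ≠ s := fun s hs => μ.rot_ne_self hangle hs
  let f : M → T.Realisation := fun m => h m
  have hf : Continuous f := continuous_subtype_val.comp h.continuous
  have hfc : Continuous fun s => f (param δ s) := hf.comp (continuous_param δ)
  -- The times at which the loop meets the two-skeleton.
  let S : Set ℝ := {s | param δ s ∈ surf T h}
  have hS : IsClosed S :=
    ⟨Triangulation.isOpen_compl_skeleton2.preimage hfc⟩
  obtain ⟨σ, n, hn, hσS, hσlt, hσfree, hσper⟩ := exists_enumeration hS hδ.meets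
    (fun s hs => by
      change param δ (s + 1) ∈ surf T h
      rw [param_add_one]; exact hs)
    (fun s hs => by
      change param δ (s + 1) ∈ surf T h at hs
      rw [param_add_one] at hs; exact hs)
    (fun b => by
      by_cases hb : b ∈ S
      · exact eventually_notMem_surf hδ.embedded.contMDiff hδ.transverse hb
      · exact mem_nhdsWithin_of_mem_nhds (hS.isOpen_compl.mem_nhds hb))
  have hfree : ∀ k, AvoidsBetween T h δ (σ k) (σ (k + 1)) := hσfree
  have hlift : ∀ k, ∃ (t : Tet) (d : ℝ → Simplex3), RunsAlong T h δ t (σ k) (σ (k + 1)) d :=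
    fun k => Triangulation.exists_lift hfc (hσlt k) (hσfree k)
  choose t d hd using hlift
  have hexit : ∀ k, ∃ j, (d k (σ (k + 1))).1 j = 0 := fun k => by
    refine (Triangulation.mk_mem_skeleton2 (T := T) (z := ⟨t k, d k (σ (k + 1))⟩)).1 ?_
    exact (congrArg (· ∈ T.skeleton2) ((hd k).2 _ ⟨(hσlt k).le, le_rfl⟩)).mpr (hσS (k + 1))
  choose j hj using hexit
  let a : ℕ → Tet × Fin 4 := fun k => (t k, j k)
  have hglue : ∀ k, T.glue (a k) (d k (σ (k + 1))) = ⟨t (k + 1), d (k + 1) (σ (k + 1))⟩ := fun k =>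
    (glue_eq_of_links hδ.links hrot (hσlt k) (hσlt (k + 1)) (hd k) (hd (k + 1)) (hfree k)
      (hfree (k + 1)) (hj k)).1
  -- The arcs link the equators, so they leave a tetrahedron on the other side.
  have hside : ∀ k,
      μ.side (T.opp (a k)).1 (T.opp (a k)).2 ≠ μ.side (a (k + 1)).1 (a (k + 1)).2 := by
    intro k
    have harc := isArc_of_links hδ.links hrot (hσlt k) (hσlt (k + 1)) (hσlt (k + 2)) (hd k)
      (hd (k + 1)) (hd (k + 2)) (hfree k) (hfree (k + 1)) (hfree (k + 2)) (hσS (k + 1))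
      (hσS (k + 2))
    have hsep := hδ.links _ _ _ _ harc
    have ht : (T.opp (a k)).1 = t (k + 1) := congrArg Sigma.fst (hglue k)
    rw [ht]
    refine μ.side_ne_of_separated hsep (hangle.zero_or_pi _) ?_ (hj (k + 1))
    have h1 := T.glue_coord_opp (a := a k) (x := d k (σ (k + 1))) (hj k)
    rw [hglue k] at h1
    exact h1
  let _ : TopologicalSpace (Equiv.Perm (Bool × μ.EdgeGroup hangle)) := ⊥
  have : DiscreteTopology (Equiv.Perm (Bool × μ.EdgeGroup hangle)) := ⟨rfl⟩
  obtain ⟨v, hvper, hvglue, hvarc⟩ := Triangulation.exists_transport (ρ := μ.cross hangle) f hf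
    (fun m => T.exists_localSection _ (μ.cross_opp hangle)
      (fun s hs _ hfix => μ.holonomy_eq_one hangle hs hfix) _
      (Triangulation.exists_pos_of_notMem_vertexNbhd (by
        rw [Quot.out_eq]
        exact (h m).2)))
    (loopPath δ) hnull (c := param δ) (param_add_one δ) fun _ => rfl
  let V : ℕ → Equiv.Perm (Bool × μ.EdgeGroup hangle) := fun k => v (σ k) ⟨t k, d k (σ k)⟩
  have hV : ∀ k, V (k + 1) = μ.cross hangle (a k) * V k := by
    intro k
    change v (σ (k + 1)) _ = _
    rw [← hglue k, hvglue _ _ _ ((hd k).2 _ ⟨(hσlt k).le, le_rfl⟩) (hj k)]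
    exact congrArg _ (hvarc _ _ _ _ (hσlt k).le (hd k).1 (hd k).2).symm
  -- After one period the loop is at the same point of the same tetrahedron.
  have hclose : V n = V 0 := by
    have hσn : σ n = σ 0 + 1 := by simpa using hσper 0
    have hσn1 : σ (n + 1) = σ 1 + 1 := by rw [Nat.add_comm]; exact hσper 1
    have hshift : RunsAlong T h δ (t 0) (σ n) (σ (n + 1)) fun s => d 0 (s - 1) := by
      constructor
      · refine (hd 0).1.comp (by fun_prop) fun s hs => ?_
        rw [hσn, hσn1] at hs
        exact ⟨by linarith [hs.1], by linarith [hs.2]⟩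
      · intro s hs
        rw [hσn, hσn1] at hs
        rw [(hd 0).2 (s - 1) ⟨by linarith [hs.1], by linarith [hs.2]⟩, ← param_add_one,
          sub_add_cancel]
    have h1 := (hd n).eq hshift (hσlt n) (hfree n) ⟨le_rfl, (hσlt n).le⟩
    simp only [V]
    rw [h1, hσn, hvper, add_sub_cancel_right]
  have hprod := transport_apply μ hangle hV hside n
  rw [hclose, mul_inv_cancel, Equiv.Perm.one_apply] at hprod
  refine (μ.relations hangle).prod_ne_one (l := (List.range n).map a) ?_ (congrArg Prod.snd hprod).symm
  simpa using hn

end TautTri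

end

theorem theorem3p2
    {Tet : Type*} [Fintype Tet] (T : TautTri.Triangulation Tet)
    {M : Type*} [TopologicalSpace M] [ChartedSpace (EuclideanHalfSpace 3) M]
    [IsManifold (𝓡∂ 3) ∞ M] [CompactSpace M] [ConnectedSpace M]
    (h : M ≃ₜ ↥(T.vertexNbhdᶜ))
    (angle : Tet → TautTri.Edge → ℝ) (hangle : T.IsTautAngleStructure angle)
    (hB : TautTri.IsBranchedSurface T h angle)
    (δ : C(Circle, M)) (hδ : TautTri.IsVertical T h angle δ) :
    FundamentalGroup.fromPath (Path.Homotopic.Quotient.mk (TautTri.loopPath δ)) ≠ 1 :=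
  fun htriv => hδ.not_homotopic_refl hangle (Path.Homotopic.Quotient.eq.1 htriv)
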